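/- Let $\Sigma$ be a finite alphabet. A WDBA is a deterministic Büchi automaton with finitely many states, all reachable, in which every maximal strongly connected component (MSCC) is contained in or disjoint from the set of accepting states. Let $U\subseteq\Sigma^\omega$ be recognized by some WDBA, and let $D\subseteq\Sigma^\omega$ have trivial right-congruence, i.e. $u\alpha\in D\Leftrightarrow v\alpha\in D$ for all $u,v\in\Sigma^*$, $\alpha\in\Sigma^\omega$. Write $L\equiv_D L'$ if $L\setminus D=L'\setminus D$; $u\sim_{U,D}v$ if $u\alpha\in U\Leftrightarrow v\alpha\in U$ for all $\alpha\notin D$; and let $n=\mathrm{Ind}(\sim_{U,D})$ be the number of classes of $\sim_{U,D}$. A WDBA $\mathcal H$ is $D$-minimal if no WDBA $\mathcal B$ with $L(\mathcal B)\equiv_D L(\mathcal H)$ has fewer states. Both $U$ and $D$ are unknown to the learner. A teacher answers queries $\mathrm{MEMBER}(u,v)$, $u\in\Sigma^*$, $v\in\Sigma^+$, by "yes" if $uv^\omega\in U\setminus D$, "no" if $uv^\omega\notin U\cup D$, "don't care" if $uv^\omega\in D$; and queries $\mathrm{EQUIV}(\mathcal H)$ for a WDBA $\mathcal H$ either by confirming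 $L(\mathcal H)\equiv_D U$ or by a counterexample $uv^\omega\notin D$, given as a pair $(u,v)$ of length $|u|+|v|$, that lies in exactly one of $L(\mathcal H)$ and $U$. The teacher's choice of counterexamples is arbitrary and may depend on the history. Consider the following algorithm, with a set $S$ of finite words and a set $E$ of ultimately periodic words, starting with $S=\{\epsilon\}$, $E=\emptyset$. For $s\in S\cup S\Sigma$ let the row $f_s:E\to\{\text{yes},\text{no}\}$ be given by $f_s(uv^\omega)=f(s,uv^\omega)=\mathrm{MEMBER}(su,v)$. 1. While some $t\in S\Sigma$ has $f_t\neq f_s$ for all $s\in S$, add such a $t$ to $S$. Then let $T$ be the transition system with state set $S$, initial state $\epsilon$, and $\delta(s,\sigma)$ the unique $t\in S$ with $f_{s\sigma}=f_t$. 2. For all $s\in S$, $\alpha\in E$, mark the states visited infinitely often by $T$ on $s\alpha$ with $f(s,\alpha)$. If some "yes"-marked $s$ and "no"-marked $t$ are in the same MSCC, choose words $z,w,x,y$ leading in $T$ from $s$ to $t$, $t$ to $s$, $s$ to $s$, $t$ to $t$, respectively, such that $x^\omega,y^\omega\in E$ are the suffixes causing the marks (so $sx^\omega\in U$, $ty^\omega\notin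 U$). For $k=1,2,\dots$, with $z'=x^kz$ and $w'=y^kw$, test by membership queries, in this order, whether $sz'y^\omega\in U$; $tw'x^\omega\notin U$; and for $i=1,\dots,k$ whether $s(z'w')^ix^\omega\notin U$; $t(w'z')^iw'x^\omega\notin U$; $s(z'w')^iz'y^\omega\in U$; $t(w'z')^iy^\omega\in U$. At the first success, add the tested word without its leading $s$ or $t$, and all suffixes of it, to $E$ (with $x^\omega,y^\omega$ written with the periods they have in $E$), and go to step 1. 3. If there is no such pair $s,t$, ask $\mathrm{EQUIV}(\mathcal H)$ for $\mathcal H=(T,F)$, where $F$ is the set of states whose MSCC has no "no"-marked state. On a counterexample, add it and all its suffixes to $E$ and go to step 1; otherwise return $\mathcal H$. Then, for every such $U$, $D$ and every correct teacher, (an explicit implementation of) this algorithm terminates and returns a $D$-minimal WDBA $\mathcal H$ with $L(\mathcal H)\equiv_D U$. Its running time, counting elementary steps on list cells and the lengths of queries and answers, is at most $p(n,\ell,|\Sigma|)$, where $\ell$ is the length of a longest counterexample received during the run ($0$ if there is none), and $p$ is a polynomial independent of $\Sigma$, $U$, $D$ and the teacher; in particular, for a fixed alphabet it is polynomial in $n$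 and $\ell$. Moreover, no membership query of the algorithm concerns a word of $D$. -/

import Mathlib

/-! # Active learning of weak deterministic Büchi automata with unknown don't-care words

Infinite words over `A` are Mathlib streams `Stream' A`; finite words are lists.  A deterministic
Büchi automaton `(Σ, Q, δ, q₀, F)` is the same tuple as a Mathlib `DFA A Q`; only the acceptance of
infinite words is new.
-/

namespace WDBALearning

open Filter

section Automata

variable {A : Type}

/-- The infinity set of `α`: the states visited infinitely often by the run of `M` on `α`. -/
def infSet {Q : Type} (M : DFA A Q) (α : Stream' A) : Set Q :=
  {q | ∃ᶠ i in atTop, M.eval (α.take i) = q}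

/-- Büchi acceptance: some accepting state is visited infinitely often. -/
def omegaLang {Q : Type} (M : DFA A Q) : Set (Stream' A) :=
  {α | (infSet M α ∩ M.accept).Nonempty}

/-- The maximal strongly connected component of `q`. -/
def mscc {Q : Type} (M : DFA A Q) (q : Q) : Set Q :=
  {p | (∃ u, M.evalFrom q u = p) ∧ (∃ v, M.evalFrom p v = q)}

/-- Weak deterministic Büchi automata: finitely many states, all of them reachable, and each
maximal strongly connected component is contained in, or disjoint from, the accepting states. -/
structure IsWDBA {Q : Type} (M : DFA A Q) : Prop where
  finite : Finite Q
  reachable : ∀ q, ∃ w, M.eval w = q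
  weak : ∀ q, mscc M q ⊆ M.accept ∨ Disjoint (mscc M q) M.accept

/-- `U` is recognized by some WDBA. -/
def WDBARecognizable (U : Set (Stream' A)) : Prop :=
  ∃ (Q : Type) (M : DFA A Q), IsWDBA M ∧ omegaLang M = U

/-- `L ≡_D L'`. -/
def DEquiv (D L L' : Set (Stream' A)) : Prop := L \ D = L' \ D

/-- A WDBA is `D`-minimal if no WDBA with a `D`-equivalent language has fewer states. -/
def IsDMinimal (D : Set (Stream' A)) {Q : Type} (M : DFA A Q) : Prop :=
  ∀ (Q' : Type) (M' : DFA A Q'), IsWDBA M' → DEquiv D (omegaLang M) (omegaLang M') →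
    Nat.card Q ≤ Nat.card Q'

/-- The relation `u ∼_{L,D} v`: `uα ∈ L ↔ vα ∈ L` for all `α ∉ D`. -/
def dCongr (L D : Set (Stream' A)) : Setoid (List A) where
  r u v := ∀ α : Stream' A, α ∉ D → (u ++ₛ α ∈ L ↔ v ++ₛ α ∈ L)
  iseqv := ⟨fun _ _ _ => Iff.rfl, fun h α hα => (h α hα).symm,
    fun h h' α hα => (h α hα).trans (h' α hα)⟩

/-- `Ind(∼_{L,D})`, the number of classes. -/
noncomputable def index (L D : Set (Stream' A)) : ℕ := Nat.card (Quotient (dCongr L D))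

/-- `D` has trivial right-congruence: the canonical right-congruence
`∼_D = ∼_{D,∅}` has a single class. -/
def TrivialRightCongruence (D : Set (Stream' A)) : Prop :=
  ∀ u v : List A, (dCongr D ∅).r u v

/-- The ultimately periodic word `u v^ω`. -/
def ultPeriodic (u v : List A) (hv : v ≠ []) : Stream' A := u ++ₛ Stream'.cycle v hv

end Automata

/-! ## Hypotheses, queries and teachers -/

/-- The concrete description of a hypothesis automaton which the learner writes down. States are
named by finite words; `trans` is a table of triples `(p, a, q)` meaning `δ(p, a) = q`. -/
structure Hypothesis (A : Type) where
  start : List A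
  states : List (List A)
  trans : List (List A × A × List A)
  accepting : List (List A)

section Queries

variable {A : Type}

/-- The automaton described by `H`. (A missing or dangling entry of the table is read as a
transition to the initial state.) -/
def Hypothesis.toDFA [DecidableEq A] (H : Hypothesis A) :
    DFA A {q : List A // q ∈ H.start :: H.states} where
  step q a :=
    match H.trans.find? (fun e => decide (e.1 = q.1 ∧ e.2.1 = a)) with
    | some e => if h : e.2.2 ∈ H.start :: H.states then ⟨e.2.2, h⟩
        else ⟨H.start, List.mem_cons_self⟩
    | none => ⟨H.start, List.mem_cons_self⟩
  start := ⟨H.start, List.mem_cons_self⟩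
  accept := {q | q.1 ∈ H.accepting}

/-- The number of symbols in the written description of `H`. -/
def Hypothesis.size (H : Hypothesis A) : ℕ :=
  (H.start.length + 1) + (H.states.map (fun q => q.length + 1)).sum +
    (H.trans.map (fun e => e.1.length + e.2.2.length + 3)).sum +
    (H.accepting.map (fun q => q.length + 1)).sum

/-- Answers to a membership query. -/
inductive Answer where
  | yes
  | no
  | dontCare

/-- `true` exactly on the answer "yes". -/
def Answer.isYes : Answer → Bool
  | .yes => true
  | .no => false
  | .dontCare => false

/-- A query together with its answer. A pair `(u, v)` stands for `u v^ω`; the answer `none` to an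
equivalence query is the confirmation of the hypothesis. -/
inductive Event (A : Type) where
  | member (u v : List A) (ans : Answer)
  | equiv (H : Hypothesis A) (ans : Option (List A × List A))

/-- The length of a counterexample `u v^ω` given as `(u, v)`; `0` for a confirmation. -/
def cexLength : Option (List A × List A) → ℕ
  | none => 0
  | some (u, v) => u.length + v.length

/-- The length of a longest counterexample in a list of events (`0` if there is none). -/
def longestCex : List (Event A) → ℕ
  | [] => 0
  | .member _ _ _ :: h => longestCex h
  | .equiv _ ans :: h => max (cexLength ans) (longestCex h)

/-- A teacher. Its choice of a counterexample may depend on everything that has been asked and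
answered before. -/
structure Teacher (A : Type) where
  member : List A → List A → Answer
  equiv : List (Event A) → Hypothesis A → Option (List A × List A)

/-- The teacher answers `MEMBER(u, v)` correctly for all `u ∈ Σ*`, `v ∈ Σ⁺`, and `EQUIV(H)`
correctly for all WDBA `H`. Nothing is required for ill-formed queries. -/
structure Teacher.IsCorrect [DecidableEq A] (T : Teacher A) (U D : Set (Stream' A)) : Prop where
  member_yes : ∀ u v (hv : v ≠ []), ultPeriodic u v hv ∈ U \ D → T.member u v = .yes
  member_no : ∀ u v (hv : v ≠ []), ultPeriodic u v hv ∉ U ∪ D → T.member u v = .no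
  member_dontCare : ∀ u v (hv : v ≠ []), ultPeriodic u v hv ∈ D → T.member u v = .dontCare
  equiv_none : ∀ h (H : Hypothesis A), IsWDBA H.toDFA → T.equiv h H = none →
    DEquiv D (omegaLang H.toDFA) U
  equiv_some : ∀ h (H : Hypothesis A) u v, IsWDBA H.toDFA → T.equiv h H = some (u, v) →
    ∃ hv : v ≠ [], ultPeriodic u v hv ∉ D ∧
      ultPeriodic u v hv ∈ (omegaLang H.toDFA \ U) ∪ (U \ omegaLang H.toDFA)

end Queries

/-! ## Programs with queries, and their running time -/

/-- Programs that compute a value of type `R`, take elementary steps and ask queries. -/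
inductive Prog (A R : Type) : Type where
  | ret (r : R)
  | tick (p : Prog A R)
  | member (u v : List A) (k : Answer → Prog A R)
  | equiv (H : Hypothesis A) (k : Option (List A × List A) → Prog A R)

namespace Prog

variable {A R R' : Type}

/-- Sequential composition. -/
def bind : Prog A R → (R → Prog A R') → Prog A R'
  | .ret r, f => f r
  | .tick p, f => .tick (p.bind f)
  | .member u v k, f => .member u v (fun ans => (k ans).bind f)
  | .equiv H k, f => .equiv H (fun ans => (k ans).bind f)

instance : Monad (Prog A) where
  pure := Prog.ret
  bind := Prog.bind

/-- Execution against the teacher `T` after the events `h`: the result, the time, and all events so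
far. An elementary step takes one unit of time. A query takes time linear in its own length plus
the length of its answer. -/
def run (T : Teacher A) : Prog A R → List (Event A) → R × ℕ × List (Event A)
  | .ret r, h => (r, 0, h)
  | .tick p, h =>
      let o := p.run T h
      (o.1, o.2.1 + 1, o.2.2)
  | .member u v k, h =>
      let ans := T.member u v
      let o := (k ans).run T (h ++ [.member u v ans])
      (o.1, o.2.1 + (u.length + v.length + 1), o.2.2)
  | .equiv H k, h =>
      let ans := T.equiv h H
      let o := (k ans).run T (h ++ [.equiv H ans])
      (o.1, o.2.1 + (H.size + cexLength ans + 1), o.2.2)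

end Prog

/-! ## The learning algorithm

Cost discipline: every call of every function below, recursive calls included, takes one elementary
step (`step1`), and between two such steps a function only applies constructors, matches on
constructors, compares two letters or two truth values, and asks queries. Thus each list operation
is paid for cell by cell, and numbers are unary. -/

section Learner

variable {A : Type}

/-- One elementary step. -/
def step1 : Prog A Unit := .tick (.ret ())

/-- Ask `MEMBER(u, v)`; the result tells whether the answer is "yes". -/
def askMember (u v : List A) : Prog A Bool := do
  step1
  Prog.member u v (fun ans => .ret ans.isYes)

/-- Ask `EQUIV(H)`. -/
def askEquiv (H : Hypothesis A) : Prog A (Option (List A × List A)) := do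
  step1
  Prog.equiv H .ret

/-- Concatenation of lists. -/
def append {B : Type} : List B → List B → Prog A (List B)
  | [], w => do
      step1
      return w
  | a :: u, w => do
      step1
      let r ← append u w
      return a :: r

/-- Equality test for lists of letters or of truth values. -/
def eqList {B : Type} [DecidableEq B] : List B → List B → Prog A Bool
  | [], [] => do
      step1
      return true
  | a :: u, b :: w => do
      step1
      if a = b then eqList u w else return false
  | [], _ :: _ => do
      step1
      return false
  | _ :: _, [] => do
      step1
      return false

/-- The power `w^k`. -/
def power (w : List A) : ℕ → Prog A (List A)
  | 0 => do
      step1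
      return []
  | k + 1 => do
      step1
      let r ← power w k
      append w r

/-- `a w ↦ w a`. -/
def rotateOne : List A → Prog A (List A)
  | [] => do
      step1
      return []
  | a :: w => do
      step1
      append w [a]

/-! ### The observation table

Columns are pairs `(u, v)`, standing for `u v^ω`. -/

/-- The rotations `(todo ++ done)^ω, …` of a periodic word, one for each letter of `todo`. -/
def rotations : List A → List A → Prog A (List (List A × List A))
  | [], _ => do
      step1
      return []
  | a :: todo, done => do
      step1
      let v ← append (a :: todo) done
      let done' ← append done [a]
      let rest ← rotations todo done'
      return ([], v) :: rest

/-- All suffixes of `u v^ω`. -/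
def suffixes (v : List A) : List A → Prog A (List (List A × List A))
  | [] => do
      step1
      rotations v []
  | a :: u => do
      step1
      let rest ← suffixes v u
      return (a :: u, v) :: rest

/-- Add `u v^ω` and its suffixes to `E`. -/
def addSuffixes (u v : List A) (E : List (List A × List A)) :
    Prog A (List (List A × List A)) := do
  step1
  let X ← suffixes v u
  append X E

/-- The row `f_s`, listed along `E`. -/
def fillRow (s : List A) : List (List A × List A) → Prog A (List Bool)
  | [] => do
      step1
      return []
  | (u, v) :: E => do
      step1
      let su ← append s u
      let b ← askMember su v
      let r ← fillRow s E
      return b :: r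

/-- The rows of all `s ∈ S`. -/
def fillRows (E : List (List A × List A)) : List (List A) → Prog A (List (List A × List Bool))
  | [] => do
      step1
      return []
  | s :: S => do
      step1
      let r ← fillRow s E
      let R ← fillRows E S
      return (s, r) :: R

/-- Look for `t ∈ S` with row `r`. -/
def findRow (r : List Bool) : List (List A × List Bool) → Prog A (Option (List A))
  | [] => do
      step1
      return none
  | (t, r') :: R => do
      step1
      let b ← eqList r r'
      if b then return some t else findRow r R

/-- The transitions `δ_f(s, a)` for the given letters `a`, or a word `sa` whose row differs from
all rows of `S`. -/
def transFrom (rows : List (List A × List Bool)) (E : List (List A × List A)) (s : List A) :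
    List A → Prog A (List A ⊕ List (List A × A × List A))
  | [] => do
      step1
      return .inr []
  | a :: as => do
      step1
      let sa ← append s [a]
      let r ← fillRow sa E
      let o ← findRow r rows
      match o with
      | none => return .inl sa
      | some t => do
          let rest ← transFrom rows E s as
          match rest with
          | .inl m => return .inl m
          | .inr l => return .inr ((s, a, t) :: l)

/-- The transition table of `T_{S,f}` if the observation table is closed, and otherwise some
`t ∈ SΣ` with `f_t ≠ f_s` for all `s ∈ S`. -/
def transAll (rows : List (List A × List Bool)) (E : List (List A × List A)) (letters : List A) :
    List (List A) → Prog A (List A ⊕ List (List A × A × List A))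
  | [] => do
      step1
      return .inr []
  | s :: S => do
      step1
      let o ← transFrom rows E s letters
      match o with
      | .inl m => return .inl m
      | .inr l => do
          let rest ← transAll rows E letters S
          match rest with
          | .inl m => return .inl m
          | .inr l' => do
              let l'' ← append l l'
              return .inr l''

/-! ### Runs and strong connectedness in a transition table -/

variable [DecidableEq A]

/-- `δ(q, a)`. -/
def lookup (q : List A) (a : A) : List (List A × A × List A) → Prog A (List A)
  | [] => do
      step1
      return []
  | (p, b, t) :: l => do
      step1
      if b = a then do
        let e ← eqList p q
        if e then return t else lookup q a l
      else lookup q a l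

/-- `δ*(q, w)`. -/
def runFrom (tr : List (List A × A × List A)) : List A → List A → Prog A (List A)
  | q, [] => do
      step1
      return q
  | q, a :: w => do
      step1
      let q' ← lookup q a tr
      runFrom tr q' w

/-- In a list of pairs (state, word leading to it), find the word of the state `q`. -/
def findPath (q : List A) : List (List A × List A) → Prog A (Option (List A))
  | [] => do
      step1
      return none
  | (p, w) :: L => do
      step1
      let e ← eqList p q
      if e then return some w else findPath q L

/-- Add the successors of `q` (reached by the word `w`) that are not in `L` yet. -/
def expandLetters (tr : List (List A × A × List A)) (q w : List A) :
    List A → List (List A × List A) → Prog A (List (List A × List A))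
  | [], L => do
      step1
      return L
  | a :: as, L => do
      step1
      let q' ← lookup q a tr
      let o ← findPath q' L
      match o with
      | some _ => expandLetters tr q w as L
      | none => do
          let w' ← append w [a]
          expandLetters tr q w as ((q', w') :: L)

/-- One round of the reachability search: expand all listed states. -/
def expandAll (tr : List (List A × A × List A)) (letters : List A) :
    List (List A × List A) → List (List A × List A) → Prog A (List (List A × List A))
  | [], L => do
      step1
      return L
  | (q, w) :: todo, L => do
      step1
      let L' ← expandLetters tr q w letters L
      expandAll tr letters todo L'

/-- As many rounds as the first list (the list of all states) has elements. -/
def saturate (tr : List (List A × A × List A)) (letters : List A) :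
    List (List A) → List (List A × List A) → Prog A (List (List A × List A))
  | [], L => do
      step1
      return L
  | _ :: S, L => do
      step1
      let L' ← expandAll tr letters L L
      saturate tr letters S L'

/-- A word leading from `p` to `q`, if there is one. -/
def pathTo (S : List (List A)) (tr : List (List A × A × List A)) (letters : List A)
    (p q : List A) : Prog A (Option (List A)) := do
  step1
  let L ← saturate tr letters S [(p, [])]
  findPath q L

/-- If `s` and `t` are in the same MSCC, words `z` and `w` leading from `s` to `t` and back. -/
def connect (S : List (List A)) (tr : List (List A × A × List A)) (letters : List A)
    (s t : List A) : Prog A (Option (List A × List A)) := do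
  step1
  let o ← pathTo S tr letters s t
  match o with
  | none => return none
  | some z => do
      let o' ← pathTo S tr letters t s
      match o' with
      | none => return none
      | some w => return some (z, w)

/-! ### Marking -/

/-- The mark `bit` at `state`. It comes with the reason: the state was visited infinitely often by
the run on some `sα` in the table, `loop` is a word leading from `state` back to itself, and
`loop^ω = per^ω` is the suffix of `α` that is read from there on. -/
structure Mark (A : Type) where
  state : List A
  loop : List A
  per : List A
  bit : Bool

/-- The state reached from `q` by reading `v` once for each element of the first list. -/
def iterateRun (tr : List (List A × A × List A)) (v : List A) :
    List (List A) → List A → Prog A (List A)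
  | [], q => do
      step1
      return q
  | _ :: S, q => do
      step1
      let q' ← runFrom tr q v
      iterateRun tr v S q'

/-- For a state `p` on a `v`-cycle, the power of `v` that leads around the cycle once. -/
def loopWord (tr : List (List A × A × List A)) (v p : List A) :
    List (List A) → List A → List A → Prog A (List A)
  | [], _, acc => do
      step1
      return acc
  | _ :: S, q, acc => do
      step1
      let q' ← runFrom tr q v
      let acc' ← append acc v
      let e ← eqList q' p
      if e then return acc' else loopWord tr v p S q' acc'

/-- Mark the states on a cycle; `todo` remains to be read on it, `done` has been read, and `v` is the
current rotation of the period. -/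
def walk (tr : List (List A × A × List A)) (b : Bool) :
    List A → List A → List A → List A → Prog A (List (Mark A))
  | [], _, _, _ => do
      step1
      return []
  | a :: todo, done, v, q => do
      step1
      let x ← append (a :: todo) done
      let done' ← append done [a]
      let v' ← rotateOne v
      let q' ← lookup q a tr
      let rest ← walk tr b todo done' v' q'
      return ⟨q, x, v, b⟩ :: rest

/-- Mark the states in `Inf(sα)` according to `f(s, α)`, for all `α ∈ E`. -/
def markRow (S : List (List A)) (tr : List (List A × A × List A)) (s : List A) :
    List (List A × List A) → List Bool → Prog A (List (Mark A))
  | (u, v) :: E, b :: r => do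
      step1
      let su ← append s u
      let q ← runFrom tr [] su
      let p ← iterateRun tr v S q
      let c ← loopWord tr v p S p []
      let m ← walk tr b c [] v p
      let rest ← markRow S tr s E r
      append m rest
  | [], _ => do
      step1
      return []
  | _ :: _, [] => do
      step1
      return []

/-- All marks, for all `s ∈ S` and `α ∈ E`. -/
def markAll (S : List (List A)) (tr : List (List A × A × List A)) (E : List (List A × List A)) :
    List (List A × List Bool) → Prog A (List (Mark A))
  | [] => do
      step1
      return []
  | (s, r) :: rows => do
      step1
      let m ← markRow S tr s E r
      let rest ← markAll S tr E rows
      append m rest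

/-- The data of a failed marking: `z` leads from `s` to `t`, `w` leads from `t` to `s`, `x` leads
from `s` to `s`, `y` leads from `t` to `t`, `s x^ω ∈ U` and `t y^ω ∉ U`. The words `x^ω` and `y^ω` are
columns of the table, where they are written with the periods `xper` and `yper`. -/
structure Conflict (A : Type) where
  s : List A
  t : List A
  x : List A
  xper : List A
  y : List A
  yper : List A
  z : List A
  w : List A

/-- Look for a "no" mark in the MSCC of the "yes" mark `m`. -/
def conflictWith (S : List (List A)) (tr : List (List A × A × List A)) (letters : List A)
    (m : Mark A) : List (Mark A) → Prog A (Option (Conflict A))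
  | [] => do
      step1
      return none
  | m' :: ms => do
      step1
      if m'.bit then conflictWith S tr letters m ms
      else do
        let o ← connect S tr letters m.state m'.state
        match o with
        | some (z, w) =>
            return some ⟨m.state, m'.state, m.loop, m.per, m'.loop, m'.per, z, w⟩
        | none => conflictWith S tr letters m ms

/-- Look for a "yes" mark (in the last argument) and a "no" mark (in `marks`) in the same MSCC. The
marking fails iff there are such marks. -/
def findConflict (S : List (List A)) (tr : List (List A × A × List A)) (letters : List A)
    (marks : List (Mark A)) : List (Mark A) → Prog A (Option (Conflict A))
  | [] => do
      step1
      return none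
  | m :: ms => do
      step1
      if m.bit then do
        let o ← conflictWith S tr letters m marks
        match o with
        | some c => return some c
        | none => findConflict S tr letters marks ms
      else findConflict S tr letters marks ms

/-- Is there a "no" mark in the MSCC of `q`? -/
def rejecting (S : List (List A)) (tr : List (List A × A × List A)) (letters : List A)
    (q : List A) : List (Mark A) → Prog A Bool
  | [] => do
      step1
      return false
  | m :: ms => do
      step1
      if m.bit then rejecting S tr letters q ms
      else do
        let o ← connect S tr letters q m.state
        match o with
        | some _ => return true
        | none => rejecting S tr letters q ms

/-- The states (in the last argument) whose MSCC has no "no" mark. -/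
def acceptingStates (S : List (List A)) (tr : List (List A × A × List A)) (letters : List A)
    (marks : List (Mark A)) : List (List A) → Prog A (List (List A))
  | [] => do
      step1
      return []
  | q :: S' => do
      step1
      let b ← rejecting S tr letters q marks
      let F ← acceptingStates S tr letters marks S'
      if b then return F else return q :: F

/-! ### Conflict resolution -/

/-- The loop over `i = 1, …, k` (the number counts the remaining rounds, `P = (z'w')^(i-1)` and
`R = (w'z')^(i-1)`). The result `(v, p)` stands for the word `v p^ω`. -/
def tryPowers (c : Conflict A) (z' w' zw wz : List A) :
    ℕ → List A → List A → Prog A (Option (List A × List A))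
  | 0, _, _ => do
      step1
      return none
  | j + 1, P₀, R₀ => do
      step1
      let P ← append zw P₀
      let R ← append wz R₀
      let sP ← append c.s P
      let b₁ ← askMember sP c.xper
      if !b₁ then return some (P, c.xper)
      else do
        let Rw ← append R w'
        let tRw ← append c.t Rw
        let b₂ ← askMember tRw c.xper
        if !b₂ then return some (Rw, c.xper)
        else do
          let Pz ← append P z'
          let sPz ← append c.s Pz
          let b₃ ← askMember sPz c.yper
          if b₃ then return some (Pz, c.yper)
          else do
            let tR ← append c.t R
            let b₄ ← askMember tR c.yper
            if b₄ then return some (R, c.yper)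
            else tryPowers c z' w' zw wz j P R

/-- The candidates for a distinguishing experiment for one value of `k`. -/
def tryExponent (c : Conflict A) (k : ℕ) : Prog A (Option (List A × List A)) := do
  step1
  let xk ← power c.x k
  let z' ← append xk c.z
  let yk ← power c.y k
  let w' ← append yk c.w
  let sz ← append c.s z'
  let b ← askMember sz c.yper
  if b then return some (z', c.yper)
  else do
    let tw ← append c.t w'
    let b' ← askMember tw c.xper
    if !b' then return some (w', c.xper)
    else do
      let zw ← append z' w'
      let wz ← append w' z'
      tryPowers c z' w' zw wz k [] []

/-! ### The main loop -/

/-- What the algorithm is doing: working on the table `(S, E)`; looking for a distinguishing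
experiment with the current value `k`; or it has returned `H`. -/
inductive Config (A : Type) where
  | table (S : List (List A)) (E : List (List A × List A))
  | search (S : List (List A)) (E : List (List A × List A)) (c : Conflict A) (k : ℕ)
  | done (H : Hypothesis A)

/-- One round of the algorithm. -/
def round (letters : List A) : Config A → Prog A (Config A)
  | .table S E => do
      step1
      let rows ← fillRows E S
      let o ← transAll rows E letters S
      match o with
      | .inl t => return .table (t :: S) E
      | .inr tr => do
          let marks ← markAll S tr E rows
          let oc ← findConflict S tr letters marks marks
          match oc with
          | some c => return .search S E c 1
          | none => do
              let F ← acceptingStates S tr letters marks S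
              let H : Hypothesis A := ⟨[], S, tr, F⟩
              let ans ← askEquiv H
              match ans with
              | none => return .done H
              | some (u, v) => do
                  let E' ← addSuffixes u v E
                  return .table S E'
  | .search S E c k => do
      step1
      let o ← tryExponent c k
      match o with
      | none => return .search S E c (k + 1)
      | some (u, v) => do
          let E' ← addSuffixes u v E
          return .table S E'
  | .done H => return .done H

/-- The situation after `m` rounds with the teacher `T`: the configuration, the total time, and all
queries so far with their answers. At the beginning, `S = {ε}` and `E = ∅`. -/
def learn (T : Teacher A) (letters : List A) : ℕ → Config A × ℕ × List (Event A)
  | 0 => (.table [[]] [], 0, [])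
  | m + 1 =>
      let c := learn T letters m
      let o := (round letters c.1).run T c.2.2
      (o.1, c.2.1 + o.2.1, o.2.2)

end Learner

end WDBALearning

open WDBALearning

namespace WDBALearning

/-! ## Executions of programs without equivalence queries -/

section Runs

variable {A : Type} {R R' : Type}

/-- All events are membership queries about non-empty periods, not answered "don't care". -/
def MemberEvents (evs : List (Event A)) : Prop :=
  ∀ e ∈ evs, ∃ u v ans, e = Event.member u v ans ∧ v ≠ [] ∧ ans ≠ Answer.dontCare

/-- Whatever happened before, `p` returns `r` within time `t` and asks only membership queries about
words outside of `D`. -/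
def Runs (T : Teacher A) (p : Prog A R) (r : R) (t : ℕ) : Prop :=
  ∀ h, ∃ t' ≤ t, ∃ evs, MemberEvents evs ∧ p.run T h = (r, t', h ++ evs)

theorem Prog.run_bind (T : Teacher A) (p : Prog A R) (f : R → Prog A R') (h : List (Event A)) :
    (p >>= f).run T h =
      (((f (p.run T h).1).run T (p.run T h).2.2).1,
        (p.run T h).2.1 + ((f (p.run T h).1).run T (p.run T h).2.2).2.1,
        ((f (p.run T h).1).run T (p.run T h).2.2).2.2) := by
  change (p.bind f).run T h = _
  induction p generalizing h with
  | ret r => simp [Prog.bind, Prog.run]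
  | tick p ih => simp [Prog.bind, Prog.run, ih]; omega
  | member u v k ih => simp [Prog.bind, Prog.run, ih]; omega
  | equiv H k ih => simp [Prog.bind, Prog.run, ih]; omega

variable {T : Teacher A}

theorem Runs.mono {p : Prog A R} {r : R} {t t' : ℕ} (hp : Runs T p r t) (h : t ≤ t') :
    Runs T p r t' := fun hist => by
  obtain ⟨s, hs, evs, he, hr⟩ := hp hist
  exact ⟨s, hs.trans h, evs, he, hr⟩

theorem Runs.pure (r : R) (t : ℕ) : Runs T (pure r : Prog A R) r t := fun h =>
  ⟨0, Nat.zero_le _, [], by simp [MemberEvents], by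
    change (Prog.ret r).run T h = _
    simp [Prog.run]⟩

theorem Runs.bind {p : Prog A R} {f : R → Prog A R'} {r : R} {r' : R'} {t t' : ℕ}
    (hp : Runs T p r t) (hf : Runs T (f r) r' t') : Runs T (p >>= f) r' (t + t') := fun h => by
  obtain ⟨s, hs, evs, he, hr⟩ := hp h
  obtain ⟨s', hs', evs', he', hr'⟩ := hf (h ++ evs)
  refine ⟨s + s', by omega, evs ++ evs', ?_, ?_⟩
  · intro e h
    rcases List.mem_append.1 h with h | h
    exacts [he e h, he' e h]
  · rw [Prog.run_bind, hr]
    simp [hr']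

theorem Runs.step1 : Runs T step1 () 1 := fun h =>
  ⟨1, le_rfl, [], by simp [MemberEvents], by simp [WDBALearning.step1, Prog.run]⟩

theorem Runs.step {p : Prog A R} {r : R} {t t' : ℕ} (hp : Runs T p r t) (ht : t + 1 ≤ t') :
    Runs T (WDBALearning.step1 >>= fun _ => p) r t' :=
  (Runs.step1.bind (f := fun _ => p) hp).mono (by omega)

/-- The first step of a program whose value is known. -/
theorem Runs.run_bind {p : Prog A R} {f : R → Prog A R'} {r : R} {t : ℕ} (hp : Runs T p r t)
    (h : List (Event A)) : ∃ t' ≤ t, ∃ evs, MemberEvents evs ∧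
      (p >>= f).run T h = (((f r).run T (h ++ evs)).1, t' + ((f r).run T (h ++ evs)).2.1,
        ((f r).run T (h ++ evs)).2.2) := by
  obtain ⟨s, hs, evs, he, hr⟩ := hp h
  exact ⟨s, hs, evs, he, by rw [Prog.run_bind, hr]⟩

/-- The answer to the membership query about `u v^ω`. -/
def ask (T : Teacher A) (u v : List A) : Bool := (T.member u v).isYes

theorem runs_askMember {u v : List A} (hv : v ≠ []) (ha : T.member u v ≠ .dontCare) :
    Runs T (askMember u v) (ask T u v) (u.length + v.length + 2) := by
  unfold askMember
  refine Runs.step (t := u.length + v.length + 1) ?_ (by omega)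
  exact fun h => ⟨_, le_rfl, [.member u v (T.member u v)], by simpa [MemberEvents] using ⟨hv, ha⟩,
    by simp [Prog.run, ask]⟩

theorem runs_append {B : Type} (u w : List B) :
    Runs T (append u w) (u ++ w) (u.length + 1) := by
  induction u with
  | nil => exact Runs.step (Runs.pure _ 0) (by simp)
  | cons a u ih =>
    unfold append
    exact Runs.step (ih.bind (Runs.pure _ 0)) (by simp)

theorem runs_eqList {B : Type} [DecidableEq B] (u w : List B) :
    Runs T (eqList u w) (decide (u = w)) (min u.length w.length + 1) := by
  induction u generalizing w with
  | nil =>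
    cases w with
    | nil => exact Runs.step (Runs.pure _ 0) (by simp)
    | cons b w => exact Runs.step (Runs.pure _ 0) (by simp)
  | cons a u ih =>
    cases w with
    | nil => exact Runs.step (Runs.pure _ 0) (by simp)
    | cons b w =>
      unfold eqList
      refine Runs.step (t := min u.length w.length + 1) ?_ (by simp)
      split_ifs with h
      · simpa [h] using ih w
      · simpa [h] using Runs.pure _ _

theorem runs_power (w : List A) (k : ℕ) :
    Runs T (power w k) (List.replicate k w).flatten (k * (w.length + 2) + 1) := by
  induction k with
  | zero => exact Runs.step (Runs.pure _ 0) (by simp)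
  | succ k ih =>
    unfold power
    refine Runs.step (ih.bind (runs_append _ _)) ?_
    rw [Nat.succ_mul]; omega

theorem runs_rotateOne (w : List A) : Runs T (rotateOne w) (w.rotate 1) (w.length + 1) := by
  cases w with
  | nil => exact Runs.step (Runs.pure _ 0) (by simp)
  | cons a w =>
    unfold rotateOne
    refine Runs.step (t := w.length + 1) ?_ (by simp)
    simpa using runs_append w [a]

end Runs

/-! ## Periodic words -/

section Streams

variable {A : Type}

/-- The word `v^ω` is `α`. -/
def IsOmega (v : List A) (α : Stream' A) : Prop := v ≠ [] ∧ v ++ₛ α = α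

/-- The power `w^k` of a word. -/
abbrev pow (w : List A) (k : ℕ) : List A := (List.replicate k w).flatten

theorem pow_succ (w : List A) (k : ℕ) : pow w (k + 1) = w ++ pow w k := by
  simp [pow, List.replicate_succ]

theorem pow_add (w : List A) (j k : ℕ) : pow w (j + k) = pow w j ++ pow w k := by
  rw [pow, List.replicate_add, List.flatten_append]

theorem pow_one (w : List A) : pow w 1 = w := by simp [pow]

theorem length_pow (w : List A) (k : ℕ) : (pow w k).length = k * w.length := by
  simp [pow]

theorem isOmega_cycle (v : List A) (hv : v ≠ []) : IsOmega v (Stream'.cycle v hv) :=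
  ⟨hv, (Stream'.cycle_eq v hv).symm⟩

theorem IsOmega.pow_append {v : List A} {α : Stream' A} (h : IsOmega v α) (k : ℕ) :
    pow v k ++ₛ α = α := by
  induction k with
  | zero => simp [pow]
  | succ k ih => rw [pow_succ, Stream'.append_append_stream, ih, h.2]

theorem IsOmega.pow {v : List A} {α : Stream' A} (h : IsOmega v α) {k : ℕ} (hk : k ≠ 0) :
    IsOmega (pow v k) α := by
  refine ⟨?_, h.pow_append k⟩
  obtain ⟨k, rfl⟩ := Nat.exists_eq_succ_of_ne_zero hk
  rw [Nat.succ_eq_add_one, pow_succ]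
  simp [h.1]

theorem take_length_append (u : List A) (α : Stream' A) : (u ++ₛ α).take u.length = u := by
  induction u with
  | nil => simp
  | cons a u ih => simp [Stream'.cons_append_stream, ih]

theorem IsOmega.unique {v : List A} {α β : Stream' A} (h : IsOmega v α) (h' : IsOmega v β) :
    α = β := by
  apply Stream'.take_theorem
  intro n
  have hn : n ≤ (WDBALearning.pow v n).length := by
    rw [length_pow]
    exact Nat.le_mul_of_pos_right _ (List.length_pos_iff.2 h.1)
  rw [← h.pow_append n, ← h'.pow_append n, Stream'.take_append_of_le_length _ _ _ hn,
    Stream'.take_append_of_le_length _ _ _ hn]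

theorem IsOmega.eq_cycle {v : List A} {α : Stream' A} (h : IsOmega v α) :
    Stream'.cycle v h.1 = α :=
  (isOmega_cycle v h.1).unique h

theorem IsOmega.tail {a : A} {v : List A} {α : Stream' A} (h : IsOmega (a :: v) α) :
    IsOmega (v ++ [a]) α.tail := by
  refine ⟨by simp, ?_⟩
  have h2 : α.tail = v ++ₛ α := by
    conv_lhs => rw [← h.2]
    rfl
  have h3 : (v ++ [a]) ++ₛ α.tail = v ++ₛ ((a :: v) ++ₛ α) := by
    rw [h2, ← Stream'.append_append_stream, ← Stream'.append_append_stream]; simp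
  rw [h3, h.2, h2]

/-- The column `(u, v)` stands for the word `u v^ω = α`. -/
def Denotes (e : List A × List A) (α : Stream' A) : Prop := ∃ β, IsOmega e.2 β ∧ α = e.1 ++ₛ β

theorem Denotes.ne_nil {e : List A × List A} {α : Stream' A} (h : Denotes e α) : e.2 ≠ [] := by
  obtain ⟨β, h, -⟩ := h
  exact h.1

theorem Denotes.eq {e : List A × List A} {α : Stream' A} (h : Denotes e α) :
    ultPeriodic e.1 e.2 h.ne_nil = α := by
  obtain ⟨β, h, rfl⟩ := h
  simp [ultPeriodic, h.eq_cycle]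

theorem denotes_ultPeriodic (u v : List A) (hv : v ≠ []) :
    Denotes (u, v) (ultPeriodic u v hv) := ⟨_, isOmega_cycle v hv, rfl⟩

theorem Denotes.unique {e : List A × List A} {α β : Stream' A} (h : Denotes e α)
    (h' : Denotes e β) : α = β := h.eq.symm.trans h'.eq

theorem Denotes.append {e : List A × List A} {α : Stream' A} (h : Denotes e α) (s : List A) :
    Denotes (s ++ e.1, e.2) (s ++ₛ α) := by
  obtain ⟨β, h, rfl⟩ := h
  exact ⟨β, h, by simp⟩

end Streams

/-! ## Pigeonhole -/

theorem exists_lt_eq_of_mem {B : Type} {S : List B} {k : ℕ} (hk : S.length ≤ k) (g : ℕ → B)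
    (hg : ∀ i ≤ k, g i ∈ S) : ∃ i j, i < j ∧ j ≤ k ∧ g i = g j := by
  classical
  obtain ⟨i, hi, j, hj, hne, h⟩ := Finset.exists_ne_map_eq_of_card_lt_of_maps_to
    (s := Finset.range (k + 1)) (t := S.toFinset) (f := g)
    (by rw [Finset.card_range]; exact Nat.lt_succ_of_le ((List.toFinset_card_le _).trans hk))
    (by intro i hi; simpa using hg i (by simpa [Nat.lt_succ_iff] using hi))
  simp only [Finset.mem_range, Nat.lt_succ_iff] at hi hj
  rcases lt_or_gt_of_ne hne with h' | h'
  exacts [⟨i, j, h', hj, h⟩, ⟨j, i, h', hi, h.symm⟩]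

theorem exists_lt_eq_of_card {Q : Type} [Finite Q] {k : ℕ} (hk : Nat.card Q ≤ k) (g : ℕ → Q) :
    ∃ i j, i < j ∧ j ≤ k ∧ g i = g j := by
  have := Fintype.ofFinite Q
  rw [Nat.card_eq_fintype_card] at hk
  exact exists_lt_eq_of_mem (S := Finset.univ.toList) (by simpa using hk) g (by simp)

/-! ## Weak automata on periodic words -/

section Automata

variable {A Q : Type} {M : DFA A Q}

theorem take_add (α : Stream' A) (i j : ℕ) :
    α.take (i + j) = α.take i ++ (α.drop i).take j := by
  induction i generalizing α with
  | zero => simp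
  | succ i ih => rw [Nat.succ_add, Stream'.take_succ, ih, Stream'.take_succ, Stream'.drop_succ]; rfl

theorem infSet_subset_mscc {α : Stream' A} {p q : Q} (hp : p ∈ infSet M α) (hq : q ∈ infSet M α) :
    q ∈ mscc M p := by
  have key : ∀ p q, p ∈ infSet M α → q ∈ infSet M α → ∃ u, M.evalFrom p u = q := by
    intro p q hp hq
    obtain ⟨i, -, hi⟩ := Filter.frequently_atTop.1 hp 0
    obtain ⟨j, hij, hj⟩ := Filter.frequently_atTop.1 hq i
    obtain ⟨k, rfl⟩ := Nat.exists_eq_add_of_le hij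
    refine ⟨(α.drop i).take k, ?_⟩
    rw [← hi, ← hj, take_add]
    simp [DFA.eval, DFA.evalFrom_of_append]
  exact ⟨key p q hp hq, key q p hq hp⟩

theorem mem_omegaLang_iff (hM : IsWDBA M) {α : Stream' A} {q : Q} (hq : q ∈ infSet M α) :
    α ∈ omegaLang M ↔ q ∈ M.accept := by
  refine ⟨?_, fun h => ⟨q, hq, h⟩⟩
  rintro ⟨p, hp, hpa⟩
  have hqp := infSet_subset_mscc hp hq
  rcases hM.weak p with h | h
  · exact h hqp
  · exact absurd hpa (Set.disjoint_left.1 h ⟨⟨[], rfl⟩, ⟨[], rfl⟩⟩)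

theorem mem_infSet_of_loop {x u : List A} {α : Stream' A} (hx : IsOmega x α)
    (h : M.evalFrom (M.eval u) x = M.eval u) : M.eval u ∈ infSet M (u ++ₛ α) := by
  refine Filter.frequently_atTop.2 fun N => ⟨u.length + (pow x N).length, ?_, ?_⟩
  · rw [length_pow]
    exact (Nat.le_mul_of_pos_right _ (List.length_pos_iff.2 hx.1)).trans (Nat.le_add_left _ _)
  · have : ∀ k, M.evalFrom (M.eval u) (pow x k) = M.eval u := by
      intro k
      induction k with
      | zero => rfl
      | succ k ih => rw [pow_succ, DFA.evalFrom_of_append, h, ih]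
    rw [← List.length_append, ← hx.pow_append N, ← Stream'.append_append_stream,
      take_length_append, DFA.eval, DFA.evalFrom_of_append]
    exact this N

/-- After the `k`-th power of `x`, a run with at most `k` states is on a cycle. -/
theorem exists_evalFrom_pow_eq [Finite Q] {k : ℕ} (hk : Nat.card Q ≤ k) (q : Q) (x : List A) :
    ∃ d, d ≠ 0 ∧ M.evalFrom (M.evalFrom q (pow x k)) (pow x d) = M.evalFrom q (pow x k) := by
  obtain ⟨i, j, hij, hj, h⟩ := exists_lt_eq_of_card hk fun i => M.evalFrom q (pow x i)
  obtain ⟨d, rfl⟩ := Nat.exists_eq_add_of_lt hij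
  obtain ⟨l, rfl⟩ := Nat.exists_eq_add_of_le hj
  refine ⟨d + 1, by omega, ?_⟩
  rw [← DFA.evalFrom_of_append, ← pow_add,
    show i + d + 1 + l + (d + 1) = (i + d + 1) + (d + 1 + l) by omega, pow_add, pow_add x (d + 1) l,
    DFA.evalFrom_of_append, ← h, ← DFA.evalFrom_of_append, ← List.append_assoc, ← pow_add,
    ← pow_add, show i + (d + 1) + l = i + d + 1 + l by omega]

theorem mem_infSet_of_pow [Finite Q] {k : ℕ} (hk : Nat.card Q ≤ k) {x u : List A} {α : Stream' A}
    (hx : IsOmega x α) : M.eval (u ++ pow x k) ∈ infSet M (u ++ₛ α) := by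
  obtain ⟨d, hd, h⟩ := exists_evalFrom_pow_eq (M := M) hk (M.eval u) x
  rw [← hx.pow_append k, ← Stream'.append_append_stream]
  apply mem_infSet_of_loop (hx.pow hd)
  simpa [DFA.eval, DFA.evalFrom_of_append] using h

theorem mem_omegaLang_iff_pow (hM : IsWDBA M) {k : ℕ} (hk : Nat.card Q ≤ k) {x : List A} (u : List A)
    {α : Stream' A} (hx : IsOmega x α) :
    u ++ₛ α ∈ omegaLang M ↔ M.eval (u ++ pow x k) ∈ M.accept := by
  have := hM.finite
  exact mem_omegaLang_iff hM (mem_infSet_of_pow hk hx)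

/-- A weak automaton with at most `k` states cannot alternate `k` times between words that have to be
accepted and words that have to be rejected. -/
theorem not_forall_alternating (hM : IsWDBA M) {k : ℕ} (hk : Nat.card Q ≤ k)
    {s x y z w : List A} {α β : Stream' A} (hx : IsOmega x α) (hy : IsOmega y β)
    (hα : ∀ i ≤ k, s ++ pow (pow x k ++ z ++ (pow y k ++ w)) i ++ₛ α ∈ omegaLang M)
    (hβ : ∀ i ≤ k, s ++ pow (pow x k ++ z ++ (pow y k ++ w)) i ++ (pow x k ++ z) ++ₛ β
      ∉ omegaLang M) : False := by
  have := hM.finite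
  set g := pow x k ++ z ++ (pow y k ++ w) with hg
  obtain ⟨i, j, hij, hj, h⟩ := exists_lt_eq_of_card hk fun i => M.eval (s ++ pow g i ++ pow x k)
  obtain ⟨d, rfl⟩ := Nat.exists_eq_add_of_lt hij
  have h1 := (mem_omegaLang_iff_pow hM hk _ hx).1 (hα i (by omega))
  have h2 := fun hh => hβ i (by omega) ((mem_omegaLang_iff_pow hM hk _ hy).2 hh)
  have hr : M.eval (s ++ pow g i ++ (pow x k ++ z) ++ pow y k) ∈
      mscc M (M.eval (s ++ pow g i ++ pow x k)) := by
    refine ⟨⟨z ++ pow y k, ?_⟩, ⟨w ++ pow g d ++ pow x k, ?_⟩⟩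
    · simp [DFA.eval, DFA.evalFrom_of_append]
    · rw [h, show i + d + 1 = i + (1 + d) by omega, pow_add, pow_add, pow_one, hg]
      simp [DFA.eval, DFA.evalFrom_of_append]
  rcases hM.weak (M.eval (s ++ pow g i ++ pow x k)) with hw | hw
  · exact h2 (hw hr)
  · exact Set.disjoint_left.1 hw ⟨⟨[], rfl⟩, ⟨[], rfl⟩⟩ h1

end Automata

/-! ## The right-congruence -/

section Congruence

variable {A : Type} {U D : Set (Stream' A)}

theorem TrivialRightCongruence.append_mem_iff (hD : TrivialRightCongruence D) (u : List A)
    (α : Stream' A) : u ++ₛ α ∈ D ↔ α ∈ D := by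
  simpa using hD u [] α (by simp)

theorem dCongr_append (hD : TrivialRightCongruence D) {u v : List A} (h : (dCongr U D).r u v)
    (w : List A) : (dCongr U D).r (u ++ w) (v ++ w) := fun α hα => by
  simpa using h (w ++ₛ α) (by rwa [hD.append_mem_iff])

theorem infSet_append {Q : Type} (M : DFA A Q) (u : List A) (α : Stream' A) :
    infSet M (u ++ₛ α) = {q | ∃ᶠ i in Filter.atTop, M.evalFrom (M.eval u) (α.take i) = q} := by
  ext q
  simp only [infSet, Set.mem_ofPred_eq, Filter.frequently_atTop]
  have key : ∀ i, M.eval ((u ++ₛ α).take (u.length + i)) = M.evalFrom (M.eval u) (α.take i) := by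
    intro i
    rw [take_add, take_length_append, Stream'.drop_append_stream, DFA.eval,
      DFA.evalFrom_of_append]
  constructor
  · intro h N
    obtain ⟨i, hi, h⟩ := h (u.length + N)
    obtain ⟨j, rfl⟩ := Nat.exists_eq_add_of_le (le_trans (Nat.le_add_right _ _) hi)
    exact ⟨j, by omega, by rw [← key, h]⟩
  · intro h N
    obtain ⟨i, hi, h⟩ := h N
    exact ⟨u.length + i, by omega, by rw [key, h]⟩

theorem append_mem_omegaLang_congr {Q : Type} {M : DFA A Q} {u v : List A}
    (h : M.eval u = M.eval v) (α : Stream' A) :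
    u ++ₛ α ∈ omegaLang M ↔ v ++ₛ α ∈ omegaLang M := by
  simp only [omegaLang, Set.mem_ofPred_eq, infSet_append, h]

theorem WDBARecognizable.finite_quotient (hU : WDBARecognizable U) (D : Set (Stream' A)) :
    Finite (Quotient (dCongr U D)) := by
  obtain ⟨Q, M, hM, rfl⟩ := hU
  have := hM.finite
  choose w hw using hM.reachable
  refine Finite.of_surjective (fun q => Quotient.mk (dCongr (omegaLang M) D) (w q)) fun c => ?_
  induction c using Quotient.inductionOn with
  | h u => exact ⟨M.eval u, Quotient.sound fun α _ => append_mem_omegaLang_congr (hw _) α⟩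

theorem WDBARecognizable.index_pos (hU : WDBARecognizable U) (D : Set (Stream' A)) :
    1 ≤ index U D := by
  have := hU.finite_quotient D
  have : Nonempty (Quotient (dCongr U D)) := ⟨Quotient.mk _ []⟩
  exact Nat.card_pos

theorem exists_lt_dCongr (hU : WDBARecognizable U) {k : ℕ} (hk : index U D ≤ k) (g : ℕ → List A) :
    ∃ i j, i < j ∧ j ≤ k ∧ (dCongr U D).r (g i) (g j) := by
  have := hU.finite_quotient D
  obtain ⟨i, j, hij, hj, h⟩ := exists_lt_eq_of_card hk fun i => Quotient.mk (dCongr U D) (g i)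
  exact ⟨i, j, hij, hj, Quotient.exact h⟩

/-- After the `k`-th power of `x`, a run in the right-congruence is on a cycle. -/
theorem exists_dCongr_pow (hU : WDBARecognizable U) (hD : TrivialRightCongruence D) {k : ℕ}
    (hk : index U D ≤ k) (s x : List A) :
    ∃ d, d ≠ 0 ∧ (dCongr U D).r (s ++ pow x k ++ pow x d) (s ++ pow x k) := by
  obtain ⟨i, j, hij, hj, h⟩ := exists_lt_dCongr (D := D) hU hk fun i => s ++ pow x i
  obtain ⟨d, rfl⟩ := Nat.exists_eq_add_of_lt hij
  obtain ⟨l, rfl⟩ := Nat.exists_eq_add_of_le hj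
  refine ⟨d + 1, by omega, ?_⟩
  have e1 : s ++ pow x (i + d + 1 + l) ++ pow x (d + 1) =
      s ++ pow x (i + d + 1) ++ pow x (d + 1 + l) := by
    rw [List.append_assoc, List.append_assoc, ← pow_add, ← pow_add]
    congr 2; omega
  have e2 : s ++ pow x (i + d + 1 + l) = s ++ pow x i ++ pow x (d + 1 + l) := by
    rw [List.append_assoc, ← pow_add]
    congr 2; omega
  rw [e1, e2]
  exact (dCongr U D).symm (dCongr_append hD h _)

theorem dCongr_pow (hD : TrivialRightCongruence D) {s x : List A}
    (h : (dCongr U D).r (s ++ x) s) (k : ℕ) : (dCongr U D).r (s ++ pow x k) s := by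
  induction k with
  | zero => simp [pow]
  | succ k ih =>
    rw [pow_succ, ← List.append_assoc]
    exact (dCongr U D).trans (dCongr_append hD h _) ih

/-- The bound on the exponent in the search for a distinguishing experiment. -/
theorem not_forall_alternating_of_index_le (hU : WDBARecognizable U)
    (hD : TrivialRightCongruence D) {k : ℕ} (hk : index U D ≤ k) {s x y z w : List A}
    {α β : Stream' A} (hx : IsOmega x α) (hy : IsOmega y β) (hαD : α ∉ D) (hβD : β ∉ D)
    (hα : ∀ i ≤ k, s ++ pow (pow x k ++ z ++ (pow y k ++ w)) i ++ₛ α ∈ U)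
    (hβ : ∀ i ≤ k, s ++ pow (pow x k ++ z ++ (pow y k ++ w)) i ++ (pow x k ++ z) ++ₛ β ∉ U) :
    False := by
  set g := pow x k ++ z ++ (pow y k ++ w) with hg
  obtain ⟨i, j, hij, hj, hc⟩ :=
    exists_lt_dCongr (D := D) hU hk fun i => s ++ pow g i ++ pow x k
  obtain ⟨l, rfl⟩ := Nat.exists_eq_add_of_lt hij
  obtain ⟨d, hd, hxd⟩ := exists_dCongr_pow hU hD hk (s ++ pow g i) x
  obtain ⟨e, he, hye⟩ := exists_dCongr_pow hU hD hk (s ++ pow g i ++ pow x k ++ z) y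
  have hα' := hα i (by omega)
  have hβ' := hβ i (by omega)
  rw [← hx.pow_append k, ← Stream'.append_append_stream] at hα'
  rw [← hy.pow_append k, ← Stream'.append_append_stream] at hβ'
  obtain ⟨Q, M, hM, rfl⟩ := hU
  set G := s ++ pow g i ++ pow x k with hG
  have h1 : (dCongr (omegaLang M) D).r (G ++ pow (pow x d) (Nat.card Q) ++ (z ++ pow y k))
      (G ++ z ++ pow y k) := by
    rw [List.append_assoc G]
    simpa using dCongr_append hD (dCongr_pow hD hxd (Nat.card Q)) (z ++ pow y k)
  have h2 : (dCongr (omegaLang M) D).r (G ++ (pow (pow x d) (Nat.card Q) ++ (z ++ pow y k)) ++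
      (pow (pow y e) (Nat.card Q) ++ (w ++ pow g l ++ pow x k))) G := by
    refine (dCongr _ D).trans (dCongr_append hD (by simpa using h1) _) ?_
    have h3 := dCongr_append hD (dCongr_pow hD hye (Nat.card Q)) (w ++ pow g l ++ pow x k)
    rw [List.append_assoc _ (pow (pow y e) _)] at h3
    refine (dCongr _ D).trans (by simpa using h3) ?_
    have h4 := (dCongr _ D).symm hc
    rw [show i + l + 1 = i + (1 + l) by omega, pow_add, pow_add, pow_one] at h4
    simpa [hg, hG] using h4
  refine not_forall_alternating hM le_rfl (s := G) (z := z ++ pow y k)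
    (w := w ++ pow g l ++ pow x k) (hx.pow hd) (hy.pow he) (fun m _ => ?_) (fun m _ => ?_)
  · exact (dCongr_pow hD (by simpa using h2) m α hαD).2 hα'
  · have h5 := dCongr_append hD (dCongr_pow hD (by simpa using h2) m)
      (pow (pow x d) (Nat.card Q) ++ (z ++ pow y k))
    refine fun hh => hβ' ?_
    have h6 := ((dCongr _ D).trans h5 (by simpa using h1)) β hβD
    simpa [hG] using h6.1 (by simpa using hh)

end Congruence

/-! ## Observation tables -/

section Tables

variable {A : Type}

/-- The words that the columns in `E` stand for. -/
def cols (E : List (List A × List A)) : Set (Stream' A) := {α | ∃ e ∈ E, Denotes e α}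

/-- No word of `X` distinguishes `s` from `t`. -/
def Eqv (U X : Set (Stream' A)) (s t : List A) : Prop :=
  ∀ α ∈ X, s ++ₛ α ∈ U ↔ t ++ₛ α ∈ U

/-- `δ` is the transition function of the closed table with rows `S` and columns `X`. -/
structure IsTrans (U X : Set (Stream' A)) (S : List (List A)) (δ : List A → A → List A) : Prop where
  mem : ∀ s ∈ S, ∀ a, δ s a ∈ S
  eqv : ∀ s ∈ S, ∀ a, Eqv U X (s ++ [a]) (δ s a)

/-- The invariants of the observation table: `ℓ` and `L` bound the periods and the initial parts of the
columns. -/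
structure IsTable (U D : Set (Stream' A)) (S : List (List A)) (E : List (List A × List A))
    (ℓ L : ℕ) : Prop where
  nil_mem : [] ∈ S
  nodup : S.Nodup
  prefix_mem : ∀ s a, s ++ [a] ∈ S → s ∈ S
  length_le : ∀ s ∈ S, s.length ≤ S.length
  distinct : ∀ s ∈ S, ∀ t ∈ S, Eqv U (cols E) s t → s = t
  period_ne_nil : ∀ e ∈ E, e.2 ≠ []
  period_length : ∀ e ∈ E, e.2.length ≤ ℓ
  initial_length : ∀ e ∈ E, e.1.length ≤ L
  notMem : ∀ α ∈ cols E, α ∉ D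
  tail_mem : ∀ α ∈ cols E, α.tail ∈ cols E

variable {U D X : Set (Stream' A)} {S : List (List A)} {E : List (List A × List A)} {ℓ L : ℕ}
  {δ δ' : List A → A → List A}

theorem Eqv.symm {s t : List A} (h : Eqv U X s t) : Eqv U X t s := fun α hα => (h α hα).symm

theorem Eqv.trans {s t r : List A} (h : Eqv U X s t) (h' : Eqv U X t r) : Eqv U X s r :=
  fun α hα => (h α hα).trans (h' α hα)

theorem Eqv.mono {Y : Set (Stream' A)} {s t : List A} (h : Eqv U Y s t) (hXY : X ⊆ Y) :
    Eqv U X s t := fun α hα => h α (hXY hα)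

theorem IsTrans.foldl_mem (h : IsTrans U X S δ) {s : List A} (hs : s ∈ S) (w : List A) :
    w.foldl δ s ∈ S := by
  induction w generalizing s with
  | nil => exact hs
  | cons a w ih => exact ih (h.mem s hs a)

theorem tails_mem (hX : ∀ α ∈ X, α.tail ∈ X) (u : List A) {β : Stream' A} (h : u ++ₛ β ∈ X) :
    β ∈ X := by
  induction u with
  | nil => simpa using h
  | cons a u ih => exact ih (by simpa [Stream'.cons_append_stream] using hX _ h)

/-- In a closed table, words of the table can be read off along the transitions. -/
theorem IsTrans.append_mem_iff (h : IsTrans U X S δ) (hX : ∀ α ∈ X, α.tail ∈ X) {s : List A}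
    (hs : s ∈ S) (u : List A) {β : Stream' A} (hβ : u ++ₛ β ∈ X) :
    s ++ₛ (u ++ₛ β) ∈ U ↔ u.foldl δ s ++ₛ β ∈ U := by
  induction u generalizing s with
  | nil => simp
  | cons a u ih =>
    have hu : u ++ₛ β ∈ X := tails_mem hX [a] (by simpa [Stream'.cons_append_stream] using hβ)
    have h1 := h.eqv s hs a _ hu
    have h2 := ih (h.mem s hs a) hu
    rw [List.foldl_cons, ← h2, ← h1]
    simp [Stream'.cons_append_stream]

theorem IsTable.foldl_nil (hS : IsTable U D S E ℓ L) (h : IsTrans U (cols E) S δ) :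
    ∀ s ∈ S, s.foldl δ [] = s := by
  intro s
  induction s using List.reverseRecOn with
  | nil => simp
  | append_singleton s a ih =>
    intro hs
    have hs' := hS.prefix_mem s a hs
    rw [List.foldl_append, ih hs']
    exact hS.distinct _ (h.mem s hs' a) _ hs (h.eqv s hs' a).symm

theorem IsTrans.mono {Y : Set (Stream' A)} (h : IsTrans U Y S δ) (hXY : X ⊆ Y) :
    IsTrans U X S δ :=
  ⟨h.mem, fun s hs a => (h.eqv s hs a).mono hXY⟩

theorem IsTable.foldl_congr (hS : IsTable U D S E ℓ L) (h : IsTrans U (cols E) S δ)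
    (h' : IsTrans U (cols E) S δ') {s : List A} (hs : s ∈ S) (w : List A) :
    w.foldl δ' s = w.foldl δ s := by
  induction w generalizing s with
  | nil => rfl
  | cons a w ih =>
    have : δ' s a = δ s a := hS.distinct _ (h'.mem s hs a) _ (h.mem s hs a)
      ((h'.eqv s hs a).symm.trans (h.eqv s hs a))
    rw [List.foldl_cons, List.foldl_cons, this, ih (h.mem s hs a)]

theorem cols_subset_append (X E : List (List A × List A)) : cols E ⊆ cols (X ++ E) := by
  rintro α ⟨e, he, h⟩
  exact ⟨e, List.mem_append_right _ he, h⟩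

/-- The rows of the table are pairwise inequivalent. -/
theorem IsTable.length_le_index (hS : IsTable U D S E ℓ L) (hU : WDBARecognizable U) :
    S.length ≤ index U D := by
  by_contra! hlt
  obtain ⟨i, j, hij, hj, h⟩ := exists_lt_dCongr (D := D) hU le_rfl
    fun i => S[i]?.getD []
  simp only [List.getElem?_eq_getElem (show i < S.length by omega),
    List.getElem?_eq_getElem (show j < S.length by omega), Option.getD_some] at h
  have := hS.distinct _ (List.getElem_mem _) _ (List.getElem_mem _)
    fun α hα => h α (hS.notMem α hα)
  exact absurd ((hS.nodup.getElem_inj_iff).1 this) (by omega)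

end Tables

/-! ## Correct answers -/

section Answers

variable {A : Type} [DecidableEq A] {T : Teacher A} {U D : Set (Stream' A)}

theorem Teacher.IsCorrect.ask_iff (hT : T.IsCorrect U D) {e : List A × List A} {α : Stream' A}
    (he : Denotes e α) (hα : α ∉ D) : ask T e.1 e.2 = true ↔ α ∈ U := by
  have h := he.eq
  by_cases hU : α ∈ U
  · rw [ask, hT.member_yes e.1 e.2 he.ne_nil (by rw [h]; exact ⟨hU, hα⟩)]
    simp [Answer.isYes, hU]
  · rw [ask, hT.member_no e.1 e.2 he.ne_nil (by rw [h]; simp [hU, hα])]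
    simp [Answer.isYes, hU]

theorem Teacher.IsCorrect.member_ne (hT : T.IsCorrect U D) {e : List A × List A} {α : Stream' A}
    (he : Denotes e α) (hα : α ∉ D) : T.member e.1 e.2 ≠ .dontCare := by
  have h := he.eq
  by_cases hU : α ∈ U
  · rw [hT.member_yes e.1 e.2 he.ne_nil (by rw [h]; exact ⟨hU, hα⟩)]
    simp
  · rw [hT.member_no e.1 e.2 he.ne_nil (by rw [h]; simp [hU, hα])]
    simp

/-- A membership query about a word outside of `D`. -/
theorem Teacher.IsCorrect.runs_askMember (hT : T.IsCorrect U D) {u v : List A} {α : Stream' A}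
    (he : Denotes (u, v) α) (hα : α ∉ D) :
    Runs T (askMember u v) (ask T u v) (u.length + v.length + 2) :=
  WDBALearning.runs_askMember he.ne_nil (hT.member_ne he hα)

end Answers

/-! ## Filling the table -/

section Fill

variable {A : Type} {T : Teacher A} {U D : Set (Stream' A)}
  {S : List (List A)} {E : List (List A × List A)} {ℓ L : ℕ}

/-- The row of `s`. -/
def row (T : Teacher A) (E : List (List A × List A)) (s : List A) : List Bool :=
  E.map fun e => ask T (s ++ e.1) e.2

theorem exists_denotes {e : List A × List A} (he : e.2 ≠ []) : ∃ α, Denotes e α :=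
  ⟨_, denotes_ultPeriodic e.1 e.2 he⟩

theorem row_eq_iff [DecidableEq A] (hT : T.IsCorrect U D) (hD : TrivialRightCongruence D)
    (hE : ∀ e ∈ E, e.2 ≠ []) (hED : ∀ α ∈ cols E, α ∉ D) (s t : List A) :
    row T E s = row T E t ↔ Eqv U (cols E) s t := by
  have key : ∀ (s : List A) (e) (α), e ∈ E → Denotes e α →
      (ask T (s ++ e.1) e.2 = true ↔ s ++ₛ α ∈ U) := fun s e α he h =>
    hT.ask_iff (h.append s) (by rw [hD.append_mem_iff]; exact hED α ⟨e, he, h⟩)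
  rw [row, row, List.map_inj_left]
  constructor
  · rintro h α ⟨e, he, hα⟩
    rw [← key s e α he hα, ← key t e α he hα, h e he]
  · intro h e he
    obtain ⟨α, hα⟩ := exists_denotes (hE e he)
    rw [Bool.eq_iff_iff, key s e α he hα, key t e α he hα]
    exact h α ⟨e, he, hα⟩

section Costs

variable {R : Type} [CommSemiring R]

/-- A bound for the time of `fillRow`. -/
def fillRowCost (N K ℓ L : R) : R := K * (2 * N + L + ℓ + 4) + 1

/-- A bound for the time of `transFrom`. -/
def transFromCost (N a K ℓ L : R) : R :=
  a * (1 + (N + 1) + fillRowCost (N + 1) K ℓ L + (N * (K + 2) + 1)) + 1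

/-- A bound for the time of `transAll`. -/
def transAllCost (N a K ℓ L : R) : R := N * (transFromCost N a K ℓ L + a + 2) + 1

/-- A bound for the time of `addSuffixes`. -/
def addSuffixesCost (L ℓ : R) : R := 1 + (L + (ℓ * (2 * ℓ + 3) + 2)) + (L + ℓ + 1)

end Costs

theorem runs_fillRow [DecidableEq A] (hT : T.IsCorrect U D) (hD : TrivialRightCongruence D)
    (hE : ∀ e ∈ E, e.2 ≠ []) (hED : ∀ α ∈ cols E, α ∉ D) (hℓ : ∀ e ∈ E, e.2.length ≤ ℓ)
    (hL : ∀ e ∈ E, e.1.length ≤ L) {N : ℕ} {s : List A} (hs : s.length ≤ N) :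
    Runs T (fillRow s E) (row T E s) (fillRowCost N E.length ℓ L) := by
  unfold fillRowCost
  induction E with
  | nil => exact Runs.step (Runs.pure _ 0) (by simp)
  | cons e E ih =>
    obtain ⟨u, v⟩ := e
    have hmem : (u, v) ∈ (u, v) :: E := List.mem_cons_self
    obtain ⟨α, hα⟩ := exists_denotes (hE _ hmem)
    have hsub : ∀ e ∈ E, e ∈ (u, v) :: E := fun e he => List.mem_cons_of_mem _ he
    have ih := ih (fun e he => hE e (hsub e he))
      (fun α ⟨e, he, h⟩ => hED α ⟨e, hsub e he, h⟩) (fun e he => hℓ e (hsub e he))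
      (fun e he => hL e (hsub e he))
    have ha := hT.runs_askMember (hα.append s)
      (by rw [hD.append_mem_iff]; exact hED α ⟨_, hmem, hα⟩)
    unfold fillRow
    refine Runs.step ((runs_append s u).bind (ha.bind (ih.bind (Runs.pure _ 0)))) ?_
    have h1 := hℓ _ hmem
    have h2 := hL _ hmem
    simp only [List.length_append, List.length_cons, Nat.succ_mul] at h1 h2 ⊢
    omega

theorem runs_fillRows {c : ℕ} (h : ∀ s ∈ S, Runs T (fillRow s E) (row T E s) c) :
    Runs T (fillRows E S) (S.map fun s => (s, row T E s)) (S.length * (c + 1) + 1) := by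
  induction S with
  | nil => exact Runs.step (Runs.pure _ 0) (by simp)
  | cons s S ih =>
    unfold fillRows
    refine Runs.step ((h s (by simp)).bind ((ih fun s hs => h s (by simp [hs])).bind
      (Runs.pure _ 0))) ?_
    simp only [List.length_cons, Nat.succ_mul]
    omega

theorem runs_findRow (g : List A → List Bool) (r : List Bool) :
    Runs T (findRow r (S.map fun s => (s, g s))) (S.find? fun s => r = g s)
      (S.length * (r.length + 2) + 1) := by
  induction S with
  | nil => exact Runs.step (Runs.pure _ 0) (by simp)
  | cons s S ih =>
    simp only [List.map_cons]
    unfold findRow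
    refine Runs.step (t := r.length + 1 + (S.length * (r.length + 2) + 1))
      (((runs_eqList r (g s)).mono (by omega)).bind ?_)
      (by simp only [List.length_cons, Nat.succ_mul]; omega)
    by_cases h : r = g s
    · rw [List.find?_cons_of_pos (by simpa using h)]
      simpa [h] using Runs.pure _ _
    · rw [List.find?_cons_of_neg (by simpa using h)]
      simpa [h] using ih

theorem runs_transFrom {N a' K c : ℕ} (hS : S.length ≤ N) (hK : E.length ≤ K) {s : List A}
    (hs : s.length ≤ N)
    (hc : ∀ a, Runs T (fillRow (s ++ [a]) E) (row T E (s ++ [a])) c) (as : List A)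
    (has : as.length = a') :
    ∃ o, Runs T (transFrom (S.map fun s => (s, row T E s)) E s as) o
        (a' * (1 + (N + 1) + c + (N * (K + 2) + 1)) + 1) ∧
      (∀ t, o = .inl t → (∃ a, t = s ++ [a]) ∧ ∀ s' ∈ S, row T E s' ≠ row T E t) ∧
      (∀ l, o = .inr l → l.length = a' ∧ (∀ a ∈ as, ∃ t, (s, a, t) ∈ l) ∧
        ∀ e ∈ l, e.1 = s ∧ e.2.2 ∈ S ∧ row T E (s ++ [e.2.1]) = row T E e.2.2) := by
  induction as generalizing a' with
  | nil =>
    refine ⟨.inr [], Runs.step (Runs.pure _ 0) (by simp), by simp, ?_⟩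
    rintro l ⟨⟩
    simp [← has]
  | cons a as ih =>
    obtain ⟨o, ho, h1, h2⟩ := ih rfl
    have hfr := runs_findRow (T := T) (S := S) (row T E) (row T E (s ++ [a]))
    have hle : S.length * ((row T E (s ++ [a])).length + 2) + 1 ≤ N * (K + 2) + 1 := by
      have : (row T E (s ++ [a])).length + 2 ≤ K + 2 := by simpa [row] using hK
      gcongr
    have hcost : ∀ t, t ≤ as.length * (1 + (N + 1) + c + (N * (K + 2) + 1)) + 1 →
        s.length + 1 + (c + (N * (K + 2) + 1 + t)) + 1 ≤
          a' * (1 + (N + 1) + c + (N * (K + 2) + 1)) + 1 := by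
      intro t ht
      rw [← has, List.length_cons, Nat.succ_mul]
      omega
    rcases hfind : S.find? (fun s' => row T E (s ++ [a]) = row T E s') with _ | t
    · refine ⟨.inl (s ++ [a]), ?_, ?_, by simp⟩
      · unfold transFrom
        refine Runs.step ((runs_append s [a]).bind ((hc a).bind ((hfr.mono hle).bind ?_)))
          (hcost 0 (by omega))
        rw [hfind]
        exact Runs.pure _ _
      · rintro t ⟨⟩
        refine ⟨⟨a, rfl⟩, fun s' hs' h => ?_⟩
        have := List.find?_eq_none.1 hfind s' hs'
        simp [h] at this
    · have ht := List.find?_some hfind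
      have htS := List.mem_of_find?_eq_some hfind
      rcases o with m | l
      · refine ⟨.inl m, ?_, ?_, by simp⟩
        · unfold transFrom
          refine Runs.step ((runs_append s [a]).bind ((hc a).bind ((hfr.mono hle).bind ?_)))
            (hcost (as.length * (1 + (N + 1) + c + (N * (K + 2) + 1)) + 1) le_rfl)
          rw [hfind]
          exact Runs.mono (Runs.bind ho (Runs.pure _ 0)) le_rfl
        · rintro t ⟨⟩
          exact h1 _ rfl
      · refine ⟨.inr ((s, a, t) :: l), ?_, by simp, ?_⟩
        · unfold transFrom
          refine Runs.step ((runs_append s [a]).bind ((hc a).bind ((hfr.mono hle).bind ?_)))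
            (hcost (as.length * (1 + (N + 1) + c + (N * (K + 2) + 1)) + 1) le_rfl)
          rw [hfind]
          exact Runs.mono (Runs.bind ho (Runs.pure _ 0)) le_rfl
        · rintro l' ⟨⟩
          obtain ⟨g1, g2, g3⟩ := h2 l rfl
          refine ⟨by simp [g1, ← has], ?_, ?_⟩
          · intro b hb
            rcases List.mem_cons.1 hb with rfl | hb
            · exact ⟨t, by simp⟩
            · obtain ⟨t', ht'⟩ := g2 b hb
              exact ⟨t', by simp [ht']⟩
          · intro e he
            rcases List.mem_cons.1 he with rfl | he
            · exact ⟨rfl, htS, by simpa using ht⟩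
            · exact g3 e he

theorem runs_transAll {N K c : ℕ} {letters : List A} (hS : S.length ≤ N) (hK : E.length ≤ K)
    (S' : List (List A)) (hs : ∀ s ∈ S', s.length ≤ N)
    (hc : ∀ s ∈ S', ∀ a, Runs T (fillRow (s ++ [a]) E) (row T E (s ++ [a])) c) :
    ∃ o, Runs T (transAll (S.map fun s => (s, row T E s)) E letters S') o
        (S'.length * (letters.length * (1 + (N + 1) + c + (N * (K + 2) + 1)) + 1 +
          letters.length + 2) + 1) ∧
      (∀ t, o = .inl t → (∃ s ∈ S', ∃ a, t = s ++ [a]) ∧ ∀ s' ∈ S, row T E s' ≠ row T E t) ∧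
      (∀ l, o = .inr l → l.length = S'.length * letters.length ∧
        (∀ s ∈ S', ∀ a ∈ letters, ∃ t, (s, a, t) ∈ l) ∧
        ∀ e ∈ l, e.1 ∈ S' ∧ e.2.2 ∈ S ∧ row T E (e.1 ++ [e.2.1]) = row T E e.2.2) := by
  induction S' with
  | nil =>
    refine ⟨.inr [], Runs.step (Runs.pure _ 0) (by simp), by simp, ?_⟩
    rintro l ⟨⟩
    simp
  | cons s S' ih =>
    obtain ⟨o', ho', h1', h2'⟩ :=
      runs_transFrom (S := S) hS hK (hs s (by simp)) (hc s (by simp)) letters rfl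
    obtain ⟨o, ho, h1, h2⟩ := ih (fun s h => hs s (by simp [h])) (fun s h => hc s (by simp [h]))
    set C := letters.length * (1 + (N + 1) + c + (N * (K + 2) + 1)) + 1
    rcases o' with m | l
    · refine ⟨.inl m, ?_, ?_, by simp⟩
      · unfold transAll
        refine Runs.step (ho'.bind (Runs.pure _ 0)) ?_
        rw [List.length_cons, Nat.succ_mul]
        omega
      · rintro t ⟨⟩
        obtain ⟨⟨a, ha⟩, h⟩ := h1' _ rfl
        exact ⟨⟨s, by simp, a, ha⟩, h⟩
    · obtain ⟨k1, k2, k3⟩ := h2' l rfl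
      rcases o with m | l'
      · refine ⟨.inl m, ?_, ?_, by simp⟩
        · unfold transAll
          refine Runs.step (ho'.bind (ho.bind (Runs.pure _ 0))) ?_
          rw [List.length_cons, Nat.succ_mul]
          omega
        · rintro t ⟨⟩
          obtain ⟨⟨s', hs', a, ha⟩, h⟩ := h1 _ rfl
          exact ⟨⟨s', by simp [hs'], a, ha⟩, h⟩
      · obtain ⟨g1, g2, g3⟩ := h2 l' rfl
        refine ⟨.inr (l ++ l'), ?_, by simp, ?_⟩
        · unfold transAll
          refine Runs.step (ho'.bind (ho.bind ((runs_append l l').bind (Runs.pure _ 0)))) ?_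
          rw [List.length_cons, Nat.succ_mul]
          omega
        · rintro l'' ⟨⟩
          refine ⟨by simp [g1, k1, Nat.succ_mul, add_comm], ?_, ?_⟩
          · intro s' hs' b hb
            rcases List.mem_cons.1 hs' with rfl | hs'
            · obtain ⟨t', ht'⟩ := k2 b hb
              exact ⟨t', by simp [ht']⟩
            · obtain ⟨t', ht'⟩ := g2 s' hs' b hb
              exact ⟨t', by simp [ht']⟩
          · intro e he
            rcases List.mem_append.1 he with he | he
            · obtain ⟨q1, q2, q3⟩ := k3 e he
              exact ⟨by simp [q1], q2, by rw [q1, q3]⟩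
            · obtain ⟨q1, q2, q3⟩ := g3 e he
              exact ⟨by simp [q1], q2, q3⟩

theorem IsOmega.tail' {a : A} {v w : List A} {α : Stream' A} (h : IsOmega (a :: v ++ w) α) :
    IsOmega (v ++ (w ++ [a])) α.tail := by
  simpa using IsOmega.tail (v := v ++ w) h

theorem runs_rotations (todo done : List A) {β : Stream' A} (h : IsOmega (todo ++ done) β ∨ todo = [])
    {V : ℕ} (hV : todo.length + done.length = V) :
    ∃ X, Runs T (rotations todo done) X (todo.length * (2 * V + 3) + 1) ∧
      X.length = todo.length ∧
      (∀ e ∈ X, e.1 = [] ∧ e.2.length = V ∧ ∃ i, Denotes e (β.drop i)) ∧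
      ∀ i < todo.length, ∃ e ∈ X, Denotes e (β.drop i) := by
  induction todo generalizing done β with
  | nil => exact ⟨[], Runs.step (Runs.pure _ 0) (by simp), by simp⟩
  | cons a todo ih =>
    have h := h.resolve_right (by simp)
    obtain ⟨X, hX, h1, h2, h3⟩ := ih (done ++ [a]) (β := β.tail) (.inl h.tail')
      (by simp at hV ⊢; omega)
    have hden : Denotes ([], a :: todo ++ done) (β.drop 0) := ⟨β, h, by simp⟩
    refine ⟨([], a :: todo ++ done) :: X, ?_, by simp [h1], ?_, ?_⟩
    · unfold rotations
      refine Runs.step ((runs_append (a :: todo) done).bind ((runs_append done [a]).bind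
        (hX.bind (Runs.pure _ 0)))) ?_
      simp only [List.length_cons] at hV ⊢
      rw [Nat.add_mul, Nat.one_mul]
      omega
    · intro e he
      rcases List.mem_cons.1 he with rfl | he
      · exact ⟨rfl, by simpa [add_right_comm] using hV, 0, hden⟩
      · obtain ⟨g1, g2, i, g3⟩ := h2 e he
        exact ⟨g1, g2, i + 1, by simpa using g3⟩
    · intro i hi
      rcases i with _ | i
      · exact ⟨_, by simp, hden⟩
      · obtain ⟨e, he, h⟩ := h3 i (by simpa using hi)
        exact ⟨e, by simp [he], by simpa using h⟩

theorem runs_suffixes (u v : List A) {α : Stream' A} (h : Denotes (u, v) α) :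
    ∃ X, Runs T (suffixes v u) X (u.length + (v.length * (2 * v.length + 3) + 2)) ∧
      X.length = u.length + v.length ∧
      (∀ e ∈ X, e.1.length ≤ u.length ∧ e.2.length = v.length ∧ ∃ i, Denotes e (α.drop i)) ∧
      ∀ i < u.length + v.length, ∃ e ∈ X, Denotes e (α.drop i) := by
  induction u generalizing α with
  | nil =>
    obtain ⟨β, h, rfl⟩ := h
    obtain ⟨X, hX, h1, h2, h3⟩ := runs_rotations (T := T) v [] (β := α) (V := v.length)
      (.inl (by simpa using h)) (by simp)
    refine ⟨X, ?_, by simpa using h1, ?_, by simpa using h3⟩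
    · unfold suffixes
      exact Runs.step hX (by simp)
    · intro e he
      obtain ⟨g1, g2, g3⟩ := h2 e he
      exact ⟨by simp [g1], g2, g3⟩
  | cons a u ih =>
    obtain ⟨β, hβ, rfl⟩ := h
    obtain ⟨X, hX, h1, h2, h3⟩ := ih (α := u ++ₛ β) ⟨β, hβ, rfl⟩
    have hden : Denotes (a :: u, v) (Stream'.drop 0 (a :: u ++ₛ β)) := ⟨β, hβ, rfl⟩
    refine ⟨(a :: u, v) :: X, ?_, by simp [h1]; omega, ?_, ?_⟩
    · unfold suffixes
      refine Runs.step (hX.bind (Runs.pure _ 0)) ?_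
      simp only [List.length_cons]
      omega
    · intro e he
      rcases List.mem_cons.1 he with rfl | he
      · exact ⟨le_rfl, rfl, 0, hden⟩
      · obtain ⟨g1, g2, i, g3⟩ := h2 e he
        exact ⟨by simp; omega, g2, i + 1, g3⟩
    · intro i hi
      rcases i with _ | i
      · exact ⟨_, by simp, hden⟩
      · obtain ⟨e, he, h⟩ := h3 i (by simp at hi; omega)
        exact ⟨e, by simp [he], h⟩

theorem runs_addSuffixes (u v : List A) {α : Stream' A} (h : Denotes (u, v) α)
    (E : List (List A × List A)) :
    ∃ X, Runs T (addSuffixes u v E) (X ++ E) (addSuffixesCost u.length v.length) ∧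
      X.length = u.length + v.length ∧
      (∀ e ∈ X, e.1.length ≤ u.length ∧ e.2.length = v.length ∧ ∃ i, Denotes e (α.drop i)) ∧
      ∀ i, ∃ e ∈ X, Denotes e (α.drop i) := by
  obtain ⟨X, hX, h1, h2, h3⟩ := runs_suffixes (T := T) u v h
  refine ⟨X, ?_, h1, h2, fun i => ?_⟩
  · unfold addSuffixes
    refine Runs.step (hX.bind (runs_append X E)) ?_
    unfold addSuffixesCost
    omega
  · have hv := List.length_pos_iff.2 h.ne_nil
    obtain ⟨β, hβ, rfl⟩ := h
    induction i using Nat.strong_induction_on with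
    | _ i ih =>
      rcases lt_or_ge i (u.length + v.length) with hi | hi
      · exact h3 i hi
      · obtain ⟨j, rfl⟩ := Nat.exists_eq_add_of_le hi
        obtain ⟨e, he, hd⟩ := ih (u.length + j) (by dsimp only at hv; omega)
        refine ⟨e, he, ?_⟩
        convert hd using 1
        rw [← Stream'.drop_drop, ← Stream'.drop_drop, ← Stream'.drop_drop,
          Stream'.drop_append_stream]
        conv_lhs => rw [← hβ.2]
        rw [Stream'.drop_append_stream]

theorem cols_append_of_drop {X E : List (List A × List A)} {α : Stream' A}
    (h2 : ∀ e ∈ X, ∃ i, Denotes e (α.drop i)) {γ : Stream' A} (h : γ ∈ cols (X ++ E)) :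
    (∃ i, γ = α.drop i) ∨ γ ∈ cols E := by
  obtain ⟨e, he, hγ⟩ := h
  rcases List.mem_append.1 he with he | he
  · obtain ⟨i, hi⟩ := h2 e he
    exact .inl ⟨i, hγ.unique hi⟩
  · exact .inr ⟨e, he, hγ⟩

/-- Adding the suffixes of a word outside of `D` preserves the invariants. -/
theorem IsTable.addSuffixes (hS : IsTable U D S E ℓ L) (hD : TrivialRightCongruence D)
    {X : List (List A × List A)} {α : Stream' A} (hα : α ∉ D) {ℓ' L' : ℕ} (hℓ : ℓ ≤ ℓ')
    (hL : L ≤ L')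
    (h2 : ∀ e ∈ X, e.1.length ≤ L' ∧ e.2.length ≤ ℓ' ∧ ∃ i, Denotes e (α.drop i))
    (h3 : ∀ i, ∃ e ∈ X, Denotes e (α.drop i)) : IsTable U D S (X ++ E) ℓ' L' where
  nil_mem := hS.nil_mem
  nodup := hS.nodup
  prefix_mem := hS.prefix_mem
  length_le := hS.length_le
  distinct s hs t ht h := hS.distinct s hs t ht (h.mono (cols_subset_append X E))
  period_ne_nil e he := by
    rcases List.mem_append.1 he with he | he
    · obtain ⟨-, -, i, h⟩ := h2 e he
      exact h.ne_nil
    · exact hS.period_ne_nil e he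
  period_length e he := by
    rcases List.mem_append.1 he with he | he
    · exact (h2 e he).2.1
    · exact (hS.period_length e he).trans hℓ
  initial_length e he := by
    rcases List.mem_append.1 he with he | he
    · exact (h2 e he).1
    · exact (hS.initial_length e he).trans hL
  notMem γ hγ := by
    rcases cols_append_of_drop (fun e he => (h2 e he).2.2) hγ with ⟨i, rfl⟩ | h
    · rwa [← hD.append_mem_iff (α.take i), Stream'.append_take_drop]
    · exact hS.notMem γ h
  tail_mem γ hγ := by
    rcases cols_append_of_drop (fun e he => (h2 e he).2.2) hγ with ⟨i, rfl⟩ | h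
    · obtain ⟨e, he, h⟩ := h3 (i + 1)
      exact ⟨e, List.mem_append_left _ he, by simpa using h⟩
    · exact cols_subset_append X E (hS.tail_mem γ h)

/-- Adding a row that differs from all others preserves the invariants. -/
theorem IsTable.cons (hS : IsTable U D S E ℓ L) {s : List A} (hs : s ∈ S) (a : A)
    (h : ∀ t ∈ S, ¬ Eqv U (cols E) t (s ++ [a])) : IsTable U D ((s ++ [a]) :: S) E ℓ L where
  nil_mem := by simp [hS.nil_mem]
  nodup := List.nodup_cons.2 ⟨fun hm => h _ hm fun _ _ => Iff.rfl, hS.nodup⟩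
  prefix_mem t b hm := by
    rcases List.mem_cons.1 hm with hm | hm
    · obtain ⟨rfl, -⟩ := List.append_inj' hm rfl
      simp [hs]
    · exact List.mem_cons_of_mem _ (hS.prefix_mem t b hm)
  length_le t ht := by
    rcases List.mem_cons.1 ht with rfl | ht
    · simpa using hS.length_le s hs
    · exact (hS.length_le t ht).trans (by simp)
  distinct t ht r hr he := by
    rcases List.mem_cons.1 ht with rfl | ht <;> rcases List.mem_cons.1 hr with rfl | hr
    · rfl
    · exact absurd he.symm (h r hr)
    · exact absurd he (h t ht)
    · exact hS.distinct t ht r hr he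
  period_ne_nil := hS.period_ne_nil
  period_length := hS.period_length
  initial_length := hS.initial_length
  notMem := hS.notMem
  tail_mem := hS.tail_mem

end Fill

/-! ## Runs and reachability in a transition table -/

section PathLists

variable {A : Type} {S : List (List A)}

/-- `L` lists states with words of length at most `j` leading to them from `p`. -/
structure IsPathList (S : List (List A)) (δ : List A → A → List A) (p : List A) (j : ℕ)
    (L : List (List A × List A)) : Prop where
  mem : ∀ e ∈ L, e.1 ∈ S
  foldl : ∀ e ∈ L, e.2.foldl δ p = e.1
  length_le : ∀ e ∈ L, e.2.length ≤ j
  nodup : (L.map Prod.fst).Nodup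

theorem IsPathList.card_le {δ : List A → A → List A} {p : List A} {j : ℕ}
    {L : List (List A × List A)} (h : IsPathList S δ p j L) : L.length ≤ S.length := by
  rw [← List.length_map (f := Prod.fst)]
  refine (List.Nodup.subperm h.nodup fun q hq => ?_).length_le
  obtain ⟨e, he, rfl⟩ := List.mem_map.1 hq
  exact h.mem e he

theorem IsPathList.mono {δ : List A → A → List A} {p : List A} {j k : ℕ}
    {L : List (List A × List A)} (h : IsPathList S δ p j L) (hjk : j ≤ k) :
    IsPathList S δ p k L :=
  ⟨h.mem, h.foldl, fun e he => (h.length_le e he).trans hjk, h.nodup⟩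

theorem IsPathList.cons {δ : List A → A → List A} {p : List A} {j : ℕ}
    {L : List (List A × List A)} (h : IsPathList S δ p j L) {q w : List A} (hq : q ∈ S)
    (hw : w.foldl δ p = q) (hj : w.length ≤ j) (hn : ∀ w, (q, w) ∉ L) :
    IsPathList S δ p j ((q, w) :: L) where
  mem := List.forall_mem_cons.2 ⟨hq, h.mem⟩
  foldl := List.forall_mem_cons.2 ⟨hw, h.foldl⟩
  length_le := List.forall_mem_cons.2 ⟨hj, h.length_le⟩
  nodup := by
    rw [List.map_cons]
    refine List.nodup_cons.2 ⟨fun hm => ?_, h.nodup⟩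
    obtain ⟨⟨q', w'⟩, he, rfl⟩ := List.mem_map.1 hm
    exact hn w' he

end PathLists

section Reachability

variable {A : Type} [DecidableEq A] {T : Teacher A}

/-- The transition function described by a table. -/
def look (tr : List (List A × A × List A)) (q : List A) (a : A) : List A :=
  match tr with
  | [] => []
  | (p, b, t) :: l => if b = a ∧ p = q then t else look l q a

/-- A transition table on the states `S`, with bounds for the number and length of the states and for
the length of the table. -/
structure IsGraph (S : List (List A)) (tr : List (List A × A × List A)) (N M : ℕ) : Prop where
  nil_mem : [] ∈ S
  mem : ∀ s ∈ S, ∀ a, look tr s a ∈ S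
  length_le : ∀ s ∈ S, s.length ≤ N
  card_le : S.length ≤ N
  table_le : tr.length ≤ M

/-- `q` can be reached from `p`. -/
def Reach (δ : List A → A → List A) (p q : List A) : Prop := ∃ w : List A, w.foldl δ p = q

/-- `p` and `q` are in the same strongly connected component. -/
def Conn (δ : List A → A → List A) (p q : List A) : Prop := Reach δ p q ∧ Reach δ q p

section Costs

variable {R : Type} [CommSemiring R]

/-- A bound for the time of `lookup`. -/
def lookupCost (N M : R) : R := M * (N + 2) + 1

/-- A bound for the time of `runFrom` on a word of length `k`. -/
def runFromCost (N M k : R) : R := k * (lookupCost N M + 1) + 1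

/-- A bound for the time of `findPath`. -/
def findPathCost (N : R) : R := N * (N + 2) + 1

/-- A bound for the time of `expandLetters`. -/
def expandLettersCost (N M a : R) : R := a * (lookupCost N M + findPathCost N + N + 2) + 1

/-- A bound for the time of `expandAll`. -/
def expandAllCost (N M a : R) : R := N * (expandLettersCost N M a + 1) + 1

/-- A bound for the time of `pathTo`. -/
def pathToCost (N M a : R) : R := 1 + (N * (expandAllCost N M a + 1) + 1) + findPathCost N

/-- A bound for the time of `connect`. -/
def connectCost (N M a : R) : R := 1 + 2 * pathToCost N M a

end Costs

theorem runs_lookup (q : List A) (a : A) (tr : List (List A × A × List A)) :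
    Runs T (lookup q a tr) (look tr q a) (tr.length * (q.length + 2) + 1) := by
  induction tr with
  | nil => exact Runs.step (Runs.pure _ 0) (by simp)
  | cons e tr ih =>
    obtain ⟨p, b, t⟩ := e
    unfold lookup
    refine Runs.step (t := q.length + 1 + (tr.length * (q.length + 2) + 1)) ?_
      (by rw [List.length_cons, Nat.succ_mul]; omega)
    unfold look
    by_cases hb : b = a
    · simp only [hb, if_true, true_and]
      refine ((runs_eqList p q).mono (by omega)).bind ?_
      by_cases hp : p = q
      · simpa [hp] using Runs.pure _ _
      · simpa [hp] using ih
    · simpa only [hb, if_false, false_and] using ih.mono (by omega)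

theorem IsGraph.foldl_mem {S : List (List A)} {tr : List (List A × A × List A)} {N M : ℕ}
    (h : IsGraph S tr N M) {q : List A} (hq : q ∈ S) (w : List A) : w.foldl (look tr) q ∈ S := by
  induction w generalizing q with
  | nil => exact hq
  | cons a w ih => exact ih (h.mem q hq a)

variable {S : List (List A)} {tr : List (List A × A × List A)} {N M : ℕ}

theorem IsGraph.runs_lookup (h : IsGraph S tr N M) {q : List A} (hq : q ∈ S) (a : A) :
    Runs T (lookup q a tr) (look tr q a) (lookupCost N M) := by
  refine (WDBALearning.runs_lookup q a tr).mono ?_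
  have h1 := h.length_le q hq
  have h2 := h.table_le
  unfold lookupCost
  gcongr

theorem IsGraph.runs_runFrom (h : IsGraph S tr N M) {q : List A} (hq : q ∈ S) (w : List A) :
    Runs T (runFrom tr q w) (w.foldl (look tr) q) (runFromCost N M w.length) := by
  unfold runFromCost
  induction w generalizing q with
  | nil => exact Runs.step (Runs.pure _ 0) (by simp)
  | cons a w ih =>
    unfold runFrom
    refine Runs.step ((h.runs_lookup hq a).bind (ih (h.mem q hq a))) ?_
    rw [List.length_cons, Nat.succ_mul]
    omega

theorem runs_findPath (q : List A) (L : List (List A × List A)) :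
    ∃ o, Runs T (findPath q L) o (L.length * (q.length + 2) + 1) ∧
      (o = none → ∀ w, (q, w) ∉ L) ∧ ∀ w, o = some w → (q, w) ∈ L := by
  induction L with
  | nil => exact ⟨none, Runs.step (Runs.pure _ 0) (by simp), by simp⟩
  | cons e L ih =>
    obtain ⟨p, w⟩ := e
    obtain ⟨o, ho, h1, h2⟩ := ih
    have hc : q.length + 1 + (L.length * (q.length + 2) + 1) + 1 ≤
      ((p, w) :: L).length * (q.length + 2) + 1 := by
      rw [List.length_cons, Nat.succ_mul]; omega
    by_cases hp : p = q
    · refine ⟨some w, ?_, by simp, by simp [hp]⟩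
      unfold findPath
      refine Runs.step (((runs_eqList p q).mono (by omega)).bind ?_) hc
      simpa [hp] using Runs.pure _ _
    · refine ⟨o, ?_, fun h w' hw' => ?_, fun w' hw' => by simp [h2 w' hw']⟩
      · unfold findPath
        refine Runs.step (((runs_eqList p q).mono (by omega)).bind ?_) hc
        simpa [hp] using ho
      · rcases List.mem_cons.1 hw' with h' | h'
        · exact hp (Prod.mk.inj h').1.symm
        · exact h1 h w' h'

theorem IsPathList.runs_findPath (h : IsGraph S tr N M) {p : List A} {j : ℕ}
    {L : List (List A × List A)} (hL : IsPathList S (look tr) p j L) {q : List A} (hq : q ∈ S) :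
    ∃ o, Runs T (findPath q L) o (findPathCost N) ∧
      (o = none → ∀ w, (q, w) ∉ L) ∧ ∀ w, o = some w → (q, w) ∈ L := by
  obtain ⟨o, ho, h'⟩ := WDBALearning.runs_findPath (T := T) q L
  refine ⟨o, ho.mono ?_, h'⟩
  have h1 := hL.card_le.trans h.card_le
  have h2 := h.length_le q hq
  unfold findPathCost
  gcongr

theorem runs_expandLetters (h : IsGraph S tr N M) {p q w : List A} {j : ℕ} (hq : q ∈ S)
    (hw : w.foldl (look tr) p = q) (hj : w.length ≤ j) (hjN : j ≤ N) (as : List A)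
    {L : List (List A × List A)} (hL : IsPathList S (look tr) p (j + 1) L) :
    ∃ L', Runs T (expandLetters tr q w as L) L' (expandLettersCost N M as.length) ∧
      IsPathList S (look tr) p (j + 1) L' ∧ L ⊆ L' ∧
      ∀ a ∈ as, ∃ w', (look tr q a, w') ∈ L' := by
  unfold expandLettersCost
  induction as generalizing L with
  | nil => exact ⟨L, Runs.step (Runs.pure _ 0) (by simp), hL, fun _ h => h, by simp⟩
  | cons a as ih =>
    obtain ⟨o, ho, h1, h2⟩ := hL.runs_findPath (T := T) h (h.mem q hq a)
    have hcost : lookupCost N M + (findPathCost N + (N + 1 +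
        (as.length * (lookupCost N M + findPathCost N + N + 2) + 1))) + 1 ≤
        (a :: as).length * (lookupCost N M + findPathCost N + N + 2) + 1 := by
      rw [List.length_cons, Nat.succ_mul]
      omega
    rcases o with _ | w'
    · obtain ⟨L', hr, hp, hs, ha⟩ := ih (hL.cons (q := look tr q a) (w := w ++ [a]) (h.mem q hq a)
        (by simp [hw]) (by simpa using hj) (h1 rfl))
      refine ⟨L', ?_, hp, fun e he => hs (List.mem_cons_of_mem _ he), ?_⟩
      · unfold expandLetters
        refine Runs.step ((h.runs_lookup hq a).bind (ho.bind
          (Runs.bind ((runs_append w [a]).mono (t' := N + 1) (by omega)) hr))) hcost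
      · exact List.forall_mem_cons.2 ⟨⟨_, hs List.mem_cons_self⟩, ha⟩
    · obtain ⟨L', hr, hp, hs, ha⟩ := ih hL
      refine ⟨L', ?_, hp, hs, ?_⟩
      · unfold expandLetters
        refine Runs.step ((h.runs_lookup hq a).bind (ho.bind (hr.mono ?_))) hcost
        omega
      · exact List.forall_mem_cons.2 ⟨⟨w', hs (h2 w' rfl)⟩, ha⟩

theorem runs_expandAll (h : IsGraph S tr N M) {p : List A} {j : ℕ} (hjN : j ≤ N)
    (letters : List A) {todo L : List (List A × List A)} (htodo : IsPathList S (look tr) p j todo)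
    (hL : IsPathList S (look tr) p (j + 1) L) :
    ∃ L', Runs T (expandAll tr letters todo L) L'
        (todo.length * (expandLettersCost N M letters.length + 1) + 1) ∧
      IsPathList S (look tr) p (j + 1) L' ∧ L ⊆ L' ∧
      ∀ e ∈ todo, ∀ a ∈ letters, ∃ w', (look tr e.1 a, w') ∈ L' := by
  induction todo generalizing L with
  | nil => exact ⟨L, Runs.step (Runs.pure _ 0) (by simp), hL, fun _ h => h, by simp⟩
  | cons e todo ih =>
    obtain ⟨q, w⟩ := e
    obtain ⟨L₁, hr₁, hp₁, hs₁, ha₁⟩ := runs_expandLetters (T := T) h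
      (htodo.mem _ List.mem_cons_self) (htodo.foldl _ List.mem_cons_self)
      (htodo.length_le _ List.mem_cons_self) hjN letters hL
    have htodo' : IsPathList S (look tr) p j todo :=
      ⟨(List.forall_mem_cons.1 htodo.mem).2, (List.forall_mem_cons.1 htodo.foldl).2,
        (List.forall_mem_cons.1 htodo.length_le).2, (List.nodup_cons.1 htodo.nodup).2⟩
    obtain ⟨L', hr, hp, hs, ha⟩ := ih htodo' hp₁
    refine ⟨L', ?_, hp, fun e he => hs (hs₁ he), ?_⟩
    · unfold expandAll
      refine Runs.step (hr₁.bind hr) ?_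
      rw [List.length_cons, Nat.succ_mul]
      omega
    · refine List.forall_mem_cons.2 ⟨fun a ha' => ?_, ha⟩
      obtain ⟨w', hw'⟩ := ha₁ a ha'
      exact ⟨w', hs hw'⟩

theorem runs_saturate (h : IsGraph S tr N M) {letters : List A} (hlet : ∀ a, a ∈ letters)
    {p : List A} (S' : List (List A)) {j : ℕ} (hjN : j + S'.length ≤ N)
    {L : List (List A × List A)} (hL : IsPathList S (look tr) p j L)
    (hall : ∀ w : List A, w.length ≤ j → ∃ w', (w.foldl (look tr) p, w') ∈ L) :
    ∃ L', Runs T (saturate tr letters S' L) L'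
        (S'.length * (expandAllCost N M letters.length + 1) + 1) ∧
      IsPathList S (look tr) p (j + S'.length) L' ∧
      ∀ w : List A, w.length ≤ j + S'.length → ∃ w', (w.foldl (look tr) p, w') ∈ L' := by
  induction S' generalizing L j with
  | nil => exact ⟨L, Runs.step (Runs.pure _ 0) (by simp), hL, hall⟩
  | cons s S' ih =>
    simp only [List.length_cons] at hjN ⊢
    obtain ⟨L₁, hr₁, hp₁, hs₁, ha₁⟩ :=
      runs_expandAll (T := T) h (j := j) (by omega) letters hL (hL.mono (Nat.le_succ j))
    have hall₁ : ∀ w : List A, w.length ≤ j + 1 → ∃ w', (w.foldl (look tr) p, w') ∈ L₁ := by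
      intro w hw
      rcases List.eq_nil_or_concat w with rfl | ⟨w, a, rfl⟩
      · obtain ⟨w', hw'⟩ := hall [] (by simp)
        exact ⟨w', hs₁ hw'⟩
      · obtain ⟨w', hw'⟩ := hall w (by simpa using hw)
        obtain ⟨w'', hw''⟩ := ha₁ _ hw' a (hlet a)
        exact ⟨w'', by simpa using hw''⟩
    obtain ⟨L', hr, hp, ha⟩ := ih (j := j + 1) (by omega) hp₁ hall₁
    rw [show j + (S'.length + 1) = j + 1 + S'.length by omega]
    refine ⟨L', ?_, hp, ha⟩
    unfold saturate
    refine Runs.step (hr₁.bind hr) ?_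
    have hc : L.length * (expandLettersCost N M letters.length + 1) + 1 ≤
        expandAllCost N M letters.length := by
      unfold expandAllCost
      have := hL.card_le.trans h.card_le
      gcongr
    rw [Nat.succ_mul]
    omega

theorem exists_short_word (h : IsGraph S tr N M) {p : List A} (hp : p ∈ S) (w : List A) :
    ∃ w' : List A, w'.length ≤ S.length ∧ w'.foldl (look tr) p = w.foldl (look tr) p := by
  induction hn : w.length using Nat.strong_induction_on generalizing w with
  | _ n ih =>
    rcases le_or_gt w.length S.length with hle | hlt
    · exact ⟨w, hle, rfl⟩
    · obtain ⟨i, j, hij, hj, he⟩ := exists_lt_eq_of_mem le_rfl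
        (fun i => (w.take i).foldl (look tr) p) fun i _ => h.foldl_mem hp _
      obtain ⟨w', h1, h2⟩ := ih (w.take i ++ w.drop j).length
        (by simp; omega) (w.take i ++ w.drop j) rfl
      refine ⟨w', h1, h2.trans ?_⟩
      rw [List.foldl_append, he, ← List.foldl_append, List.take_append_drop]

theorem runs_pathTo (h : IsGraph S tr N M) {letters : List A} (hlet : ∀ a, a ∈ letters)
    {p q : List A} (hp : p ∈ S) (hq : q ∈ S) :
    ∃ o, Runs T (pathTo S tr letters p q) o (pathToCost N M letters.length) ∧
      (o = none → ¬ Reach (look tr) p q) ∧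
      ∀ w, o = some w → w.foldl (look tr) p = q ∧ w.length ≤ N := by
  have h0 : IsPathList S (look tr) p 0 [(p, [])] :=
    ⟨by simp [hp], by simp, by simp, by simp⟩
  obtain ⟨L, hr, hL, hall⟩ := runs_saturate (T := T) h hlet S (j := 0)
    (by simpa using h.card_le) h0 (fun w hw => ⟨[], by simp_all⟩)
  obtain ⟨o, ho, h1, h2⟩ := hL.runs_findPath (T := T) h hq
  refine ⟨o, ?_, fun hnone => ?_, fun w hw => ?_⟩
  · unfold pathTo
    refine Runs.step (hr.bind ho) ?_
    have h3 := Nat.mul_le_mul_right (expandAllCost N M letters.length + 1) h.card_le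
    unfold pathToCost
    omega
  · rintro ⟨w, hw⟩
    obtain ⟨w', hw', he⟩ := exists_short_word h hp w
    obtain ⟨w'', hw''⟩ := hall w' (by simpa using hw')
    exact h1 hnone w'' (by rwa [he, hw] at hw'')
  · have := hL.length_le _ (h2 w hw)
    exact ⟨hL.foldl _ (h2 w hw), this.trans (by simpa using h.card_le)⟩

theorem runs_connect (h : IsGraph S tr N M) {letters : List A} (hlet : ∀ a, a ∈ letters)
    {s t : List A} (hs : s ∈ S) (ht : t ∈ S) :
    ∃ o, Runs T (connect S tr letters s t) o (connectCost N M letters.length) ∧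
      (o = none → ¬ Conn (look tr) s t) ∧
      ∀ z w, o = some (z, w) → z.foldl (look tr) s = t ∧ w.foldl (look tr) t = s ∧
        z.length ≤ N ∧ w.length ≤ N := by
  obtain ⟨o₁, hr₁, h1, h2⟩ := runs_pathTo (T := T) h hlet hs ht
  obtain ⟨o₂, hr₂, h3, h4⟩ := runs_pathTo (T := T) h hlet ht hs
  have hc : pathToCost N M letters.length + pathToCost N M letters.length + 1 ≤
      connectCost N M letters.length := by
    unfold connectCost
    omega
  rcases o₁ with _ | z
  · refine ⟨none, ?_, fun _ hc => h1 rfl hc.1, by simp⟩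
    unfold connect
    exact Runs.step (hr₁.bind (Runs.pure _ 0)) (by omega)
  · rcases o₂ with _ | w
    · refine ⟨none, ?_, fun _ hc => h3 rfl hc.2, by simp⟩
      unfold connect
      exact Runs.step (hr₁.bind (hr₂.bind (Runs.pure _ 0))) (by omega)
    · refine ⟨some (z, w), ?_, by simp, ?_⟩
      · unfold connect
        exact Runs.step (hr₁.bind (hr₂.bind (Runs.pure _ 0))) (by omega)
      · rintro z' w' ⟨⟩
        exact ⟨(h2 z rfl).1, (h4 w rfl).1, (h2 z rfl).2, (h4 w rfl).2⟩

end Reachability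

/-! ## Marking -/

section MarkSemantics

variable {A : Type}

theorem Conn.refl (δ : List A → A → List A) (p : List A) : Conn δ p p := ⟨⟨[], rfl⟩, ⟨[], rfl⟩⟩

theorem Conn.symm {δ : List A → A → List A} {p q : List A} (h : Conn δ p q) : Conn δ q p :=
  ⟨h.2, h.1⟩

theorem Reach.trans {δ : List A → A → List A} {p q r : List A} (h : Reach δ p q)
    (h' : Reach δ q r) : Reach δ p r := by
  obtain ⟨u, rfl⟩ := h
  obtain ⟨v, rfl⟩ := h'
  exact ⟨u ++ v, List.foldl_append⟩

theorem Conn.trans {δ : List A → A → List A} {p q r : List A} (h : Conn δ p q)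
    (h' : Conn δ q r) : Conn δ p r := ⟨h.1.trans h'.1, h'.2.trans h.2⟩

/-- A state visited infinitely often by the run on `s u v^ω`. -/
def recState (δ : List A → A → List A) (S : List (List A)) (s : List A) (e : List A × List A) :
    List A := (pow e.2 S.length).foldl δ ((s ++ e.1).foldl δ [])

/-- Some state connected to `q` is marked with `b`. -/
def Marked (T : Teacher A) (δ : List A → A → List A) (S : List (List A))
    (E : List (List A × List A)) (b : Bool) (q : List A) : Prop :=
  ∃ s ∈ S, ∃ e ∈ E, ask T (s ++ e.1) e.2 = b ∧ Conn δ q (recState δ S s e)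

/-- The data of a mark are correct; `B` and `V` bound the lengths of the words. -/
def IsMark (U X : Set (Stream' A)) (S : List (List A)) (δ : List A → A → List A) (B V : ℕ)
    (m : Mark A) : Prop :=
  m.state ∈ S ∧ m.loop.foldl δ m.state = m.state ∧ m.loop.length ≤ B ∧ m.per.length ≤ V ∧
    ∃ α ∈ X, IsOmega m.loop α ∧ IsOmega m.per α ∧ (m.state ++ₛ α ∈ U ↔ m.bit = true)

/-- `ms` marks the states visited infinitely often, for the pairs in `P`. -/
structure IsMarking (T : Teacher A) (U X : Set (Stream' A)) (S : List (List A))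
    (δ : List A → A → List A) (B V : ℕ) (P : List A → List A × List A → Prop)
    (ms : List (Mark A)) : Prop where
  isMark : ∀ m ∈ ms, IsMark U X S δ B V m
  sound : ∀ m ∈ ms, ∃ s e, P s e ∧ ask T (s ++ e.1) e.2 = m.bit ∧
    Conn δ (recState δ S s e) m.state
  complete : ∀ s e, P s e → ∃ m ∈ ms, m.bit = ask T (s ++ e.1) e.2 ∧ m.state = recState δ S s e

/-- The data of a conflict are correct. -/
structure IsConflict (U X : Set (Stream' A)) (S : List (List A)) (δ : List A → A → List A)
    (N B V : ℕ) (c : Conflict A) : Prop where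
  s_mem : c.s ∈ S
  t_mem : c.t ∈ S
  foldl_x : c.x.foldl δ c.s = c.s
  foldl_y : c.y.foldl δ c.t = c.t
  foldl_z : c.z.foldl δ c.s = c.t
  foldl_w : c.w.foldl δ c.t = c.s
  x_length : c.x.length ≤ B
  y_length : c.y.length ≤ B
  xper_length : c.xper.length ≤ V
  yper_length : c.yper.length ≤ V
  z_length : c.z.length ≤ N
  w_length : c.w.length ≤ N
  x_omega : ∃ α ∈ X, IsOmega c.x α ∧ IsOmega c.xper α ∧ c.s ++ₛ α ∈ U
  y_omega : ∃ β ∈ X, IsOmega c.y β ∧ IsOmega c.yper β ∧ c.t ++ₛ β ∉ U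

variable {T : Teacher A} {U X : Set (Stream' A)} {S : List (List A)} {δ : List A → A → List A}
  {B V : ℕ} {E : List (List A × List A)} {ms : List (Mark A)}

theorem IsMarking.exists_iff
    (h : IsMarking T U X S δ B V (fun s e => s ∈ S ∧ e ∈ E) ms) (b : Bool) (q : List A) :
    (∃ m ∈ ms, m.bit = b ∧ Conn δ q m.state) ↔ Marked T δ S E b q := by
  constructor
  · rintro ⟨m, hm, hb, hq⟩
    obtain ⟨s, e, ⟨hs, he⟩, ha, hc⟩ := h.sound m hm
    exact ⟨s, hs, e, he, ha.trans hb, hq.trans hc.symm⟩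
  · rintro ⟨s, hs, e, he, ha, hc⟩
    obtain ⟨m, hm, hb, hst⟩ := h.complete s e ⟨hs, he⟩
    exact ⟨m, hm, hb.trans ha, hst ▸ hc⟩

theorem IsOmega.singleton_append_tail {a : A} {v : List A} {α : Stream' A}
    (h : IsOmega (a :: v) α) : [a] ++ₛ α.tail = α := by
  conv_rhs => rw [← h.2]
  conv_lhs => rw [← h.2]
  rfl

theorem IsOmega.rotate {v : List A} {α : Stream' A} (h : IsOmega v α) :
    IsOmega (v.rotate 1) α.tail := by
  rcases v with _ | ⟨a, v⟩
  · exact absurd rfl h.1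
  · simpa using h.tail

end MarkSemantics

section Marking

variable {A : Type} [DecidableEq A] {T : Teacher A} {U X : Set (Stream' A)}
  {S : List (List A)} {tr : List (List A × A × List A)} {N M : ℕ}

section Costs

variable {R : Type} [CommSemiring R]

/-- A bound for the time of `loopWord`. -/
def loopWordCost (N M ℓ B : R) : R := N * (runFromCost N M ℓ + B + N + 3) + 1

/-- A bound for the time of `walk`. -/
def walkCost (N M ℓ B : R) : R := B * (2 * B + ℓ + lookupCost N M + 4) + 1

/-- A bound for the time that `markRow` spends on one column. -/
def markColCost (N M ℓ L B : R) : R :=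
  1 + (N + 1) + runFromCost N M (N + L) + (N * (runFromCost N M ℓ + 1) + 1) +
    loopWordCost N M ℓ B + walkCost N M ℓ B + (B + 1)

/-- A bound for the time of `markAll`. -/
def markAllCost (N M ℓ L B K : R) : R :=
  N * (K * markColCost N M ℓ L B + 1 + (K * B + 1) + 1) + 1

end Costs

theorem runFromCost_mono {k l : ℕ} (h : k ≤ l) : runFromCost N M k ≤ runFromCost N M l := by
  unfold runFromCost
  gcongr

theorem runs_iterateRun (h : IsGraph S tr N M) (v : List A) (S' : List (List A)) {q : List A}
    (hq : q ∈ S) :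
    Runs T (iterateRun tr v S' q) ((pow v S'.length).foldl (look tr) q)
      (S'.length * (runFromCost N M v.length + 1) + 1) := by
  induction S' generalizing q with
  | nil => exact Runs.step (Runs.pure _ 0) (by simp)
  | cons s S' ih =>
    unfold iterateRun
    rw [List.length_cons, pow_succ, List.foldl_append]
    refine Runs.step ((h.runs_runFrom hq v).bind (ih (h.foldl_mem hq v))) ?_
    rw [Nat.succ_mul]
    omega

theorem runs_loopWord (h : IsGraph S tr N M) {ℓ B : ℕ} {v p : List A} (hv : v.length ≤ ℓ)
    (S' : List (List A)) {q acc : List A} (hq : q ∈ S) (hB : acc.length + S'.length * v.length ≤ B)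
    (hex : ∃ d, d + 1 ≤ S'.length ∧ (pow v (d + 1)).foldl (look tr) q = p) :
    ∃ d, d + 1 ≤ S'.length ∧ (pow v (d + 1)).foldl (look tr) q = p ∧
      Runs T (loopWord tr v p S' q acc) (acc ++ pow v (d + 1))
        (S'.length * (runFromCost N M ℓ + B + N + 3) + 1) := by
  induction S' generalizing q acc with
  | nil =>
    obtain ⟨d, hd, -⟩ := hex
    simp at hd
  | cons s S' ih =>
    obtain ⟨d, hd, hp⟩ := hex
    have hq' := h.foldl_mem hq v
    rw [List.length_cons] at hd hB ⊢
    have hl : (acc ++ v).length + S'.length * v.length ≤ B := by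
      rw [List.length_append]
      rw [Nat.succ_mul] at hB
      omega
    have hrun := (h.runs_runFrom (T := T) hq v).mono (runFromCost_mono hv)
    have happ := (runs_append (A := A) (T := T) acc v).mono (t' := B + 1) (by omega)
    have heq := (runs_eqList (T := T) (v.foldl (look tr) q) p).mono (t' := N + 1)
      (by have := h.length_le _ hq'; omega)
    have hcost : runFromCost N M ℓ + (B + 1 + (N + 1 +
        (S'.length * (runFromCost N M ℓ + B + N + 3) + 1))) + 1 ≤
        (S'.length + 1) * (runFromCost N M ℓ + B + N + 3) + 1 := by
      rw [Nat.succ_mul]; omega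
    by_cases he : v.foldl (look tr) q = p
    · refine ⟨0, by omega, by simpa [pow_one] using he, ?_⟩
      unfold loopWord
      refine Runs.step (hrun.bind (happ.bind (heq.bind ?_))) hcost
      simpa [he, pow_one] using Runs.pure _ _
    · rcases d with _ | d
      · exact absurd (by simpa [pow_one] using hp) he
      · rw [pow_succ, List.foldl_append] at hp
        obtain ⟨d', hd', hp', hr⟩ := ih hq' hl ⟨d, by omega, hp⟩
        refine ⟨d' + 1, by omega, by rw [pow_succ, List.foldl_append]; exact hp', ?_⟩
        unfold loopWord
        refine Runs.step (hrun.bind (happ.bind (heq.bind ?_))) hcost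
        rw [pow_succ v (d' + 1), ← List.append_assoc]
        simpa [he] using hr

theorem runs_walk (h : IsGraph S tr N M) (ht : IsTrans U X S (look tr))
    (hX : ∀ α ∈ X, α.tail ∈ X) {ℓ B : ℕ} {b : Bool} {p : List A} (todo : List A)
    {done v q : List A} {α : Stream' A} (hp : p ∈ S) (hq : done.foldl (look tr) p = q)
    (hloop : todo.foldl (look tr) q = p) (hα : IsOmega (todo ++ done) α) (hv : IsOmega v α)
    (hαX : α ∈ X) (hb : q ++ₛ α ∈ U ↔ b = true) (hB : todo.length + done.length ≤ B)
    (hℓ : v.length ≤ ℓ) :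
    ∃ ms, Runs T (walk tr b todo done v q) ms
        (todo.length * (2 * B + ℓ + lookupCost N M + 4) + 1) ∧
      ms.length = todo.length ∧
      (∀ m ∈ ms, IsMark U X S (look tr) B ℓ m ∧ m.bit = b ∧ Conn (look tr) p m.state) ∧
      (todo ≠ [] → ∃ m ∈ ms, m.state = q ∧ m.bit = b) := by
  induction todo generalizing done v q α with
  | nil => exact ⟨[], Runs.step (Runs.pure _ 0) (by simp), by simp⟩
  | cons a todo ih =>
    have hqS : q ∈ S := hq ▸ h.foldl_mem hp done
    have hsplit := hα.singleton_append_tail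
    have hstep := ht.append_mem_iff hX hqS [a] (β := α.tail) (by rwa [hsplit])
    rw [hsplit] at hstep
    obtain ⟨ms, hr, h1, h2, -⟩ := ih (done := done ++ [a]) (v := v.rotate 1) (q := look tr q a)
      (α := α.tail) (by simp [hq]) (by simpa using hloop) hα.tail' hv.rotate (hX _ hαX)
      (hstep.symm.trans hb) (by simp at hB ⊢; omega) (by simpa using hℓ)
    have hc : Conn (look tr) p q := ⟨⟨done, hq⟩, ⟨a :: todo, hloop⟩⟩
    refine ⟨⟨q, a :: todo ++ done, v, b⟩ :: ms, ?_, by simp [h1], ?_, fun _ => ?_⟩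
    · unfold walk
      refine Runs.step ((runs_append (a :: todo) done).bind ((runs_append done [a]).bind
        ((runs_rotateOne v).bind ((h.runs_lookup hqS a).bind (hr.bind (Runs.pure _ 0)))))) ?_
      rw [List.length_cons] at hB ⊢
      rw [Nat.add_mul, Nat.one_mul]
      omega
    · refine List.forall_mem_cons.2 ⟨⟨⟨hqS, ?_, ?_, hℓ, α, hαX, hα, hv, hb⟩, rfl, hc⟩, h2⟩
      · rw [List.foldl_append]
        dsimp only
        rw [hloop, hq]
      · dsimp only
        rwa [List.length_append]
    · exact ⟨_, List.mem_cons_self, rfl, rfl⟩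

theorem runs_markRow (h : IsGraph S tr N M) (ht : IsTrans U X S (look tr))
    (hX : ∀ α ∈ X, α.tail ∈ X) {ℓ L : ℕ} {s : List A} (hs : s ∈ S)
    (hfold : s.foldl (look tr) [] = s) (E : List (List A × List A))
    (hE : ∀ e ∈ E, e.1.length ≤ L ∧ e.2.length ≤ ℓ ∧ ∃ α ∈ X, Denotes e α ∧
      (s ++ₛ α ∈ U ↔ ask T (s ++ e.1) e.2 = true)) :
    ∃ ms, Runs T (markRow S tr s E (row T E s)) ms
        (E.length * markColCost N M ℓ L (N * ℓ) + 1) ∧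
      ms.length ≤ E.length * (N * ℓ) ∧
      IsMarking T U X S (look tr) (N * ℓ) ℓ (fun s' e => s' = s ∧ e ∈ E) ms := by
  induction E with
  | nil =>
    exact ⟨[], Runs.step (Runs.pure _ 0) (by simp), by simp, by simp, by simp, by simp⟩
  | cons e E ih =>
    obtain ⟨u, v⟩ := e
    obtain ⟨hL, hℓ, α, hα, ⟨β, hβ, rfl⟩, hask⟩ := hE _ List.mem_cons_self
    obtain ⟨ms, hr, h1, h2⟩ := ih fun e he => hE e (List.mem_cons_of_mem _ he)
    dsimp only at hL hℓ hβ hα hask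
    set q := (s ++ u).foldl (look tr) [] with hq
    have hqS : q ∈ S := h.foldl_mem h.nil_mem _
    have hpS : recState (look tr) S s (u, v) ∈ S := h.foldl_mem hqS _
    set p := recState (look tr) S s (u, v) with hp
    have hSℓ : S.length * v.length ≤ N * ℓ := Nat.mul_le_mul h.card_le hℓ
    obtain ⟨d, hd, hpd, hloop⟩ := runs_loopWord (T := T) h (p := p) hℓ S (q := p) (acc := [])
      (B := N * ℓ) hpS (by simpa using hSℓ) (by
        obtain ⟨i, j, hij, hj, he⟩ := exists_lt_eq_of_mem le_rfl
          (fun i => (pow v i).foldl (look tr) q) fun i _ => h.foldl_mem hqS _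
        obtain ⟨d, rfl⟩ := Nat.exists_eq_add_of_lt hij
        obtain ⟨k, hk⟩ := Nat.exists_eq_add_of_le hj
        refine ⟨d, by omega, ?_⟩
        have e1 : p = (pow v (i + d + 1 + k)).foldl (look tr) q := by rw [← hk]; rfl
        rw [e1, ← List.foldl_append, ← pow_add,
          show i + d + 1 + k + (d + 1) = (i + d + 1) + (d + 1 + k) by omega, pow_add,
          List.foldl_append, ← he, ← List.foldl_append, ← pow_add]
        congr 2; omega)
    have hxβ : u ++ pow v S.length ++ₛ β = u ++ₛ β := by
      rw [Stream'.append_append_stream, hβ.pow_append]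
    have hβX : β ∈ X := tails_mem hX u hα
    have hbit : p ++ₛ β ∈ U ↔ ask T (s ++ u) v = true := by
      have := ht.append_mem_iff hX hs (u ++ pow v S.length) (β := β) (by rwa [hxβ])
      rw [hxβ, hask] at this
      rw [this, hp, recState]
      conv_rhs => rw [List.foldl_append]
      dsimp only
      rw [List.foldl_append, hfold]
    simp only [List.nil_append] at hloop
    have hlen : (pow v (d + 1)).length ≤ N * ℓ := by
      rw [length_pow]
      exact Nat.mul_le_mul (hd.trans h.card_le) hℓ
    have hpow : IsOmega (pow v (d + 1)) β := hβ.pow (Nat.succ_ne_zero d)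
    obtain ⟨ms', hr', g1, g2, g3⟩ := runs_walk (T := T) h ht hX (ℓ := ℓ) (B := N * ℓ)
      (b := ask T (s ++ u) v) (p := p) (pow v (d + 1)) (done := []) (v := v) (q := p) (α := β)
      hpS rfl hpd (by simpa using hpow) hβ hβX hbit (by simpa using hlen) hℓ
    refine ⟨ms' ++ ms, ?_, ?_, ?_, ?_, ?_⟩
    · have hsu : (s ++ u).length ≤ N + L := by
        have := h.length_le s hs
        rw [List.length_append]
        omega
      have c1 := (runs_append (A := A) (T := T) s u).mono (t' := N + 1)
        (by have := h.length_le s hs; omega)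
      have c2 := (h.runs_runFrom (T := T) h.nil_mem (s ++ u)).mono (runFromCost_mono hsu)
      have c3 := (runs_iterateRun (T := T) h v S hqS).mono
        (t' := N * (runFromCost N M ℓ + 1) + 1) (by
          have := runFromCost_mono (N := N) (M := M) hℓ
          have := h.card_le
          gcongr)
      have c4 := hloop.mono (t' := loopWordCost N M ℓ (N * ℓ)) (by
          have := h.card_le
          unfold loopWordCost
          gcongr)
      have c5 := hr'.mono (t' := walkCost N M ℓ (N * ℓ)) (by
          unfold walkCost
          gcongr)
      have c6 := (runs_append (A := A) (T := T) ms' ms).mono (t' := N * ℓ + 1) (by omega)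
      unfold row
      rw [List.map_cons]
      unfold markRow
      refine Runs.step (c1.bind (c2.bind (c3.bind (c4.bind (c5.bind (hr.bind c6)))))) ?_
      rw [List.length_cons, Nat.succ_mul]
      conv_rhs => rw [markColCost]
      unfold markColCost
      omega
    · rw [List.length_append, List.length_cons, Nat.succ_mul]
      omega
    · intro m hm
      rcases List.mem_append.1 hm with hm | hm
      exacts [(g2 m hm).1, h2.isMark m hm]
    · intro m hm
      rcases List.mem_append.1 hm with hm | hm
      · exact ⟨s, (u, v), ⟨rfl, List.mem_cons_self⟩, (g2 m hm).2.1.symm, (g2 m hm).2.2⟩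
      · obtain ⟨s', e, ⟨hs', he⟩, hh⟩ := h2.sound m hm
        exact ⟨s', e, ⟨hs', List.mem_cons_of_mem _ he⟩, hh⟩
    · rintro s' e ⟨rfl, he⟩
      rcases List.mem_cons.1 he with rfl | he
      · obtain ⟨m, hm, hst, hbt⟩ := g3 hpow.1
        exact ⟨m, List.mem_append_left _ hm, hbt, hst⟩
      · obtain ⟨m, hm, hh⟩ := h2.complete s' e ⟨rfl, he⟩
        exact ⟨m, List.mem_append_right _ hm, hh⟩

theorem runs_markAll {E : List (List A × List A)} {B V c k : ℕ} (S' : List (List A))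
    (hrow : ∀ s ∈ S', ∃ ms, Runs T (markRow S tr s E (row T E s)) ms c ∧ ms.length ≤ k ∧
      IsMarking T U X S (look tr) B V (fun s' e => s' = s ∧ e ∈ E) ms) :
    ∃ ms, Runs T (markAll S tr E (S'.map fun s => (s, row T E s))) ms
        (S'.length * (c + (k + 1) + 1) + 1) ∧
      ms.length ≤ S'.length * k ∧
      IsMarking T U X S (look tr) B V (fun s e => s ∈ S' ∧ e ∈ E) ms := by
  induction S' with
  | nil =>
    exact ⟨[], Runs.step (Runs.pure _ 0) (by simp), by simp, by simp, by simp, by simp⟩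
  | cons s S' ih =>
    obtain ⟨ms', hr', g1, g2⟩ := hrow s List.mem_cons_self
    obtain ⟨ms, hr, h1, h2⟩ := ih fun s hs => hrow s (List.mem_cons_of_mem _ hs)
    refine ⟨ms' ++ ms, ?_, ?_, ?_, ?_, ?_⟩
    · rw [List.map_cons]
      unfold markAll
      refine Runs.step (hr'.bind (hr.bind (runs_append ms' ms))) ?_
      rw [List.length_cons, Nat.succ_mul]
      omega
    · rw [List.length_append, List.length_cons, Nat.succ_mul]
      omega
    · intro m hm
      rcases List.mem_append.1 hm with hm | hm
      exacts [g2.isMark m hm, h2.isMark m hm]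
    · intro m hm
      rcases List.mem_append.1 hm with hm | hm
      · obtain ⟨s', e, ⟨rfl, he⟩, hh⟩ := g2.sound m hm
        exact ⟨s', e, ⟨List.mem_cons_self, he⟩, hh⟩
      · obtain ⟨s', e, ⟨hs', he⟩, hh⟩ := h2.sound m hm
        exact ⟨s', e, ⟨List.mem_cons_of_mem _ hs', he⟩, hh⟩
    · rintro s' e ⟨hs', he⟩
      rcases List.mem_cons.1 hs' with rfl | hs'
      · obtain ⟨m, hm, hh⟩ := g2.complete s' e ⟨rfl, he⟩
        exact ⟨m, List.mem_append_left _ hm, hh⟩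
      · obtain ⟨m, hm, hh⟩ := h2.complete s' e ⟨hs', he⟩
        exact ⟨m, List.mem_append_right _ hm, hh⟩

/-! ### Conflicts and accepting states -/

theorem runs_conflictWith (h : IsGraph S tr N M) {letters : List A} (hlet : ∀ a, a ∈ letters)
    {B V : ℕ} {m : Mark A} (hm : IsMark U X S (look tr) B V m) (hmb : m.bit = true)
    (ms : List (Mark A)) (hms : ∀ m ∈ ms, IsMark U X S (look tr) B V m) :
    ∃ o, Runs T (conflictWith S tr letters m ms) o
        (ms.length * (connectCost N M letters.length + 1) + 1) ∧
      (o = none → ∀ m' ∈ ms, m'.bit = false → ¬ Conn (look tr) m.state m'.state) ∧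
      ∀ c, o = some c → IsConflict U X S (look tr) N B V c := by
  induction ms with
  | nil => exact ⟨none, Runs.step (Runs.pure _ 0) (by simp), by simp⟩
  | cons m' ms ih =>
    obtain ⟨o, hr, h1, h2⟩ := ih fun m hm => hms m (List.mem_cons_of_mem _ hm)
    have hm' := hms m' List.mem_cons_self
    have hcost : connectCost N M letters.length +
        (ms.length * (connectCost N M letters.length + 1) + 1) + 1 ≤
        (m' :: ms).length * (connectCost N M letters.length + 1) + 1 := by
      rw [List.length_cons, Nat.succ_mul]; omega
    rcases hb : m'.bit with _ | _
    · obtain ⟨o', hr', g1, g2⟩ := runs_connect (T := T) h hlet hm.1 hm'.1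
      rcases o' with _ | ⟨z, w⟩
      · refine ⟨o, ?_, fun hn => List.forall_mem_cons.2 ⟨fun _ => g1 rfl, h1 hn⟩, h2⟩
        unfold conflictWith
        simp only [hb, Bool.false_eq_true, if_false]
        exact Runs.step (hr'.bind hr) hcost
      · refine ⟨some ⟨m.state, m'.state, m.loop, m.per, m'.loop, m'.per, z, w⟩, ?_, by simp, ?_⟩
        · unfold conflictWith
          simp only [hb, Bool.false_eq_true, if_false]
          exact Runs.step (hr'.bind (Runs.pure _ 0)) (by omega)
        · rintro c ⟨⟩
          obtain ⟨gz, gw, lz, lw⟩ := g2 z w rfl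
          obtain ⟨a1, a2, a3, a4, α, a5, a6, a7, a8⟩ := hm
          obtain ⟨b1, b2, b3, b4, β, b5, b6, b7, b8⟩ := hm'
          exact ⟨a1, b1, a2, b2, gz, gw, a3, b3, a4, b4, lz, lw, ⟨α, a5, a6, a7, a8.2 hmb⟩,
            ⟨β, b5, b6, b7, fun hh => by simp [b8.1 hh] at hb⟩⟩
    · refine ⟨o, ?_, fun hn => List.forall_mem_cons.2 ⟨fun hf => by simp [hb] at hf, h1 hn⟩, h2⟩
      unfold conflictWith
      simp only [hb, if_true]
      exact Runs.step hr (by omega)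

theorem runs_findConflict (h : IsGraph S tr N M) {letters : List A} (hlet : ∀ a, a ∈ letters)
    {B V : ℕ} {marks : List (Mark A)} (hmarks : ∀ m ∈ marks, IsMark U X S (look tr) B V m)
    (ms : List (Mark A)) (hms : ∀ m ∈ ms, IsMark U X S (look tr) B V m) :
    ∃ o, Runs T (findConflict S tr letters marks ms) o
        (ms.length * (marks.length * (connectCost N M letters.length + 1) + 2) + 1) ∧
      (o = none → ∀ m ∈ ms, m.bit = true → ∀ m' ∈ marks, m'.bit = false →
        ¬ Conn (look tr) m.state m'.state) ∧
      ∀ c, o = some c → IsConflict U X S (look tr) N B V c := by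
  induction ms with
  | nil => exact ⟨none, Runs.step (Runs.pure _ 0) (by simp), by simp⟩
  | cons m ms ih =>
    obtain ⟨o, hr, h1, h2⟩ := ih fun m hm => hms m (List.mem_cons_of_mem _ hm)
    have hm := hms m List.mem_cons_self
    have hcost : marks.length * (connectCost N M letters.length + 1) + 1 +
        (ms.length * (marks.length * (connectCost N M letters.length + 1) + 2) + 1) + 1 ≤
        (m :: ms).length * (marks.length * (connectCost N M letters.length + 1) + 2) + 1 := by
      rw [List.length_cons, Nat.succ_mul]; omega
    rcases hb : m.bit with _ | _
    · refine ⟨o, ?_, fun hn => List.forall_mem_cons.2 ⟨fun hf => by simp [hb] at hf, h1 hn⟩, h2⟩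
      unfold findConflict
      simp only [hb, Bool.false_eq_true, if_false]
      exact Runs.step hr (by omega)
    · obtain ⟨o', hr', g1, g2⟩ := runs_conflictWith (T := T) h hlet hm hb marks hmarks
      rcases o' with _ | c
      · refine ⟨o, ?_, fun hn => List.forall_mem_cons.2 ⟨fun _ => g1 rfl, h1 hn⟩, h2⟩
        unfold findConflict
        simp only [hb, if_true]
        exact Runs.step (hr'.bind hr) hcost
      · refine ⟨some c, ?_, by simp, fun c' hc' => g2 c' hc'⟩
        unfold findConflict
        simp only [hb, if_true]
        exact Runs.step (hr'.bind (Runs.pure _ 0)) (by omega)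

theorem runs_rejecting (h : IsGraph S tr N M) {letters : List A} (hlet : ∀ a, a ∈ letters)
    {q : List A} (hq : q ∈ S) (ms : List (Mark A)) (hms : ∀ m ∈ ms, m.state ∈ S) :
    ∃ b, Runs T (rejecting S tr letters q ms) b
        (ms.length * (connectCost N M letters.length + 1) + 1) ∧
      (b = true ↔ ∃ m ∈ ms, m.bit = false ∧ Conn (look tr) q m.state) := by
  induction ms with
  | nil => exact ⟨false, Runs.step (Runs.pure _ 0) (by simp), by simp⟩
  | cons m ms ih =>
    obtain ⟨b, hr, h1⟩ := ih fun m hm => hms m (List.mem_cons_of_mem _ hm)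
    have hcost : connectCost N M letters.length +
        (ms.length * (connectCost N M letters.length + 1) + 1) + 1 ≤
        (m :: ms).length * (connectCost N M letters.length + 1) + 1 := by
      rw [List.length_cons, Nat.succ_mul]; omega
    rcases hb : m.bit with _ | _
    · obtain ⟨o', hr', g1, g2⟩ := runs_connect (T := T) h hlet hq (hms m List.mem_cons_self)
      rcases o' with _ | ⟨z, w⟩
      · refine ⟨b, ?_, ?_⟩
        · unfold rejecting
          simp only [hb, Bool.false_eq_true, if_false]
          exact Runs.step (hr'.bind hr) hcost
        · simp [h1, g1 rfl]
      · refine ⟨true, ?_, ?_⟩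
        · unfold rejecting
          simp only [hb, Bool.false_eq_true, if_false]
          exact Runs.step (hr'.bind (Runs.pure _ 0)) (by omega)
        · obtain ⟨gz, gw, -⟩ := g2 z w rfl
          simp only [true_iff]
          exact ⟨m, List.mem_cons_self, hb, ⟨z, gz⟩, ⟨w, gw⟩⟩
    · refine ⟨b, ?_, ?_⟩
      · unfold rejecting
        simp only [hb, if_true]
        exact Runs.step hr (by omega)
      · simp [h1, hb]

theorem runs_acceptingStates (h : IsGraph S tr N M) {letters : List A} (hlet : ∀ a, a ∈ letters)
    (ms : List (Mark A)) (hms : ∀ m ∈ ms, m.state ∈ S) (S' : List (List A)) (hS' : S' ⊆ S) :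
    ∃ F, Runs T (acceptingStates S tr letters ms S') F
        (S'.length * (ms.length * (connectCost N M letters.length + 1) + 2) + 1) ∧
      F.Sublist S' ∧
      ∀ q ∈ S', q ∈ F ↔ ¬ ∃ m ∈ ms, m.bit = false ∧ Conn (look tr) q m.state := by
  induction S' with
  | nil => exact ⟨[], Runs.step (Runs.pure _ 0) (by simp), by simp⟩
  | cons q S' ih =>
    obtain ⟨F, hr, h1, h2⟩ := ih fun q hq => hS' (List.mem_cons_of_mem _ hq)
    obtain ⟨b, hr', h3⟩ := runs_rejecting (T := T) h hlet (hS' List.mem_cons_self) ms hms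
    have hcost : ms.length * (connectCost N M letters.length + 1) + 1 +
        (S'.length * (ms.length * (connectCost N M letters.length + 1) + 2) + 1) + 1 ≤
        (q :: S').length * (ms.length * (connectCost N M letters.length + 1) + 2) + 1 := by
      rw [List.length_cons, Nat.succ_mul]; omega
    rcases b with _ | _
    · have h3' : ¬ ∃ m ∈ ms, m.bit = false ∧ Conn (look tr) q m.state := fun hh => by
        simpa using h3.2 hh
      refine ⟨q :: F, ?_, h1.cons_cons q, fun q' hq' => ?_⟩
      · unfold acceptingStates
        exact Runs.step (hr'.bind (hr.bind (t' := 0) (Runs.pure _ 0))) hcost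
      · by_cases he : q' = q
        · subst he
          simp only [List.mem_cons_self, true_iff]
          exact h3'
        · rw [← h2 q' ((List.mem_cons.1 hq').resolve_left he)]
          simp [he]
    · have h3' := h3.1 rfl
      refine ⟨F, ?_, h1.cons q, fun q' hq' => ?_⟩
      · unfold acceptingStates
        exact Runs.step (hr'.bind (hr.bind (t' := 0) (Runs.pure _ 0))) hcost
      · by_cases hm : q' ∈ S'
        · exact h2 q' hm
        · obtain rfl := (List.mem_cons.1 hq').resolve_right hm
          exact ⟨fun hF => absurd (h1.subset hF) hm, fun hn => absurd h3' hn⟩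

end Marking

/-! ## Conflict resolution -/

theorem foldl_pow {A : Type} {δ : List A → A → List A} {q : List A} {w : List A} (h : w.foldl δ q = q) (k : ℕ) :
    (pow w k).foldl δ q = q := by
  induction k with
  | zero => rfl
  | succ k ih => rw [pow_succ, List.foldl_append, h, ih]

section Search

variable {A : Type} [DecidableEq A] {T : Teacher A} {U D X : Set (Stream' A)}
  {S : List (List A)} {δ : List A → A → List A} {N B V : ℕ} {c : Conflict A}

section Costs

variable {R : Type} [CommSemiring R]

/-- A bound for the length of `x^k z`. -/
def blockBound (N B : R) : R := N * B + N

/-- A bound for the length of the distinguishing experiments. -/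
def experimentBound (N B : R) : R := N * (2 * blockBound N B) + blockBound N B

/-- A bound for the time of one round of `tryPowers`. -/
def tryPowersCost (N B V : R) : R :=
  4 * blockBound N B + 8 * N + 6 * experimentBound N B + 4 * V + 17

/-- A bound for the time of `tryExponent`. -/
def tryExponentCost (N B V : R) : R :=
  1 + 2 * (N * (B + 2) + 1) + 4 * (blockBound N B + 1) + 2 * (N + 1) +
    2 * (N + blockBound N B + V + 2) + (N * tryPowersCost N B V + 1)

end Costs

/-- The word `v p^ω` shows that the transitions `δ` are not those of a closed table. -/
def IsExperiment (U X : Set (Stream' A)) (S : List (List A)) (δ : List A → A → List A)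
    (v p : List A) : Prop :=
  ∃ γ ∈ X, IsOmega p γ ∧ ∃ s ∈ S, ¬ ((s ++ v) ++ₛ γ ∈ U ↔ v.foldl δ s ++ₛ γ ∈ U)

theorem runs_tryPowers (hT : T.IsCorrect U D) (hD : TrivialRightCongruence D)
    (hXD : ∀ α ∈ X, α ∉ D) (hc : IsConflict U X S δ N B V c) (hSN : ∀ s ∈ S, s.length ≤ N)
    {α β : Stream' A} (hα : α ∈ X) (hxα : IsOmega c.xper α) (hsα : c.s ++ₛ α ∈ U)
    (hβ : β ∈ X) (hyβ : IsOmega c.yper β) (htβ : c.t ++ₛ β ∉ U)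
    {z' w' : List A} (hz : z'.foldl δ c.s = c.t) (hw : w'.foldl δ c.t = c.s)
    (hzl : z'.length ≤ blockBound N B) (hwl : w'.length ≤ blockBound N B) (j i : ℕ)
    (hij : i + j ≤ N) :
    ∃ o, Runs T (tryPowers c z' w' (z' ++ w') (w' ++ z') j (pow (z' ++ w') i)
        (pow (w' ++ z') i)) o (j * tryPowersCost N B V + 1) ∧
      (o = none → ∀ l, i < l → l ≤ i + j → c.s ++ pow (z' ++ w') l ++ₛ α ∈ U ∧
        c.s ++ pow (z' ++ w') l ++ z' ++ₛ β ∉ U) ∧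
      ∀ v p, o = some (v, p) → v.length ≤ experimentBound N B ∧ p.length ≤ V ∧
        IsExperiment U X S δ v p := by
  induction j generalizing i with
  | zero =>
    exact ⟨none, Runs.step (Runs.pure _ 0) (by simp), by intros; omega, by simp⟩
  | succ j ih =>
    obtain ⟨o, hr, h1, h2⟩ := ih (i + 1) (by omega)
    set P := pow (z' ++ w') (i + 1) with hP
    set R := pow (w' ++ z') (i + 1) with hR
    have hPl : P.length ≤ N * (2 * blockBound N B) := by
      rw [hP, length_pow, List.length_append]
      exact Nat.mul_le_mul (by omega) (by omega)
    have hRl : R.length ≤ N * (2 * blockBound N B) := by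
      rw [hR, length_pow, List.length_append]
      exact Nat.mul_le_mul (by omega) (by omega)
    have hPf : P.foldl δ c.s = c.s := foldl_pow (by rw [List.foldl_append, hz, hw]) _
    have hRf : R.foldl δ c.t = c.t := foldl_pow (by rw [List.foldl_append, hw, hz]) _
    have hsl := hSN _ hc.s_mem
    have htl := hSN _ hc.t_mem
    have hxl := hc.xper_length
    have hyl := hc.yper_length
    obtain ⟨Ex, hEx⟩ : ∃ e, e = experimentBound N B := ⟨_, rfl⟩
    obtain ⟨Bl, hBl⟩ : ∃ e, e = blockBound N B := ⟨_, rfl⟩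
    obtain ⟨Q, hQ⟩ : ∃ e, e = N + Ex + V + 2 := ⟨_, rfl⟩
    have hEB : N * (2 * Bl) + Bl = Ex := by rw [hEx, hBl, experimentBound]
    have query : ∀ (s v p : List A) (γ : Stream' A), s.length ≤ N →
        v.length ≤ Ex → p.length ≤ V → γ ∈ X → IsOmega p γ →
        Runs T (askMember (s ++ v) p) (ask T (s ++ v) p) Q ∧
          (ask T (s ++ v) p = true ↔ s ++ v ++ₛ γ ∈ U) := by
      intro s v p γ hs hv hp hγ hpγ
      have hden : Denotes (s ++ v, p) (s ++ v ++ₛ γ) := ⟨γ, hpγ, rfl⟩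
      have hγD : s ++ v ++ₛ γ ∉ D := by rw [hD.append_mem_iff]; exact hXD γ hγ
      refine ⟨(hT.runs_askMember hden hγD).mono ?_, hT.ask_iff hden hγD⟩
      rw [List.length_append]
      omega
    rw [← hBl] at hPl hRl hzl hwl
    rw [← hEx] at h2 ⊢
    have lP : P.length ≤ Ex := by omega
    have lR : R.length ≤ Ex := by omega
    have lPz : (P ++ z').length ≤ Ex := by rw [List.length_append]; omega
    have lRw : (R ++ w').length ≤ Ex := by rw [List.length_append]; omega
    obtain ⟨q1, e1⟩ := query c.s P c.xper α hsl lP hxl hα hxα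
    obtain ⟨q2, e2⟩ := query c.t (R ++ w') c.xper α htl lRw hxl hα hxα
    obtain ⟨q3, e3⟩ := query c.s (P ++ z') c.yper β hsl lPz hyl hβ hyβ
    obtain ⟨q4, e4⟩ := query c.t R c.yper β htl lR hyl hβ hyβ
    obtain ⟨N₁, hN₁⟩ : ∃ e, e = N + 1 := ⟨_, rfl⟩
    obtain ⟨E₁, hE₁⟩ : ∃ e, e = Ex + 1 := ⟨_, rfl⟩
    obtain ⟨B₁, hB₁⟩ : ∃ e, e = 2 * Bl + 1 := ⟨_, rfl⟩
    have a1 := (runs_append (A := A) (T := T) (z' ++ w') (pow (z' ++ w') i)).mono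
      (t' := B₁) (by rw [List.length_append]; omega)
    have a2 := (runs_append (A := A) (T := T) (w' ++ z') (pow (w' ++ z') i)).mono
      (t' := B₁) (by rw [List.length_append]; omega)
    rw [← pow_succ, ← hP] at a1
    rw [← pow_succ, ← hR] at a2
    have a3 := (runs_append (A := A) (T := T) c.s P).mono (t' := N₁) (by omega)
    have a4 := (runs_append (A := A) (T := T) R w').mono (t' := E₁) (by omega)
    have a5 := (runs_append (A := A) (T := T) c.t (R ++ w')).mono (t' := N₁) (by omega)
    have a6 := (runs_append (A := A) (T := T) P z').mono (t' := E₁) (by omega)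
    have a7 := (runs_append (A := A) (T := T) c.s (P ++ z')).mono (t' := N₁) (by omega)
    have a8 := (runs_append (A := A) (T := T) c.t R).mono (t' := N₁) (by omega)
    obtain ⟨T₄, hT₄⟩ : ∃ e, e = j * tryPowersCost N B V + 1 := ⟨_, rfl⟩
    obtain ⟨T₃, hT₃⟩ : ∃ e, e = N₁ + (Q + T₄) := ⟨_, rfl⟩
    obtain ⟨T₂, hT₂⟩ : ∃ e, e = E₁ + (N₁ + (Q + T₃)) := ⟨_, rfl⟩
    obtain ⟨T₁, hT₁⟩ : ∃ e, e = E₁ + (N₁ + (Q + T₂)) := ⟨_, rfl⟩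
    have hcost : B₁ + (B₁ + (N₁ + (Q + T₁))) + 1 ≤ (j + 1) * tryPowersCost N B V + 1 := by
      have : tryPowersCost N B V = 4 * Bl + 8 * N + 6 * Ex + 4 * V + 17 := by
        rw [tryPowersCost, hBl, hEx]
      rw [Nat.add_mul, Nat.one_mul]
      omega
    rw [← hT₄] at hr
    by_cases b1 : c.s ++ P ++ₛ α ∈ U
    swap
    · refine ⟨some (P, c.xper), ?_, by simp, ?_⟩
      · unfold tryPowers
        refine Runs.step (a1.bind (a2.bind (a3.bind (q1.bind (t' := T₁) ?_)))) hcost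
        rw [Bool.eq_false_iff.2 fun h => b1 (e1.1 h)]
        exact Runs.pure _ _
      · rintro v p ⟨⟩
        refine ⟨lP, hxl, α, hα, hxα, c.s, hc.s_mem, fun hh => b1 (hh.2 ?_)⟩
        rwa [hPf]
    rw [← e1] at b1
    by_cases b2 : c.t ++ (R ++ w') ++ₛ α ∈ U
    swap
    · refine ⟨some (R ++ w', c.xper), ?_, by simp, ?_⟩
      · unfold tryPowers
        refine Runs.step (a1.bind (a2.bind (a3.bind (q1.bind (t' := T₁) ?_)))) hcost
        rw [b1]
        refine Runs.mono (Runs.bind a4 (Runs.bind a5 (Runs.bind q2 (t' := T₂) ?_))) hT₁.ge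
        rw [Bool.eq_false_iff.2 fun h => b2 (e2.1 h)]
        exact Runs.pure _ _
      · rintro v p ⟨⟩
        refine ⟨lRw, hxl, α, hα, hxα, c.t, hc.t_mem, fun hh => b2 (hh.2 ?_)⟩
        rwa [List.foldl_append, hRf, hw]
    rw [← e2] at b2
    by_cases b3 : c.s ++ (P ++ z') ++ₛ β ∈ U
    · refine ⟨some (P ++ z', c.yper), ?_, by simp, ?_⟩
      · unfold tryPowers
        refine Runs.step (a1.bind (a2.bind (a3.bind (q1.bind (t' := T₁) ?_)))) hcost
        rw [b1]
        refine Runs.mono (Runs.bind a4 (Runs.bind a5 (Runs.bind q2 (t' := T₂) ?_))) hT₁.ge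
        rw [b2]
        refine Runs.mono (Runs.bind a6 (Runs.bind a7 (Runs.bind q3 (t' := T₃) ?_))) hT₂.ge
        rw [e3.2 b3]
        exact Runs.pure _ _
      · rintro v p ⟨⟩
        refine ⟨lPz, hyl, β, hβ, hyβ, c.s, hc.s_mem, fun hh => htβ ?_⟩
        have := hh.1 b3
        rwa [List.foldl_append, hPf, hz] at this
    have b3' : ask T (c.s ++ (P ++ z')) c.yper = false :=
      Bool.eq_false_iff.2 fun h => b3 (e3.1 h)
    by_cases b4 : c.t ++ R ++ₛ β ∈ U
    · refine ⟨some (R, c.yper), ?_, by simp, ?_⟩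
      · unfold tryPowers
        refine Runs.step (a1.bind (a2.bind (a3.bind (q1.bind (t' := T₁) ?_)))) hcost
        rw [b1]
        refine Runs.mono (Runs.bind a4 (Runs.bind a5 (Runs.bind q2 (t' := T₂) ?_))) hT₁.ge
        rw [b2]
        refine Runs.mono (Runs.bind a6 (Runs.bind a7 (Runs.bind q3 (t' := T₃) ?_))) hT₂.ge
        rw [b3']
        refine Runs.mono (Runs.bind a8 (Runs.bind q4 (t' := T₄) ?_)) hT₃.ge
        rw [e4.2 b4]
        exact Runs.pure _ _
      · rintro v p ⟨⟩
        refine ⟨lR, hyl, β, hβ, hyβ, c.t, hc.t_mem, fun hh => htβ ?_⟩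
        have := hh.1 b4
        rwa [hRf] at this
    refine ⟨o, ?_, fun hn l hl hl' => ?_, h2⟩
    · unfold tryPowers
      refine Runs.step (a1.bind (a2.bind (a3.bind (q1.bind (t' := T₁) ?_)))) hcost
      rw [b1]
      refine Runs.mono (Runs.bind a4 (Runs.bind a5 (Runs.bind q2 (t' := T₂) ?_))) hT₁.ge
      rw [b2]
      refine Runs.mono (Runs.bind a6 (Runs.bind a7 (Runs.bind q3 (t' := T₃) ?_))) hT₂.ge
      rw [b3']
      refine Runs.mono (Runs.bind a8 (Runs.bind q4 (t' := T₄) ?_)) hT₃.ge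
      rw [Bool.eq_false_iff.2 fun h => b4 (e4.1 h)]
      exact hr
    · rcases Nat.eq_or_lt_of_le (Nat.succ_le_of_lt hl) with he | hlt
      · subst he
        exact ⟨e1.1 b1, by rw [List.append_assoc]; exact b3⟩
      · exact h1 hn l hlt (by omega)

theorem runs_tryExponent (hT : T.IsCorrect U D) (hD : TrivialRightCongruence D)
    (hU : WDBARecognizable U) (hXD : ∀ α ∈ X, α ∉ D) (hc : IsConflict U X S δ N B V c)
    (hSN : ∀ s ∈ S, s.length ≤ N) {k : ℕ} (hk : k ≤ N) :
    ∃ o, Runs T (tryExponent c k) o (tryExponentCost N B V) ∧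
      (o = none → k < index U D) ∧
      ∀ v p, o = some (v, p) → v.length ≤ experimentBound N B ∧ p.length ≤ V ∧
        IsExperiment U X S δ v p := by
  obtain ⟨α, hα, hx, hxα, hsα⟩ := hc.x_omega
  obtain ⟨β, hβ, hy, hyβ, htβ⟩ := hc.y_omega
  set z' := pow c.x k ++ c.z with hz'
  set w' := pow c.y k ++ c.w with hw'
  have hz : z'.foldl δ c.s = c.t := by
    rw [hz', List.foldl_append, foldl_pow hc.foldl_x, hc.foldl_z]
  have hw : w'.foldl δ c.t = c.s := by
    rw [hw', List.foldl_append, foldl_pow hc.foldl_y, hc.foldl_w]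
  have hxk : (pow c.x k).length ≤ N * B := by
    rw [length_pow]; exact Nat.mul_le_mul hk hc.x_length
  have hyk : (pow c.y k).length ≤ N * B := by
    rw [length_pow]; exact Nat.mul_le_mul hk hc.y_length
  have hzl : z'.length ≤ blockBound N B := by
    have := hc.z_length
    rw [hz', List.length_append]; unfold blockBound; omega
  have hwl : w'.length ≤ blockBound N B := by
    have := hc.w_length
    rw [hw', List.length_append]; unfold blockBound; omega
  have hle : blockBound N B ≤ experimentBound N B := by unfold experimentBound; omega
  obtain ⟨o, hr, h1, h2⟩ := runs_tryPowers hT hD hXD hc hSN hα hxα hsα hβ hyβ htβ hz hw hzl hwl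
    k 0 (by omega)
  have hsl := hSN _ hc.s_mem
  have htl := hSN _ hc.t_mem
  have hxl := hc.xper_length
  have hyl := hc.yper_length
  have hzβD : c.s ++ z' ++ₛ β ∉ D := by rw [hD.append_mem_iff]; exact hXD β hβ
  have hwαD : c.t ++ w' ++ₛ α ∉ D := by rw [hD.append_mem_iff]; exact hXD α hα
  have q1 := (hT.runs_askMember (u := c.s ++ z') (v := c.yper) ⟨β, hyβ, rfl⟩ hzβD).mono
    (t' := N + blockBound N B + V + 2) (by rw [List.length_append]; omega)
  have e1 := hT.ask_iff (e := (c.s ++ z', c.yper)) ⟨β, hyβ, rfl⟩ hzβD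
  have q2 := (hT.runs_askMember (u := c.t ++ w') (v := c.xper) ⟨α, hxα, rfl⟩ hwαD).mono
    (t' := N + blockBound N B + V + 2) (by rw [List.length_append]; omega)
  have e2 := hT.ask_iff (e := (c.t ++ w', c.xper)) ⟨α, hxα, rfl⟩ hwαD
  dsimp only at e1 e2
  have p1 := (runs_power (T := T) c.x k).mono (t' := N * (B + 2) + 1) (by
    have := hc.x_length
    gcongr)
  have p2 := (runs_power (T := T) c.y k).mono (t' := N * (B + 2) + 1) (by
    have := hc.y_length
    gcongr)
  have hble : N * B ≤ blockBound N B := by unfold blockBound; omega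
  have a1 := (runs_append (A := A) (T := T) (pow c.x k) c.z).mono (t' := blockBound N B + 1)
    (by omega)
  have a2 := (runs_append (A := A) (T := T) (pow c.y k) c.w).mono (t' := blockBound N B + 1)
    (by omega)
  have a3 := (runs_append (A := A) (T := T) c.s z').mono (t' := N + 1) (by omega)
  have a4 := (runs_append (A := A) (T := T) c.t w').mono (t' := N + 1) (by omega)
  have a5 := (runs_append (A := A) (T := T) z' w').mono (t' := blockBound N B + 1) (by omega)
  have a6 := (runs_append (A := A) (T := T) w' z').mono (t' := blockBound N B + 1) (by omega)
  have hcost : N * (B + 2) + 1 + (blockBound N B + 1 + (N * (B + 2) + 1 + (blockBound N B + 1 +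
      (N + 1 + (N + blockBound N B + V + 2 + (N + 1 + (N + blockBound N B + V + 2 +
      (blockBound N B + 1 + (blockBound N B + 1 + (N * tryPowersCost N B V + 1)))))))))) + 1 ≤
      tryExponentCost N B V := by
    unfold tryExponentCost
    omega
  have hkN := Nat.mul_le_mul_right (tryPowersCost N B V) hk
  by_cases b1 : c.s ++ z' ++ₛ β ∈ U
  · refine ⟨some (z', c.yper), ?_, by simp, ?_⟩
    · unfold tryExponent
      refine Runs.mono (Runs.step (p1.bind (a1.bind (p2.bind (a2.bind (a3.bind (q1.bind
        (r' := some (z', c.yper)) (t' := 0) ?_)))))) le_rfl) (by omega)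
      rw [e1.2 b1]
      exact Runs.pure _ _
    · rintro v p ⟨⟩
      refine ⟨hzl.trans hle, hyl, β, hβ, hyβ, c.s, hc.s_mem, fun hh => htβ ?_⟩
      have := hh.1 b1
      rwa [hz] at this
  have b1' : ask T (c.s ++ z') c.yper = false := Bool.eq_false_iff.2 fun h => b1 (e1.1 h)
  by_cases b2 : c.t ++ w' ++ₛ α ∈ U
  swap
  · refine ⟨some (w', c.xper), ?_, by simp, ?_⟩
    · unfold tryExponent
      refine Runs.mono (Runs.step (p1.bind (a1.bind (p2.bind (a2.bind (a3.bind (q1.bind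
        (r' := some (w', c.xper)) (t' := (N + 1 + (N + blockBound N B + V + 2 + 0)))
        ?_)))))) le_rfl) (by omega)
      rw [b1']
      refine Runs.bind a4 (Runs.bind q2 ?_)
      rw [Bool.eq_false_iff.2 fun h => b2 (e2.1 h)]
      exact Runs.pure _ _
    · rintro v p ⟨⟩
      refine ⟨hwl.trans hle, hxl, α, hα, hxα, c.t, hc.t_mem, fun hh => b2 (hh.2 ?_)⟩
      rwa [hw]
  refine ⟨o, ?_, fun hn => ?_, h2⟩
  · unfold tryExponent
    refine Runs.mono (Runs.step (p1.bind (a1.bind (p2.bind (a2.bind (a3.bind (q1.bind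
      (r' := o) (t' := (N + 1 + (N + blockBound N B + V + 2 + (blockBound N B + 1 +
        (blockBound N B + 1 + (k * tryPowersCost N B V + 1)))))) ?_)))))) le_rfl) (by omega)
    rw [b1']
    refine Runs.bind a4 (Runs.bind q2 ?_)
    rw [e2.2 b2]
    exact Runs.bind a5 (Runs.bind a6 hr)
  · by_contra! hlt
    refine not_forall_alternating_of_index_le hU hD hlt hx hy (hXD α hα) (hXD β hβ)
      (s := c.s) (z := c.z) (w := c.w) (fun i hi => ?_) (fun i hi => ?_)
    · rcases Nat.eq_zero_or_pos i with rfl | hpos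
      · simpa [pow] using hsα
      · exact (h1 hn i hpos (by omega)).1
    · rcases Nat.eq_zero_or_pos i with rfl | hpos
      · simpa [pow, hz'] using b1
      · exact (h1 hn i hpos (by omega)).2

end Search

/-! ## The hypothesis automaton -/

theorem mem_of_mem_nil_cons {A : Type} {S : List (List A)} (h : [] ∈ S) {q : List A}
    (hq : q ∈ [] :: S) : q ∈ S := by
  rcases List.mem_cons.1 hq with rfl | hq
  exacts [h, hq]

theorem Marked.of_conn {A : Type} {T : Teacher A} {S : List (List A)}
    {E : List (List A × List A)} {δ : List A → A → List A} {b : Bool} {p q : List A}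
    (h : Marked T δ S E b q) (hpq : Conn δ p q) : Marked T δ S E b p := by
  obtain ⟨s, hs, e, he, ha, hc⟩ := h
  exact ⟨s, hs, e, he, ha, hpq.trans hc⟩

theorem DEquiv.mem_iff {A : Type} {D L₁ L₂ : Set (Stream' A)} (h : DEquiv D L₁ L₂) {α : Stream' A}
    (hα : α ∉ D) : α ∈ L₁ ↔ α ∈ L₂ := by
  have := Set.ext_iff.1 h α
  simpa [hα] using this

section HypothesisAutomaton

variable {A : Type} [DecidableEq A] {T : Teacher A} {U D : Set (Stream' A)}
  {S F : List (List A)} {E : List (List A × List A)} {tr : List (List A × A × List A)}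
  {N M ℓ L : ℕ}

theorem look_eq_find? (tr : List (List A × A × List A)) (q : List A) (a : A) :
    look tr q a =
      ((tr.find? fun e => decide (e.1 = q ∧ e.2.1 = a)).map fun e => e.2.2).getD [] := by
  induction tr with
  | nil => rfl
  | cons e tr ih =>
    obtain ⟨p, b, t⟩ := e
    unfold look
    by_cases h : p = q ∧ b = a
    · simp [h.1, h.2]
    · rw [List.find?_cons_of_neg (by simpa using h), if_neg fun h' => h h'.symm, ih]

/-- The hypothesis with transition table `tr` and accepting states `F`. -/
abbrev hypothesis (S : List (List A)) (tr : List (List A × A × List A)) (F : List (List A)) :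
    Hypothesis A := ⟨[], S, tr, F⟩

theorem IsGraph.step_val (h : IsGraph S tr N M) (q : {q // q ∈ [] :: S}) (a : A) :
    ((hypothesis S tr F).toDFA.step q a).1 = look tr q.1 a := by
  have hq : q.1 ∈ S := mem_of_mem_nil_cons h.nil_mem q.2
  have hm := h.mem q.1 hq a
  rw [look_eq_find?] at hm ⊢
  simp only [Hypothesis.toDFA]
  split
  · next e he =>
    rw [he] at hm ⊢
    simp only [Option.map_some, Option.getD_some] at hm ⊢
    rw [dif_pos (List.mem_cons_of_mem _ hm)]
  · next he => rw [he]; rfl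

theorem IsGraph.evalFrom_val (h : IsGraph S tr N M) (q : {q // q ∈ [] :: S}) (w : List A) :
    ((hypothesis S tr F).toDFA.evalFrom q w).1 = w.foldl (look tr) q.1 := by
  induction w generalizing q with
  | nil => rfl
  | cons a w ih => rw [DFA.evalFrom_cons, ih, h.step_val, List.foldl_cons]

theorem IsGraph.eval_val (h : IsGraph S tr N M) (w : List A) :
    ((hypothesis S tr F).toDFA.eval w).1 = w.foldl (look tr) [] :=
  h.evalFrom_val _ w

theorem card_states_le (h : [] ∈ S) (hn : S.Nodup) :
    Nat.card {q : List A // q ∈ [] :: S} ≤ S.length := by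
  have hS : ∀ q : List A, q ∈ [] :: S ↔ q ∈ S.toFinset := by
    intro q
    simp only [List.mem_cons, List.mem_toFinset]
    exact ⟨fun hq => hq.elim (fun hq => hq ▸ h) id, Or.inr⟩
  rw [Nat.card_congr (Equiv.subtypeEquivRight hS), Nat.card_eq_fintype_card, Fintype.card_coe,
    List.toFinset_card_of_nodup hn]

theorem IsGraph.isWDBA (h : IsGraph S tr N M) (hfold : ∀ s ∈ S, s.foldl (look tr) [] = s)
    (hF : ∀ q ∈ S, q ∈ F ↔ ¬ Marked T (look tr) S E false q) :
    IsWDBA (hypothesis S tr F).toDFA where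
  finite := (List.finite_toSet ([] :: S)).to_subtype
  reachable q := by
    refine ⟨q.1, Subtype.ext ?_⟩
    rw [h.eval_val]
    exact hfold _ (mem_of_mem_nil_cons h.nil_mem q.2)
  weak q := by
    have hmem : ∀ p : {q // q ∈ [] :: S}, p.1 ∈ S := fun p => mem_of_mem_nil_cons h.nil_mem p.2
    have hconn : ∀ p ∈ mscc (hypothesis S tr F).toDFA q, Conn (look tr) q.1 p.1 := by
      rintro p ⟨⟨u, hu⟩, ⟨v, hv⟩⟩
      exact ⟨⟨u, by rw [← h.evalFrom_val (F := F), hu]⟩,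
        ⟨v, by rw [← h.evalFrom_val (F := F), hv]⟩⟩
    by_cases hq : q.1 ∈ F
    · refine .inl fun p hp => (hF _ (hmem p)).2 fun hm => (hF _ (hmem q)).1 hq ?_
      exact hm.of_conn (hconn p hp)
    · refine .inr (Set.disjoint_left.2 fun p hp hpF => hq ((hF _ (hmem q)).2 fun hm => ?_))
      exact (hF _ (hmem p)).1 hpF (hm.of_conn (hconn p hp).symm)

/-- Acceptance of ultimately periodic words by the hypothesis. -/
theorem IsGraph.mem_omegaLang_iff (h : IsGraph S tr N M) (hn : S.Nodup)
    (hM : IsWDBA (hypothesis S tr F).toDFA) {e : List A × List A} {α : Stream' A}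
    (he : Denotes e α) :
    α ∈ omegaLang (hypothesis S tr F).toDFA ↔ recState (look tr) S [] e ∈ F := by
  obtain ⟨β, hβ, rfl⟩ := he
  rw [mem_omegaLang_iff_pow hM (card_states_le h.nil_mem hn) e.1 hβ, recState, List.nil_append,
    ← List.foldl_append, ← h.eval_val (F := F)]
  rfl

theorem IsTable.isDMinimal (hS : IsTable U D S E ℓ L) (hD : TrivialRightCongruence D)
    (hU : DEquiv D (omegaLang (hypothesis S tr F).toDFA) U) :
    IsDMinimal D (hypothesis S tr F).toDFA := by
  intro Q' M' hM' hequiv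
  refine (card_states_le hS.nil_mem hS.nodup).trans ?_
  by_contra! hlt
  have := hM'.finite
  obtain ⟨i, j, hij, hj, h⟩ := exists_lt_eq_of_card le_rfl fun i => M'.eval (S[i]?.getD [])
  simp only [List.getElem?_eq_getElem (show i < S.length by omega),
    List.getElem?_eq_getElem (show j < S.length by omega), Option.getD_some] at h
  have := hS.distinct _ (List.getElem_mem _) _ (List.getElem_mem _) fun α hα => by
    have hαD : ∀ s : List A, s ++ₛ α ∉ D := fun s => by
      rw [hD.append_mem_iff]; exact hS.notMem α hα
    exact ((hU.mem_iff (hαD _)).symm.trans ((hequiv.mem_iff (hαD _)).trans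
      (append_mem_omegaLang_congr h α))).trans
        ((hequiv.mem_iff (hαD _)).symm.trans (hU.mem_iff (hαD _)))
  exact absurd ((hS.nodup.getElem_inj_iff).1 this) (by omega)

end HypothesisAutomaton

/-! ## One round of the algorithm -/

section Reduces

variable {A R R' : Type} {T : Teacher A}

/-- Up to membership queries and at most `t` units of time, `p` behaves like `q`. -/
def Reduces (T : Teacher A) (p q : Prog A R) (t : ℕ) : Prop :=
  ∀ h, ∃ t' ≤ t, ∃ evs, MemberEvents evs ∧
    p.run T h = ((q.run T (h ++ evs)).1, t' + (q.run T (h ++ evs)).2.1, (q.run T (h ++ evs)).2.2)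

theorem Reduces.of_eq {p q : Prog A R} (h : p = q) (t : ℕ) : Reduces T p q t := fun hist =>
  ⟨0, Nat.zero_le _, [], by simp [MemberEvents], by simp [h]⟩

theorem Runs.reduces {p : Prog A R} {f : R → Prog A R'} {r : R} {q : Prog A R'} {t t' : ℕ}
    (hp : Runs T p r t) (hf : Reduces T (f r) q t') : Reduces T (p >>= f) q (t + t') := fun h => by
  obtain ⟨s, hs, evs, he, hr⟩ := hp.run_bind (f := f) h
  obtain ⟨s', hs', evs', he', hr'⟩ := hf (h ++ evs)
  refine ⟨s + s', by omega, evs ++ evs', ?_, ?_⟩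
  · intro e h
    rcases List.mem_append.1 h with h | h
    exacts [he e h, he' e h]
  · rw [hr, hr']
    simp [add_assoc]

theorem Reduces.mono {p q : Prog A R} {t t' : ℕ} (h : Reduces T p q t) (ht : t ≤ t') :
    Reduces T p q t' := fun hist => by
  obtain ⟨s, hs, h⟩ := h hist
  exact ⟨s, hs.trans ht, h⟩

end Reduces

section Rounds

variable {A : Type} [DecidableEq A] {T : Teacher A} {U D : Set (Stream' A)}
  {S : List (List A)} {E : List (List A × List A)} {N K ℓ L : ℕ} {letters : List A}

section Costs

variable {R : Type} [CommSemiring R]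

/-- A bound for the number of marks. -/
def markBound (N K ℓ : R) : R := N * (K * (N * ℓ))

/-- A bound for the time of a round before the equivalence query. -/
def tableCost (N a K ℓ L : R) : R :=
  1 + (N * (fillRowCost N K ℓ L + 1) + 1) + transAllCost N a K ℓ L +
    markAllCost N (N * a) ℓ L (N * ℓ) K +
    (markBound N K ℓ * (markBound N K ℓ * (connectCost N (N * a) a + 1) + 2) + 1) +
    (N * (markBound N K ℓ * (connectCost N (N * a) a + 1) + 2) + 1)

/-- A bound for the size of a hypothesis. -/
def sizeBound (N a : R) : R := 1 + N * (N + 1) + N * a * (2 * N + 3) + N * (N + 1)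

end Costs

theorem sum_map_le {B : Type} (l : List B) (g : B → ℕ) (c : ℕ) (h : ∀ b ∈ l, g b ≤ c) :
    (l.map g).sum ≤ l.length * c := by
  have := List.sum_le_card_nsmul (l.map g) c (by simpa using h)
  simpa using this

theorem look_mem {tr : List (List A × A × List A)} {q : List A} {a : A}
    (h : ∃ t, (q, a, t) ∈ tr) : (q, a, look tr q a) ∈ tr := by
  obtain ⟨t, ht⟩ := h
  induction tr with
  | nil => simp at ht
  | cons e tr ih =>
    obtain ⟨p, b, t'⟩ := e
    unfold look
    split_ifs with hc
    · simp [hc.1, hc.2]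
    · refine List.mem_cons_of_mem _ (ih ?_)
      rcases List.mem_cons.1 ht with h | h
      · obtain ⟨rfl, h2⟩ := Prod.mk.inj h
        exact absurd ⟨(Prod.mk.inj h2).1.symm, rfl⟩ hc
      · exact h

/-- How a round goes on after the equivalence query about `H`. -/
def afterEquiv (S : List (List A)) (E : List (List A × List A)) (H : Hypothesis A) :
    Option (List A × List A) → Prog A (Config A)
  | none => pure (.done H)
  | some (u, v) => addSuffixes u v E >>= fun E' => pure (.table S E')

theorem table_round (hT : T.IsCorrect U D) (hD : TrivialRightCongruence D)
    (hlet : ∀ a, a ∈ letters) (hS : IsTable U D S E ℓ L) (hSN : S.length ≤ N)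
    (hEK : E.length ≤ K) :
    (∃ t, Runs T (round letters (.table S E)) (.table (t :: S) E)
        (tableCost N letters.length K ℓ L) ∧ IsTable U D (t :: S) E ℓ L) ∨
    ∃ tr, IsGraph S tr N (N * letters.length) ∧ IsTrans U (cols E) S (look tr) ∧
      ((∃ c, Runs T (round letters (.table S E)) (.search S E c 1)
          (tableCost N letters.length K ℓ L) ∧
          IsConflict U (cols E) S (look tr) N (N * ℓ) ℓ c) ∨
        ∃ F, F.Sublist S ∧ (∀ q ∈ S, q ∈ F ↔ ¬ Marked T (look tr) S E false q) ∧
          (∀ q, ¬ (Marked T (look tr) S E true q ∧ Marked T (look tr) S E false q)) ∧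
          (hypothesis S tr F).size ≤ sizeBound N letters.length ∧
          Reduces T (round letters (.table S E))
            (askEquiv (hypothesis S tr F) >>= afterEquiv S E (hypothesis S tr F))
            (tableCost N letters.length K ℓ L)) := by
  have hlenN : ∀ s ∈ S, s.length ≤ N := fun s hs => (hS.length_le s hs).trans hSN
  have hrow := row_eq_iff hT hD hS.period_ne_nil hS.notMem
  have hfill : ∀ (N' : ℕ) (s : List A), s.length ≤ N' →
      Runs T (fillRow s E) (row T E s) (fillRowCost N' E.length ℓ L) := fun N' s hs =>
    runs_fillRow hT hD hS.period_ne_nil hS.notMem hS.period_length hS.initial_length hs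
  have hfillRows := (runs_fillRows (S := S) fun s hs => hfill N s (hlenN s hs)).mono
    (t' := N * (fillRowCost N K ℓ L + 1) + 1) (by unfold fillRowCost; gcongr)
  obtain ⟨o, hto, h1, h2⟩ := runs_transAll (T := T) (letters := letters) hSN hEK S hlenN
    fun s hs a => hfill (N + 1) (s ++ [a]) (by simpa using hlenN s hs)
  replace hto := hto.mono (t' := transAllCost N letters.length K ℓ L) (by
    unfold transAllCost transFromCost fillRowCost; gcongr)
  rcases o with t | tr
  · left
    obtain ⟨⟨s, hs, a, rfl⟩, hne⟩ := h1 t rfl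
    refine ⟨s ++ [a], ?_, hS.cons hs a fun t ht he => hne t ht ((hrow _ _).2 he)⟩
    unfold round
    refine Runs.mono (Runs.step (Runs.bind hfillRows (Runs.bind hto (Runs.pure _ 0))) le_rfl) ?_
    unfold tableCost
    omega
  right
  obtain ⟨htl, hall, hent⟩ := h2 tr rfl
  have hlook : ∀ s ∈ S, ∀ a, (s, a, look tr s a) ∈ tr := fun s hs a =>
    look_mem (hall s hs a (hlet a))
  have hg : IsGraph S tr N (N * letters.length) :=
    ⟨hS.nil_mem, fun s hs a => (hent _ (hlook s hs a)).2.1, hlenN, hSN,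
      htl.le.trans (Nat.mul_le_mul_right _ hSN)⟩
  have htrans : IsTrans U (cols E) S (look tr) :=
    ⟨hg.mem, fun s hs a => (hrow _ _).1 (hent _ (hlook s hs a)).2.2⟩
  refine ⟨tr, hg, htrans, ?_⟩
  have hfold := hS.foldl_nil htrans
  obtain ⟨ms, hms, hlen, hmark⟩ := runs_markAll (T := T) (U := U) (X := cols E) (tr := tr)
    (B := N * ℓ) (V := ℓ) (E := E) S
    fun s hs => runs_markRow hg htrans hS.tail_mem (L := L) hs (hfold s hs) E fun e he => by
      obtain ⟨α, hα⟩ := exists_denotes (hS.period_ne_nil e he)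
      have hmem : α ∈ cols E := ⟨e, he, hα⟩
      exact ⟨hS.initial_length e he, hS.period_length e he, α, hmem, hα,
        (hT.ask_iff (hα.append s) (by rw [hD.append_mem_iff]; exact hS.notMem α hmem)).symm⟩
  replace hms := hms.mono (t' := markAllCost N (N * letters.length) ℓ L (N * ℓ) K) (by
    unfold markAllCost; gcongr)
  have hmlen : ms.length ≤ markBound N K ℓ := by
    refine hlen.trans ?_
    unfold markBound
    gcongr
  obtain ⟨o, ho, h3, h4⟩ := runs_findConflict (T := T) hg hlet hmark.isMark ms hmark.isMark
  replace ho := ho.mono (t' := markBound N K ℓ * (markBound N K ℓ *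
    (connectCost N (N * letters.length) letters.length + 1) + 2) + 1) (by gcongr)
  rcases o with _ | c
  swap
  · left
    refine ⟨c, ?_, h4 c rfl⟩
    unfold round
    refine Runs.mono (Runs.step (Runs.bind hfillRows (Runs.bind hto (Runs.bind hms
      (Runs.bind ho (Runs.pure _ 0))))) le_rfl) ?_
    unfold tableCost
    omega
  right
  obtain ⟨F, hF, hsub, hFm⟩ := runs_acceptingStates (T := T) hg hlet ms
    (fun m hm => (hmark.isMark m hm).1) S fun _ h => h
  replace hF := hF.mono (t' := N * (markBound N K ℓ *
    (connectCost N (N * letters.length) letters.length + 1) + 2) + 1) (by gcongr)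
  refine ⟨F, hsub, fun q hq => ?_, ?_, ?_, ?_⟩
  · rw [hFm q hq, hmark.exists_iff]
  · rintro q ⟨ht, hf⟩
    obtain ⟨m, hm, hb, hc⟩ := (hmark.exists_iff true q).2 ht
    obtain ⟨m', hm', hb', hc'⟩ := (hmark.exists_iff false q).2 hf
    exact h3 rfl m hm hb m' hm' hb' (hc.symm.trans hc')
  · have s1 := sum_map_le S (fun q => q.length + 1) (N + 1) fun q hq =>
      Nat.succ_le_succ (hlenN q hq)
    have s2 := sum_map_le tr (fun e => e.1.length + e.2.2.length + 3) (2 * N + 3) fun e he => by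
      have h5 := hlenN _ (hent e he).1
      have h6 := hlenN _ (hent e he).2.1
      omega
    have s3 := sum_map_le F (fun q => q.length + 1) (N + 1) fun q hq =>
      Nat.succ_le_succ (hlenN q (hsub.subset hq))
    have k1 := Nat.mul_le_mul_right (N + 1) hSN
    have k2 := Nat.mul_le_mul_right (2 * N + 3) hg.table_le
    have k3 := Nat.mul_le_mul_right (N + 1) (hsub.length_le.trans hSN)
    unfold Hypothesis.size sizeBound
    simp only [List.length_nil]
    omega
  · unfold round
    refine Reduces.mono (Runs.reduces Runs.step1 (Runs.reduces hfillRows (Runs.reduces hto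
      (Runs.reduces hms (Runs.reduces ho (Runs.reduces hF (Reduces.of_eq ?_ 0))))))) ?_
    · rfl
    · unfold tableCost
      omega

/-- The successors of a search configuration. -/
theorem search_round (hT : T.IsCorrect U D) (hD : TrivialRightCongruence D)
    (hU : WDBARecognizable U) (hS : IsTable U D S E ℓ L) (hSN : S.length ≤ N)
    {δ : List A → A → List A} {c : Conflict A}
    (hc : IsConflict U (cols E) S δ N (N * ℓ) ℓ c) (htrans : IsTrans U (cols E) S δ)
    (hL : experimentBound N (N * ℓ) ≤ L) {k : ℕ} (hk : k ≤ N) :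
    (k < index U D ∧ Runs T (round letters (.search S E c k)) (.search S E c (k + 1))
        (1 + tryExponentCost N (N * ℓ) ℓ + addSuffixesCost L ℓ)) ∨
    ∃ E', Runs T (round letters (.search S E c k)) (.table S E')
        (1 + tryExponentCost N (N * ℓ) ℓ + addSuffixesCost L ℓ) ∧
      IsTable U D S E' ℓ L ∧ E'.length ≤ E.length + (L + ℓ) ∧
      ∀ δ', ¬ IsTrans U (cols E') S δ' := by
  obtain ⟨o, ho, h1, h2⟩ := runs_tryExponent hT hD hU hS.notMem hc
    (fun s hs => (hS.length_le s hs).trans hSN) hk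
  rcases o with _ | ⟨v, p⟩
  · refine .inl ⟨h1 rfl, ?_⟩
    unfold round
    exact Runs.mono (Runs.step (Runs.bind ho (Runs.pure _ 0)) le_rfl) (by omega)
  · right
    obtain ⟨hv, hp, γ, hγ, hpγ, s, hs, hns⟩ := h2 v p rfl
    have hden : Denotes (v, p) (v ++ₛ γ) := ⟨γ, hpγ, rfl⟩
    obtain ⟨X, hX, hXl, hX1, hX2⟩ := runs_addSuffixes (T := T) v p hden E
    have hvL := hv.trans hL
    refine ⟨X ++ E, ?_, ?_, ?_, fun δ' hδ' => hns ?_⟩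
    · unfold round
      have hX' := hX.mono (t' := addSuffixesCost L ℓ) (by unfold addSuffixesCost; gcongr)
      exact Runs.mono (Runs.step (Runs.bind ho (Runs.bind hX' (Runs.pure _ 0))) le_rfl) (by omega)
    · exact hS.addSuffixes hD (α := v ++ₛ γ)
        (by rw [hD.append_mem_iff]; exact hS.notMem γ hγ) le_rfl le_rfl
        (fun e he => ⟨(hX1 e he).1.trans hvL, (hX1 e he).2.1.le.trans hp, (hX1 e he).2.2⟩) hX2
    · rw [List.length_append]
      omega
    · obtain ⟨e, he, hd⟩ := hX2 0
      have hS' : IsTable U D S (X ++ E) ℓ L := hS.addSuffixes hD (α := v ++ₛ γ)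
        (by rw [hD.append_mem_iff]; exact hS.notMem γ hγ) le_rfl le_rfl
        (fun e he => ⟨(hX1 e he).1.trans hvL, (hX1 e he).2.1.le.trans hp, (hX1 e he).2.2⟩) hX2
      have := hδ'.append_mem_iff hS'.tail_mem hs v (β := γ)
        ⟨e, List.mem_append_left _ he, by simpa using hd⟩
      rwa [hS.foldl_congr htrans (hδ'.mono (cols_subset_append X E)) hs v,
        ← Stream'.append_append_stream] at this

end Rounds

/-! ## Termination and the running time -/

section Events

variable {A : Type}

theorem longestCex_append (h h' : List (Event A)) :
    longestCex (h ++ h') = max (longestCex h) (longestCex h') := by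
  induction h with
  | nil => simp [longestCex]
  | cons e h ih => cases e <;> simp [longestCex, ih, max_assoc]

theorem MemberEvents.longestCex_eq {evs : List (Event A)} (h : MemberEvents evs) :
    longestCex evs = 0 := by
  induction evs with
  | nil => rfl
  | cons e evs ih =>
    obtain ⟨u, v, ans, rfl, -⟩ := h e List.mem_cons_self
    exact ih fun e he => h e (List.mem_cons_of_mem _ he)

/-- No membership query in `h` concerns an empty period or a don't-care word. -/
def GoodTrace (h : List (Event A)) : Prop :=
  ∀ (u v : List A) (ans : Answer), Event.member u v ans ∈ h → v ≠ [] ∧ ans ≠ Answer.dontCare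

theorem GoodTrace.append {h evs : List (Event A)} (hh : GoodTrace h) (he : MemberEvents evs) :
    GoodTrace (h ++ evs) := by
  intro u v ans hm
  rcases List.mem_append.1 hm with hm | hm
  · exact hh u v ans hm
  · obtain ⟨u', v', ans', heq, hv, ha⟩ := he _ hm
    cases heq
    exact ⟨hv, ha⟩

theorem GoodTrace.equiv {h : List (Event A)} (hh : GoodTrace h) (H : Hypothesis A)
    (ans : Option (List A × List A)) : GoodTrace (h ++ [.equiv H ans]) := by
  intro u v a hm
  rcases List.mem_append.1 hm with hm | hm
  · exact hh u v a hm
  · simp at hm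

end Events

section Progress

variable {A : Type} {T : Teacher A} {U D : Set (Stream' A)}
  {S : List (List A)} {E : List (List A × List A)} {ℓ L n r : ℕ}

/-- If the table is closed, then at least `n + 3` is left of the budget `r`, and if moreover there are no
conflicting marks, then one unit for each accepting state besides. -/
def Budget (T : Teacher A) (U : Set (Stream' A)) (n : ℕ) (S : List (List A))
    (E : List (List A × List A)) (r : ℕ) : Prop :=
  ∀ δ, IsTrans U (cols E) S δ → n + 3 ≤ r ∧
    ((∀ q, ¬ (Marked T δ S E true q ∧ Marked T δ S E false q)) →
      ∀ F : List (List A), F.Nodup → (∀ q ∈ F, q ∈ S ∧ ¬ Marked T δ S E false q) →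
        F.length + n + 4 ≤ r)

theorem budget_length_add (S : List (List A)) (E : List (List A × List A)) :
    Budget T U n S E (S.length + n + 4) := fun _ _ =>
  ⟨by omega, fun _ F hF hsub => by
    have := (hF.subperm fun q hq => (hsub q hq).1).length_le
    omega⟩

theorem IsTable.recState_congr (hS : IsTable U D S E ℓ L) {δ δ' : List A → A → List A}
    (h : IsTrans U (cols E) S δ) (h' : IsTrans U (cols E) S δ') (s : List A)
    (e : List A × List A) : recState δ' S s e = recState δ S s e := by
  rw [recState, recState, hS.foldl_congr h h' hS.nil_mem,
    hS.foldl_congr h h' (h.foldl_mem hS.nil_mem _)]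

theorem IsTable.marked_congr (hS : IsTable U D S E ℓ L) {δ δ' : List A → A → List A}
    (h : IsTrans U (cols E) S δ) (h' : IsTrans U (cols E) S δ') {q : List A} (hq : q ∈ S)
    (E' : List (List A × List A)) (b : Bool) :
    Marked T δ' S E' b q ↔ Marked T δ S E' b q := by
  have hr : ∀ p ∈ S, ∀ p', Reach δ' p p' ↔ Reach δ p p' := fun p hp p' =>
    exists_congr fun w => by rw [hS.foldl_congr h h' hp]
  unfold Marked
  refine exists_congr fun s => and_congr_right fun _ => exists_congr fun e =>
    and_congr_right fun _ => and_congr_right fun _ => ?_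
  have hm : recState δ S s e ∈ S := h.foldl_mem (h.foldl_mem hS.nil_mem _) _
  rw [hS.recState_congr h h', Conn, Conn, hr _ hq, hr _ hm]

theorem Marked.append {δ : List A → A → List A} {b : Bool} {q : List A}
    (h : Marked T δ S E b q) (X : List (List A × List A)) : Marked T δ S (X ++ E) b q := by
  obtain ⟨s, hs, e, he, h⟩ := h
  exact ⟨s, hs, e, List.mem_append_right _ he, h⟩

theorem isTable_initial (U D : Set (Stream' A)) (ℓ L : ℕ) : IsTable U D [[]] [] ℓ L where
  nil_mem := by simp
  nodup := by simp
  prefix_mem s a h := by simp at h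
  length_le s h := by simp_all
  distinct s hs t ht _ := by simp_all
  period_ne_nil := by simp
  period_length := by simp
  initial_length := by simp
  notMem α h := by simp [cols] at h
  tail_mem α h := by simp [cols] at h

end Progress

section Progress

variable {A : Type} [DecidableEq A] {T : Teacher A} {U D : Set (Stream' A)}
  {S : List (List A)} {E : List (List A × List A)} {ℓ L n r : ℕ} {letters : List A}

/-- A counterexample either reveals a conflict or removes an accepting component. -/
theorem Budget.counterexample (hT : T.IsCorrect U D) (hS : IsTable U D S E ℓ L)
    (hb : Budget T U n S E r) {tr : List (List A × A × List A)} {N M : ℕ} (hg : IsGraph S tr N M)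
    (ht : IsTrans U (cols E) S (look tr)) {F : List (List A)} (hF : F.Sublist S)
    (hFm : ∀ q ∈ S, q ∈ F ↔ ¬ Marked T (look tr) S E false q)
    (hno : ∀ q, ¬ (Marked T (look tr) S E true q ∧ Marked T (look tr) S E false q))
    {α : Stream' A} (hα : α ∉ D)
    (hcex : α ∈ (omegaLang (hypothesis S tr F).toDFA \ U) ∪
      (U \ omegaLang (hypothesis S tr F).toDFA))
    {X : List (List A × List A)} (hX : ∃ e ∈ X, Denotes e α) :
    n + 4 ≤ r ∧ Budget T U n S (X ++ E) (r - 1) := by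
  have hr := (hb _ ht).2 hno F (hS.nodup.sublist hF)
    fun q hq => ⟨hF.subset hq, (hFm q (hF.subset hq)).1 hq⟩
  refine ⟨by omega, fun δ' hδ' => ⟨by omega, fun hno' F' hF'n hF' => ?_⟩⟩
  have hδ := hδ'.mono (cols_subset_append X E)
  obtain ⟨e, he, hd⟩ := hX
  have hask := hT.ask_iff hd hα
  have hfold := hS.foldl_nil ht
  have hM := hg.isWDBA hfold hFm
  have hlang := hg.mem_omegaLang_iff hS.nodup hM hd
  set p := recState (look tr) S [] e with hp
  have hpS : p ∈ S := hg.foldl_mem (hg.foldl_mem hg.nil_mem _) _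
  have hmark : Marked T δ' S (X ++ E) (ask T e.1 e.2) p :=
    ⟨[], hS.nil_mem, e, List.mem_append_left _ he, by simp,
      by rw [hS.recState_congr ht hδ]; exact Conn.refl _ _⟩
  have hsub : F' ⊆ F := fun q hq => by
    obtain ⟨hqS, hqm⟩ := hF' q hq
    exact (hFm q hqS).2 fun hm => hqm (((hS.marked_congr ht hδ hqS E false).2 hm).append X)
  rcases hcex with ⟨hH, hU⟩ | ⟨hU, hH⟩
  · have hpF := hlang.1 hH
    rw [Bool.eq_false_iff.2 fun h => hU (hask.1 h)] at hmark
    have hpF' : p ∉ F' := fun h => (hF' p h).2 hmark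
    have := (List.Nodup.subperm (List.nodup_cons.2 ⟨hpF', hF'n⟩)
      (List.cons_subset.2 ⟨hpF, hsub⟩)).length_le
    rw [List.length_cons] at this
    omega
  · rw [hask.2 hU] at hmark
    have hpF : p ∉ F := fun h => hH (hlang.2 h)
    have hm : Marked T (look tr) S E false p := by
      by_contra hm
      exact hpF ((hFm p hpS).2 hm)
    exact absurd ⟨hmark, ((hS.marked_congr ht hδ hpS E false).2 hm).append X⟩ (hno' p)

section Costs

variable {R : Type} [CommSemiring R]

/-- A bound for the initial parts of the columns. -/
def initialBound (n ℓ : R) : R := experimentBound n (n * ℓ) + ℓ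

/-- A bound for the number of columns added in one round. -/
def newColsBound (n ℓ : R) : R := initialBound n ℓ + ℓ

/-- A bound for the number of rounds. -/
def roundsBound (n : R) : R := n * (2 * n + 5) + 2 * n + 4

/-- A bound for the number of columns. -/
def colsBound (n ℓ : R) : R := roundsBound n * newColsBound n ℓ

/-- A bound for the time of a round. -/
def roundCost (n ℓ a : R) : R :=
  tableCost n a (colsBound n ℓ) ℓ (initialBound n ℓ) + (sizeBound n a + ℓ + 2) +
    (1 + tryExponentCost n (n * ℓ) ℓ) + addSuffixesCost (initialBound n ℓ) ℓ

/-- A bound for the running time of the algorithm. -/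
def learnCost (n ℓ a : R) : R := roundsBound n * roundCost n ℓ a

end Costs

theorem initialBound_mono {ℓ ℓ' : ℕ} (h : ℓ ≤ ℓ') : initialBound n ℓ ≤ initialBound n ℓ' := by
  unfold initialBound experimentBound blockBound
  gcongr

theorem newColsBound_mono {ℓ ℓ' : ℕ} (h : ℓ ≤ ℓ') : newColsBound n ℓ ≤ newColsBound n ℓ' :=
  Nat.add_le_add (initialBound_mono h) h

theorem colsBound_mono {ℓ ℓ' : ℕ} (h : ℓ ≤ ℓ') : colsBound n ℓ ≤ colsBound n ℓ' :=
  Nat.mul_le_mul_left _ (newColsBound_mono h)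

theorem tableCost_mono {ℓ ℓ' K K' L' a : ℕ} (h : ℓ ≤ ℓ') (hK : K ≤ K') (hL : L ≤ L') :
    tableCost n a K ℓ L ≤ tableCost n a K' ℓ' L' := by
  unfold tableCost fillRowCost transAllCost transFromCost fillRowCost markAllCost
    markColCost runFromCost loopWordCost runFromCost walkCost markBound
  gcongr

theorem roundCost_mono {ℓ ℓ' a : ℕ} (h : ℓ ≤ ℓ') : roundCost n ℓ a ≤ roundCost n ℓ' a := by
  have h1 := initialBound_mono (n := n) h
  have h2 := tableCost_mono (n := n) (a := a) h (colsBound_mono (n := n) h) h1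
  unfold roundCost tryExponentCost tryPowersCost experimentBound blockBound addSuffixesCost
  gcongr

/-- The invariant of the main loop: `ℓ` bounds the counterexamples so far, `K` the number of columns, and
`P` the number of rounds to come. -/
def Inv (T : Teacher A) (U D : Set (Stream' A)) (n ℓ K P : ℕ) : Config A → Prop
  | .table S E => IsTable U D S E ℓ (initialBound n ℓ) ∧ E.length ≤ K ∧
      ∃ r, Budget T U n S E r ∧ (n - S.length) * (2 * n + 5) + r ≤ P
  | .search S E c k => IsTable U D S E ℓ (initialBound n ℓ) ∧ E.length ≤ K ∧ k ≤ n ∧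
      (∃ δ, IsTrans U (cols E) S δ ∧ IsConflict U (cols E) S δ n (n * ℓ) ℓ c) ∧
      (n - S.length) * (2 * n + 5) + (n - k) + 3 ≤ P
  | .done _ => False

theorem Inv.mono {A : Type} {T : Teacher A} {U D : Set (Stream' A)} {K K' P : ℕ} {cfg : Config A} (h : Inv T U D n ℓ K P cfg) (hK : K ≤ K') :
    Inv T U D n ℓ K' P cfg := by
  rcases cfg with ⟨S, E⟩ | ⟨S, E, c, k⟩ | H
  · exact ⟨h.1, h.2.1.trans hK, h.2.2⟩
  · exact ⟨h.1, h.2.1.trans hK, h.2.2⟩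
  · exact h

/-- The properties of the result. -/
def Solves (U D : Set (Stream' A)) (H : Hypothesis A) : Prop :=
  IsWDBA H.toDFA ∧ DEquiv D (omegaLang H.toDFA) U ∧ IsDMinimal D H.toDFA

/-- A round decreases the number of rounds to come, or it is the last one. -/
theorem Inv.round (hT : T.IsCorrect U D) (hD : TrivialRightCongruence D)
    (hU : WDBARecognizable U) (hn : index U D = n) (hlet : ∀ a, a ∈ letters) {K P : ℕ}
    {cfg : Config A} {h : List (Event A)} (hK : K ≤ colsBound n (longestCex h))
    (hinv : Inv T U D n (longestCex h) K P cfg) (hh : GoodTrace h) :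
    ∃ cfg' t h', (round letters cfg).run T h = (cfg', t, h') ∧ GoodTrace h' ∧
      longestCex h ≤ longestCex h' ∧ t ≤ roundCost n (longestCex h') letters.length ∧
      ((∃ H, cfg' = .done H ∧ Solves U D H ∧ 1 ≤ P) ∨
        ∃ P', P' + 1 ≤ P ∧
          Inv T U D n (longestCex h') (K + newColsBound n (longestCex h')) P' cfg') := by
  have hone := hU.index_pos D
  rw [hn] at hone
  -- rounds in which only membership queries are asked
  have hmember : ∀ {cfg' : Config A} {t : ℕ}, Runs T (WDBALearning.round letters cfg) cfg' t →
      t ≤ roundCost n (longestCex h) letters.length → (∃ P', P' + 1 ≤ P ∧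
        Inv T U D n (longestCex h) (K + newColsBound n (longestCex h)) P' cfg') →
      ∃ cfg' t h', (WDBALearning.round letters cfg).run T h = (cfg', t, h') ∧ GoodTrace h' ∧
      longestCex h ≤ longestCex h' ∧ t ≤ roundCost n (longestCex h') letters.length ∧
      ((∃ H, cfg' = .done H ∧ Solves U D H ∧ 1 ≤ P) ∨
        ∃ P', P' + 1 ≤ P ∧
          Inv T U D n (longestCex h') (K + newColsBound n (longestCex h')) P' cfg') := by
    intro cfg' t hrun ht hP'
    obtain ⟨t', ht', evs, hev, hrun⟩ := hrun h
    have hlc : longestCex (h ++ evs) = longestCex h := by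
      rw [longestCex_append, hev.longestCex_eq]; simp
    exact ⟨cfg', t', h ++ evs, hrun, hh.append hev, hlc.ge, by rw [hlc]; exact ht'.trans ht,
      .inr (by rwa [hlc])⟩
  rcases cfg with ⟨S, E⟩ | ⟨S, E, c, k⟩ | H
  · obtain ⟨hS, hEK, r, hr, hP⟩ := hinv
    have hSn : S.length ≤ n := hn ▸ hS.length_le_index hU
    rcases table_round hT hD hlet hS hSn (hEK.trans hK) with ⟨t, hrun, hS'⟩ |
      ⟨tr, hg, ht, ⟨c, hrun, hc⟩ | ⟨F, hF, hFm, hno, hsize, hred⟩⟩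
    · refine hmember hrun (by unfold roundCost; omega) ?_
      have hSn' : (t :: S).length ≤ n := hn ▸ hS'.length_le_index hU
      rw [List.length_cons] at hSn'
      obtain ⟨d, hd⟩ := Nat.exists_eq_add_of_le hSn'
      have e1 : n - S.length = d + 1 := by omega
      have e2 : n - (t :: S).length = d := by rw [List.length_cons]; omega
      rw [e1, Nat.succ_mul] at hP
      refine ⟨P - 1, by omega, hS', by omega, (t :: S).length + n + 4, budget_length_add _ _, ?_⟩
      rw [e2, List.length_cons]
      omega
    · have hr' := (hr _ ht).1
      exact hmember hrun (by unfold roundCost; omega)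
        ⟨P - 1, by omega, hS, by omega, hone, ⟨_, ht, hc⟩, by omega⟩
    · obtain ⟨t', ht', evs, hev, hrun⟩ := hred h
      have hlc : longestCex (h ++ evs) = longestCex h := by
        rw [longestCex_append, hev.longestCex_eq]; simp
      have hM := hg.isWDBA (hS.foldl_nil ht) hFm
      have hr' := (hr _ ht).1
      set H := hypothesis S tr F with hH
      have hequiv : (askEquiv H).run T (h ++ evs) = (T.equiv (h ++ evs) H,
          H.size + cexLength (T.equiv (h ++ evs) H) + 2,
          h ++ evs ++ [.equiv H (T.equiv (h ++ evs) H)]) := by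
        unfold askEquiv
        rw [Prog.run_bind]
        simp [step1, Prog.run]
        omega
      rw [Prog.run_bind, hequiv] at hrun
      dsimp only at hrun
      rcases hans : T.equiv (h ++ evs) H with _ | ⟨u, v⟩
      · rw [hans] at hrun
        set h' := h ++ evs ++ [.equiv H none] with hh'
        have hlc' : longestCex h' = longestCex h := by
          rw [hh', longestCex_append, hlc]; simp [longestCex, cexLength]
        refine ⟨.done H, t' + (H.size + 0 + 2 + 0), h', hrun, (hh.append hev).equiv _ _, hlc'.ge,
          ?_, .inl ⟨H, rfl, ⟨hM, hT.equiv_none _ H hM hans, ?_⟩, by omega⟩⟩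
        · rw [hlc']
          unfold roundCost
          omega
        · exact hS.isDMinimal hD (hT.equiv_none _ H hM hans)
      · rw [hans] at hrun
        obtain ⟨hv, hαD, hcex⟩ := hT.equiv_some _ H u v hM hans
        have hden := denotes_ultPeriodic u v hv
        obtain ⟨X, hX, hXl, hX1, hX2⟩ := runs_addSuffixes (T := T) u v hden E
        obtain ⟨t'', ht'', evs', hev', hrun'⟩ := (hX.bind (f := fun E' => pure (Config.table S E'))
          (Runs.pure (T := T) (Config.table S (X ++ E)) 0)) (h ++ evs ++ [.equiv H (some (u, v))])
        simp only [afterEquiv] at hrun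
        rw [hrun'] at hrun
        dsimp only at hrun
        set h' := h ++ evs ++ [.equiv H (some (u, v))] ++ evs' with hh'
        have hlc' : longestCex h' = max (longestCex h) (u.length + v.length) := by
          rw [hh', longestCex_append, hev'.longestCex_eq, longestCex_append, hlc]
          simp [longestCex, cexLength]
        have hle : longestCex h ≤ longestCex h' := hlc' ▸ le_max_left _ _
        have huv : u.length + v.length ≤ longestCex h' := hlc' ▸ le_max_right _ _
        clear_value h'
        have hiL : longestCex h' ≤ initialBound n (longestCex h') := by
          unfold initialBound; omega
        have hm := initialBound_mono (n := n) hle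
        refine ⟨.table S (X ++ E), _, h', hrun, ?_, hle, ?_, .inr ?_⟩
        · rw [hh']
          exact ((hh.append hev).equiv _ _).append hev'
        · have c2 : addSuffixesCost u.length v.length ≤
              addSuffixesCost (initialBound n (longestCex h')) (longestCex h') := by
            have : u.length ≤ initialBound n (longestCex h') := by omega
            have : v.length ≤ longestCex h' := by omega
            unfold addSuffixesCost
            gcongr
          have c3 := tableCost_mono (n := n) (a := letters.length) hle
            (colsBound_mono (n := n) hle) hm
          have c4 : cexLength (some (u, v)) = u.length + v.length := rfl
          rw [c4]
          unfold roundCost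
          omega
        · obtain ⟨hr1, hr2⟩ := hr.counterexample hT hS hg ht hF hFm hno hαD hcex (X := X)
            (by simpa using hX2 0)
          refine ⟨P - 1, by omega, hS.addSuffixes hD hαD hle hm (fun e he => ?_) hX2, ?_, r - 1, hr2,
            by omega⟩
          · obtain ⟨g1, g2, g3⟩ := hX1 e he
            exact ⟨by omega, by omega, g3⟩
          · rw [List.length_append]
            unfold newColsBound
            omega
  · obtain ⟨hS, hEK, hk, ⟨δ, ht, hc⟩, hP⟩ := hinv
    have hSn : S.length ≤ n := hn ▸ hS.length_le_index hU
    rcases search_round (letters := letters) hT hD hU hS hSn hc ht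
      (by unfold initialBound; omega) hk with ⟨hkn, hrun⟩ | ⟨E', hrun, hS', hE', hncl⟩
    · rw [hn] at hkn
      exact hmember hrun (by unfold roundCost; omega)
        ⟨P - 1, by omega, hS, by omega, hkn, ⟨δ, ht, hc⟩, by omega⟩
    · refine hmember hrun (by unfold roundCost; omega)
        ⟨P - 1, by omega, hS', ?_, 0, fun δ' hδ' => absurd hδ' (hncl δ'), by omega⟩
      unfold newColsBound
      omega
  · exact hinv.elim

/-- After `m` rounds, the learner is done, or at most `roundsBound n - m` rounds remain. -/
theorem learn_invariant (hT : T.IsCorrect U D) (hD : TrivialRightCongruence D)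
    (hU : WDBARecognizable U) (hn : index U D = n) (hlet : ∀ a, a ∈ letters) (m : ℕ) :
    (∃ m' H time trace, learn T letters m' = (.done H, time, trace) ∧ Solves U D H ∧
      GoodTrace trace ∧ time ≤ learnCost n (longestCex trace) letters.length) ∨
    ∃ cfg time trace P, learn T letters m = (cfg, time, trace) ∧ GoodTrace trace ∧
      m + P ≤ roundsBound n ∧ time ≤ m * roundCost n (longestCex trace) letters.length ∧
      Inv T U D n (longestCex trace) (m * newColsBound n (longestCex trace)) P cfg := by
  induction m with
  | zero =>
    refine .inr ⟨_, _, _, roundsBound n, rfl, by simp [GoodTrace], by simp, by simp,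
      isTable_initial U D _ _, by simp, _, budget_length_add _ _, ?_⟩
    have := Nat.mul_le_mul_right (2 * n + 5) (Nat.sub_le n 1)
    have := hU.index_pos D
    unfold roundsBound
    simp only [List.length_singleton]
    omega
  | succ m ih =>
    rcases ih with hdone | ⟨cfg, time, trace, P, hl, hgood, hP, htime, hinv⟩
    · exact .inl hdone
    have hK : m * newColsBound n (longestCex trace) ≤ colsBound n (longestCex trace) :=
      Nat.mul_le_mul_right _ (by omega)
    obtain ⟨cfg', t, h', hrun, hg', hle, ht, hcase⟩ := hinv.round hT hD hU hn hlet hK hgood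
    have hl' : learn T letters (m + 1) = (cfg', time + t, h') := by
      simp only [learn, hl, hrun]
    have htime' : time + t ≤ (m + 1) * roundCost n (longestCex h') letters.length := by
      rw [Nat.succ_mul]
      exact Nat.add_le_add (htime.trans (Nat.mul_le_mul_left _ (roundCost_mono hle))) ht
    rcases hcase with ⟨H, rfl, hH, hP1⟩ | ⟨P', hP', hinv'⟩
    · exact .inl ⟨m + 1, H, time + t, h', hl', hH, hg',
        htime'.trans (Nat.mul_le_mul_right _ (by omega))⟩
    · refine .inr ⟨cfg', time + t, h', P', hl', hg', by omega, htime', hinv'.mono ?_⟩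
      rw [Nat.succ_mul]
      exact Nat.add_le_add_right (Nat.mul_le_mul_left _ (newColsBound_mono hle)) _

theorem exists_learn_eq_done (hT : T.IsCorrect U D) (hD : TrivialRightCongruence D)
    (hU : WDBARecognizable U) (hlet : ∀ a, a ∈ letters) :
    ∃ m H time trace, learn T letters m = (.done H, time, trace) ∧ Solves U D H ∧
      GoodTrace trace ∧
      time ≤ learnCost (index U D) (longestCex trace) letters.length := by
  rcases learn_invariant hT hD hU rfl hlet (roundsBound (index U D) + 1) with h | h
  · exact h
  · obtain ⟨_, _, _, _, _, _, h, _⟩ := h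
    omega

end Progress

theorem eval_learnCost (n ℓ a : ℕ) :
    MvPolynomial.eval ![n, ℓ, a]
      (learnCost (MvPolynomial.X 0) (MvPolynomial.X 1) (MvPolynomial.X 2)) = learnCost n ℓ a := by
  simp [learnCost, roundCost, roundsBound, colsBound, newColsBound, initialBound, sizeBound,
    tableCost, markBound, tryExponentCost, tryPowersCost, experimentBound, blockBound,
    markAllCost, markColCost, walkCost, loopWordCost, connectCost, pathToCost, expandAllCost,
    expandLettersCost, findPathCost, runFromCost, lookupCost, addSuffixesCost, transAllCost,
    transFromCost, fillRowCost]

end WDBALearning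

theorem theorem5 :
    ∃ p : MvPolynomial (Fin 3) ℕ,
      ∀ (A : Type) [Fintype A] [DecidableEq A] (letters : List A),
        letters.Nodup → (∀ a, a ∈ letters) →
      ∀ U D : Set (Stream' A), WDBARecognizable U → TrivialRightCongruence D →
      ∀ T : Teacher A, T.IsCorrect U D →
        ∃ (m : ℕ) (H : Hypothesis A) (time : ℕ) (trace : List (Event A)),
          learn T letters m = (Config.done H, time, trace) ∧
          IsWDBA H.toDFA ∧
          DEquiv D (omegaLang H.toDFA) U ∧
          IsDMinimal D H.toDFA ∧
          time ≤ MvPolynomial.eval ![index U D, longestCex trace, Fintype.card A] p ∧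
          (∀ (u v : List A) (ans : Answer),
            Event.member u v ans ∈ trace → v ≠ [] ∧ ans ≠ Answer.dontCare) := by
  refine ⟨learnCost (MvPolynomial.X 0) (MvPolynomial.X 1) (MvPolynomial.X 2), ?_⟩
  intro A _ _ letters hnodup hlet U D hU hD T hT
  obtain ⟨m, H, time, trace, hl, ⟨hM, hequiv, hmin⟩, hgood, htime⟩ :=
    exists_learn_eq_done hT hD hU hlet
  refine ⟨m, H, time, trace, hl, hM, hequiv, hmin, ?_, hgood⟩
  rw [eval_learnCost]
  refine htime.trans (le_of_eq ?_)
  rw [← List.toFinset_card_of_nodup hnodup, Finset.eq_univ_of_forall (s := letters.toFinset)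
    (by simpa using hlet), Finset.card_univ]
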